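/- Let $-\Lambda$ be the Laplace--Beltrami operator of the unit sphere $\mathbb S^{3}\subset\mathbb R^4$, extended homogeneously to $\mathbb R^4$ (so that it acts on each sphere centred at the origin). Its eigenvalues are $\mu_k=k(k+2)$, $k=0,1,2,\dots$, the eigenspaces being the spherical harmonics of degree $k$; with $H_k$ the projection onto the spherical harmonics of degree $k$, $(1-\Lambda)^{1/4}=\sum_{k\ge 0}(1+\mu_k)^{1/4}H_k$. Let $\|f\|_{\dot H^s(\mathbb R^4)}=\||\nabla|^sf\|_{L^2(\mathbb R^4)}$, and let $(1-\Delta)^{1/4}$ be the Fourier multiplier operator with symbol $(1+|\xi|^2)^{1/4}$ (where $-\Delta$ has the symbol $|\xi|^2$). Solutions are complex-valued and the equations hold in the sense of distributions. In each case below the function under the integral is well defined for almost every $t$, and both sides are finite. (i) Every solution $u\in C(\mathbb R;L^2(\mathbb R^4))$ of the Schrödinger equation $i\partial_tu+\frac12\Delta u=0$ on $\mathbb R^{4+1}$ satisfies \[ \int_{\mathbb R}\int_{\mathbb R^4}|(1-\Lambda)^{1/4}u(x,t)|^2\,\frac{dx\,dt}{|x|^2}=\pi\,\|u(0)\|_{L^2(\mathbb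 R^4)}^2 . \] (ii) Every solution $u\in C(\mathbb R;\dot H^{1/2}(\mathbb R^4))$ with $\partial_tu\in C(\mathbb R;\dot H^{-1/2}(\mathbb R^4))$ of the wave equation $\partial_{tt}u-\Delta u=0$ on $\mathbb R^{4+1}$ satisfies \[ 2\int_{\mathbb R}\int_{\mathbb R^4}|(1-\Lambda)^{1/4}u(x,t)|^2\,\frac{dx\,dt}{|x|^2}=\pi\left(\|u(0)\|_{\dot H^{1/2}(\mathbb R^4)}^2+\|\partial_tu(0)\|_{\dot H^{-1/2}(\mathbb R^4)}^2\right). \] (iii) Every solution $u$ of the Klein--Gordon equation $\partial_{tt}u-\Delta u+u=0$ on $\mathbb R^{4+1}$ with $u,\partial_tu\in C(\mathbb R;L^2(\mathbb R^4))$ and $\nabla u(0)\in L^2(\mathbb R^4)$ satisfies \[ 2\int_{\mathbb R}\int_{\mathbb R^4}|(1-\Delta)^{1/4}(1-\Lambda)^{1/4}u(x,t)|^2\,\frac{dx\,dt}{|x|^2}=\pi\left(\|u(0)\|_{L^2(\mathbb R^4)}^2+\|\nabla u(0)\|_{L^2(\mathbb R^4)}^2+\|\partial_tu(0)\|_{L^2(\mathbb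 R^4)}^2\right). \] -/

import Mathlib

open MeasureTheory Filter Topology FourierTransform Laplacian LineDeriv
open scoped ENNReal SchwartzMap

noncomputable section

namespace AngularSmoothing

/-- Euclidean space `ℝ^d`. -/
abbrev Eucl (d : ℕ) : Type := EuclideanSpace ℝ (Fin d)

/-- Complex tempered distributions on `ℝ^d`. -/
abbrev Distr (d : ℕ) : Type := 𝓢'(Eucl d, ℂ)

/-- The complex space `L²(ℝ^d)`. -/
abbrev L2 (d : ℕ) : Type := Lp ℂ 2 (volume : Measure (Eucl d))

/-- The tempered distribution `T` is (integration against) the function `v`. -/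
def Represents {d : ℕ} (T : Distr d) (v : Eucl d → ℂ) : Prop :=
  ∀ φ : 𝓢(Eucl d, ℂ), Integrable (fun x => φ x * v x) ∧ T φ = ∫ x, φ x * v x

/-! ### Functions of the Laplace–Beltrami operator of the sphere -/

/-- `p` is a solid spherical harmonic of degree `k`: a polynomial on `ℝ^d` that is homogeneous of
degree `k` and harmonic. The complex ones are the complex linear combinations of these. -/
def IsSolidHarmonic {d : ℕ} (k : ℕ) (p : MvPolynomial (Fin d) ℝ) : Prop :=
  p.IsHomogeneous k ∧ ∑ i, MvPolynomial.pderiv i (MvPolynomial.pderiv i p) = 0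

/-- The surface measure of the unit sphere of `ℝ^d`. -/
def sphereMeasure (d : ℕ) : Measure (Metric.sphere (0 : Eucl d) 1) :=
  (volume : Measure (Eucl d)).toSphere

/-- The spherical moment `∫ f(ω) p(ω) dω` of a function on the unit sphere. -/
def sphereMoment {d : ℕ} (f : Metric.sphere (0 : Eucl d) 1 → ℂ) (p : MvPolynomial (Fin d) ℝ) : ℂ :=
  ∫ ω, f ω * ((MvPolynomial.eval (fun i => (ω : Eucl d) i) p : ℝ) : ℂ) ∂(sphereMeasure d)

/-- The eigenvalue `μ_k = k (k + d - 2)` of the Laplace–Beltrami operator `-Λ` of the unit sphere of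
`ℝ^d`, whose eigenspace is the space of spherical harmonics of degree `k`. -/
def sphereEigenvalue (d k : ℕ) : ℝ := (k : ℝ) * ((k : ℝ) + (d : ℝ) - 2)

/-- `h = θ(-Λ) f` on the unit sphere, for `f, h ∈ L²`: for every `k` the orthogonal projections onto
the spherical harmonics of degree `k` satisfy `H_k h = θ(μ_k) H_k f`. -/
def IsSphereFunction {d : ℕ} (θ : ℝ → ℝ) (f h : Metric.sphere (0 : Eucl d) 1 → ℂ) : Prop :=
  MemLp f 2 (sphereMeasure d) ∧ MemLp h 2 (sphereMeasure d) ∧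
    ∀ (k : ℕ) (p : MvPolynomial (Fin d) ℝ), IsSolidHarmonic k p →
      sphereMoment h p = ((θ (sphereEigenvalue d k) : ℝ) : ℂ) * sphereMoment f p

/-- `w = θ(-Λ) v` on `ℝ^d`, where `θ(-Λ)` is extended homogeneously, that is, it acts on each sphere
centred at the origin: `w(r ·) = θ(-Λ) (v(r ·))` for almost every radius `r`. -/
def IsAngularFunction {d : ℕ} (θ : ℝ → ℝ) (v w : Eucl d → ℂ) : Prop :=
  ∀ᵐ r ∂((volume : Measure ℝ).restrict (Set.Ioi 0)),
    IsSphereFunction θ (fun ω : Metric.sphere (0 : Eucl d) 1 => v (r • (ω : Eucl d)))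
      (fun ω : Metric.sphere (0 : Eucl d) 1 => w (r • (ω : Eucl d)))

/-- `S = (1 - Λ)^σ T` for tempered distributions `S`, `T` that are functions. -/
def IsAngularPower {d : ℕ} (σ : ℝ) (T S : Distr d) : Prop :=
  ∃ v w : Eucl d → ℂ, Represents T v ∧ Represents S w ∧
    IsAngularFunction (fun ρ => (1 + ρ) ^ σ) v w

/-! ### Fractional powers of `1 - Δ` and homogeneous Sobolev norms

With the convention `𝓕 f (ξ) = ∫ f(x) exp(-2πi x·ξ) dx`, the operator `-Δ` has the symbol
`(2π|ξ|)²`, and `𝓕` is unitary on `L²`. -/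

/-- The symbol `(1 + (2π|ξ|)²)^σ` of `(1 - Δ)^σ`. -/
def inhomSymbol (d : ℕ) (σ : ℝ) (ξ : Eucl d) : ℝ := (1 + (2 * Real.pi * ‖ξ‖) ^ 2) ^ σ

theorem inhomSymbol_hasTemperateGrowth (d : ℕ) (σ : ℝ) :
    (fun ξ : Eucl d => ((inhomSymbol d σ ξ : ℝ) : ℂ)).HasTemperateGrowth := by
  have h := Function.hasTemperateGrowth_one_add_norm_sq_rpow (Eucl d) σ
  have h2 : (fun ξ : Eucl d => (2 * Real.pi) • ξ).HasTemperateGrowth :=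
    ((2 * Real.pi) • ContinuousLinearMap.id ℝ (Eucl d)).hasTemperateGrowth
  have h3 := h.comp h2
  have h4 : inhomSymbol d σ = (fun x : Eucl d => (1 + ‖x‖ ^ 2) ^ σ) ∘
      (fun ξ : Eucl d => (2 * Real.pi) • ξ) := by
    funext ξ
    simp [inhomSymbol, norm_smul, abs_of_pos Real.pi_pos]
  rw [← h4] at h3
  exact Complex.ofRealCLM.hasTemperateGrowth.comp h3

/-- The operator `(1 - Δ)^σ` on tempered distributions. -/
def oneSubLaplacianPow (d : ℕ) (σ : ℝ) : Distr d →L[ℂ] Distr d :=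
  TemperedDistribution.fourierMultiplierCLM ℂ (fun ξ => ((inhomSymbol d σ ξ : ℝ) : ℂ))

/-- The squared norm `‖|∇|^s T‖²` of `Ḣ^s(ℝ^d)` (for `|s| < d / 2`). It is `∞` if the Fourier
transform of `T` is not a function; if it is one, that function is unique almost everywhere. -/
def homSobolevSq {d : ℕ} (s : ℝ) (T : Distr d) : ℝ≥0∞ :=
  ⨅ (w : Eucl d → ℂ) (_ : Represents (𝓕 T) w),
    ∫⁻ ξ, ENNReal.ofReal (2 * Real.pi * ‖ξ‖) ^ (2 * s) * ‖w ξ‖ₑ ^ 2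

/-- The curve `u` belongs to `C(ℝ; Ḣ^s(ℝ^d))`. -/
def ContinuousInHomSobolev {d : ℕ} (s : ℝ) (u : ℝ → Distr d) : Prop :=
  (∀ t, homSobolevSq s (u t) < ⊤) ∧
    ∀ t₀, Tendsto (fun t => homSobolevSq s (u t - u t₀)) (𝓝 t₀) (𝓝 0)

/-! ### Solutions of the free equations -/

/-- `∂ₜ u = v` in the sense of distributions: for every test function `φ`, the function
`t ↦ ⟨u(t), φ⟩` has the derivative `⟨v(t), φ⟩`. -/
def HasTimeDeriv {d : ℕ} (u v : ℝ → Distr d) : Prop :=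
  ∀ (φ : 𝓢(Eucl d, ℂ)) (t : ℝ), HasDerivAt (fun s => u s φ) (v t φ) t

/-- `u ∈ C(ℝ; L²)` solves `i ∂ₜu + ½ Δu = 0`, that is, `∂ₜu = (i/2) Δu`. -/
structure IsSchrodingerSolution {d : ℕ} (u : ℝ → L2 d) : Prop where
  continuous : Continuous u
  equation : HasTimeDeriv (fun t => (u t : Distr d))
    (fun t => (Complex.I / 2) • Δ (u t : Distr d))

/-- `u ∈ C(ℝ; Ḣ^{1/2})`, with time derivative `u' ∈ C(ℝ; Ḣ^{-1/2})`, solves `∂ₜₜu - Δu = 0`. -/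
structure IsWaveSolution {d : ℕ} (u u' : ℝ → Distr d) : Prop where
  continuous : ContinuousInHomSobolev (1 / 2) u
  continuous_deriv : ContinuousInHomSobolev (-1 / 2) u'
  hasTimeDeriv : HasTimeDeriv u u'
  equation : HasTimeDeriv u' (fun t => Δ (u t))

/-- `u ∈ C(ℝ; L²)`, with time derivative `u' ∈ C(ℝ; L²)`, solves `∂ₜₜu - Δu + u = 0`. -/
structure IsKleinGordonSolution {d : ℕ} (u u' : ℝ → L2 d) : Prop where
  continuous : Continuous u
  continuous_deriv : Continuous u'
  hasTimeDeriv : HasTimeDeriv (fun t => (u t : Distr d)) (fun t => (u' t : Distr d))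
  equation : HasTimeDeriv (fun t => (u' t : Distr d))
    (fun t => Δ (u t : Distr d) - (u t : Distr d))

/-- `D` is the weak gradient of `f`, and it lies in `L²`. -/
def IsWeakGradient {d : ℕ} (f : L2 d) (D : Fin d → L2 d) : Prop :=
  ∀ j, ∂_{(EuclideanSpace.single j 1 : Eucl d)} (f : Distr d) = (D j : Distr d)

/-! ### Space-time functions -/

/-- `g = (1 - Λ)^σ u` as a measurable function of `(t, x)`. -/
structure IsAngularPowerOf {d : ℕ} (σ : ℝ) (u : ℝ → Distr d) (g : ℝ → Eucl d → ℂ) : Prop where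
  measurable : AEStronglyMeasurable (Function.uncurry g) (volume.prod volume)
  eq : ∀ᵐ t : ℝ, ∃ S : Distr d, IsAngularPower σ (u t) S ∧ Represents S (g t)

/-- `g = (1 - Δ)^κ (1 - Λ)^σ u` as a measurable function of `(t, x)`. -/
structure IsLaplacianAngularPowerOf {d : ℕ} (κ σ : ℝ) (u : ℝ → Distr d) (g : ℝ → Eucl d → ℂ) :
    Prop where
  measurable : AEStronglyMeasurable (Function.uncurry g) (volume.prod volume)
  eq : ∀ᵐ t : ℝ, ∃ S : Distr d, IsAngularPower σ (u t) S ∧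
    Represents (oneSubLaplacianPow d κ S) (g t)

/-- `∫_ℝ ∫_{ℝ^d} |g(t, x)|² |x|^{-2} dx dt`. -/
def weightedIntegral {d : ℕ} (g : ℝ → Eucl d → ℂ) : ℝ≥0∞ :=
  ∫⁻ t : ℝ, ∫⁻ x : Eucl d, ‖g t x‖ₑ ^ 2 / ‖x‖ₑ ^ 2

end AngularSmoothing

end

open MeasureTheory Filter Topology FourierTransform Laplacian LineDeriv
open scoped ENNReal SchwartzMap

noncomputable section

namespace AngularSmoothing


/-! ### Solid harmonics and completeness on the sphere -/

section Polynomials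

open MvPolynomial

variable {d : ℕ}

/-! In polar coordinates both sides split over spherical harmonics. In dimension four 1 + k(k+2) =
(k+1)², so (1-Λ)^{1/4} multiplies the degree k part by √(k+1). The claim becomes that the degree k
part of a free half-wave has squared norm π/(k+1) times that of its datum in L²(dt dx/|x|²),
different degrees being orthogonal.

On the Fourier side a solution is a sum of half-waves amp(|ξ|) e^{∓itφ(|ξ|)} f(ξ), with an extra
multiplier for Klein–Gordon, where φ is the dispersion relation and amp² = φ'/(4π²ρ). For a mode f =
b(|ξ|) p(ξ/|ξ|) with p harmonic of degree k, the Funk–Hecke formula (`sphereFourier_smul`) makes the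
half-wave at rω equal to p(ω) ∫ e^{∓itφ(ρ)} ρ³ amp(ρ) b(ρ) K(ρr) dρ, where K is the radial profile.
For fixed r, Plancherel in t after the substitution ρ ↦ φ(ρ) gives 2π ∫ ρ⁶ amp² |b|² |K(ρr)|² / φ'
dρ. The amplitude is chosen so that φ' cancels, which makes all three equations the same
computation. Integrating against r dr and scaling leaves ∫ |K|² r dr = 2π²/(k+1), and 2π · 1/(4π²) ·
2π²/(k+1) = π/(k+1). The two half-waves are orthogonal because φ > 0 puts their time spectra on
opposite half-lines. The result, polarised, is `Mode.inner_weighted_waveLp`.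

No theory of Bessel functions is needed. The Gaussian Fourier integral of a solid harmonic at
complex width z = 1 + 2πit is explicit (`gaussInt_eq`), and in polar coordinates it is a Schrödinger
time signal built from the profile. Injectivity of Plancherel in t then gives Funk–Hecke, and its
isometry, integrated in r, gives the normalisation `lintegral_radialProfile`.

Modes are total in the space of data (`denseRange_dataMap`), so the isometry passes to the limit. A
common subsequence converges on almost every time slice, and on almost every sphere inside it, which
identifies the limit as (1-Λ)^{1/4}u (`exists_smoothing`). Weak solutions are shown to be free
evolutions in Fourier space by `evolution_eq` and `oscillator_eq`. Completeness of spherical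
harmonics makes the angular power unique, so one admissible g decides the value for all. -/

/-- The Laplacian on polynomials. -/
def polyLap (p : MvPolynomial (Fin d) ℝ) : MvPolynomial (Fin d) ℝ :=
  ∑ i, pderiv i (pderiv i p)

/-- The polynomial `|x|²`. -/
def normSqPoly (d : ℕ) : MvPolynomial (Fin d) ℝ := ∑ i, X i ^ 2

theorem polyLap_add (p q : MvPolynomial (Fin d) ℝ) : polyLap (p + q) = polyLap p + polyLap q := by
  simp [polyLap, Finset.sum_add_distrib]

theorem polyLap_sub (p q : MvPolynomial (Fin d) ℝ) : polyLap (p - q) = polyLap p - polyLap q := by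
  simp [polyLap, Finset.sum_sub_distrib]

theorem polyLap_C_mul (c : ℝ) (p : MvPolynomial (Fin d) ℝ) :
    polyLap (C c * p) = C c * polyLap p := by
  simp [polyLap, Finset.mul_sum]

theorem isHomogeneous_normSqPoly : (normSqPoly d).IsHomogeneous 2 :=
  IsHomogeneous.sum _ _ _ fun i _ => isHomogeneous_X_pow i 2

theorem isHomogeneous_polyLap {n : ℕ} {p : MvPolynomial (Fin d) ℝ} (hp : p.IsHomogeneous n) :
    (polyLap p).IsHomogeneous (n - 2) :=
  IsHomogeneous.sum _ _ _ fun _ _ => hp.pderiv.pderiv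

theorem pderiv_normSqPoly (i : Fin d) : pderiv i (normSqPoly d) = 2 * X i := by
  simp only [normSqPoly, map_sum, pderiv_pow, pderiv_X]
  rw [Finset.sum_eq_single i] <;> simp +contextual

/-- The cross term 4 x·∇q is 4n q by Euler's identity, so the commutator of Δ with |x|² is a scalar
on homogeneous polynomials. -/
theorem polyLap_normSqPoly_mul {n : ℕ} {q : MvPolynomial (Fin d) ℝ} (hq : q.IsHomogeneous n) :
    polyLap (normSqPoly d * q) = normSqPoly d * polyLap q + C (2 * d + 4 * n : ℝ) * q := by
  have h : ∀ i, pderiv i (pderiv i (normSqPoly d * q)) =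
      2 * q + 4 * (X i * pderiv i q) + normSqPoly d * pderiv i (pderiv i q) := by
    intro i
    simp only [pderiv_mul, map_add, pderiv_normSqPoly, pderiv_X_self]
    have : pderiv i (2 : MvPolynomial (Fin d) ℝ) = 0 := by
      rw [← map_ofNat (C (R := ℝ) (σ := Fin d)) 2, pderiv_C]
    rw [this]; ring
  simp only [polyLap, h, Finset.sum_add_distrib, ← Finset.mul_sum, hq.sum_X_mul_pderiv]
  have h2 : (C 2 : MvPolynomial (Fin d) ℝ) = 2 := map_ofNat C 2
  have h4 : (C 4 : MvPolynomial (Fin d) ℝ) = 4 := map_ofNat C 4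
  simp [h2, h4]; ring

theorem polyLap_eq_zero_of_lt {n : ℕ} (hn : n < 2) {p : MvPolynomial (Fin d) ℝ}
    (hp : p.IsHomogeneous n) : polyLap p = 0 := by
  refine Finset.sum_eq_zero fun i _ => ?_
  have h0 : (pderiv i p).IsHomogeneous 0 := by
    have := hp.pderiv (i := i)
    rwa [show n - 1 = 0 by omega] at this
  rw [← totalDegree_zero_iff_isHomogeneous, totalDegree_eq_zero_iff_eq_C] at h0
  rw [h0, pderiv_C]

/-- The operator `|x|²Δ + c` is onto on homogeneous polynomials, for `c > 0`. -/
theorem exists_normSqPoly_mul_polyLap_add (n : ℕ) : ∀ (c : ℝ), 0 < c →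
    ∀ p : MvPolynomial (Fin d) ℝ, p.IsHomogeneous n →
      ∃ q, q.IsHomogeneous n ∧ normSqPoly d * polyLap q + C c * q = p := by
  induction n using Nat.strong_induction_on with
  | _ n ih =>
    intro c hc p hp
    have hcc : (C c⁻¹ * C c : MvPolynomial (Fin d) ℝ) = 1 := by
      rw [← C_mul, inv_mul_cancel₀ hc.ne', C_1]
    by_cases hn : n < 2
    · refine ⟨C c⁻¹ * p, ?_, ?_⟩
      · simpa using (isHomogeneous_C (Fin d) c⁻¹).mul hp
      · rw [polyLap_C_mul, polyLap_eq_zero_of_lt hn hp]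
        linear_combination p * hcc
    · push Not at hn
      obtain ⟨m, rfl⟩ := Nat.exists_eq_add_of_le' hn
      have hlap := isHomogeneous_polyLap hp
      rw [Nat.add_sub_cancel] at hlap
      -- Solving for Δp two degrees lower, with c raised by the commutator 2d + 4m, makes the
      -- Laplacian of (p - |x|²q)/c exactly q.
      obtain ⟨q, hq, hq'⟩ := ih m (by omega) (c + (2 * d + 4 * m)) (by positivity) _ hlap
      have key : polyLap (C c⁻¹ * (p - normSqPoly d * q)) = q := by
        rw [polyLap_C_mul, polyLap_sub, polyLap_normSqPoly_mul hq, ← hq', C_add]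
        linear_combination q * hcc
      refine ⟨C c⁻¹ * (p - normSqPoly d * q), ?_, ?_⟩
      · have h2 := isHomogeneous_normSqPoly.mul hq
        rw [add_comm] at h2
        simpa using (isHomogeneous_C (Fin d) c⁻¹).mul (hp.sub h2)
      · rw [key]
        linear_combination (p - normSqPoly d * q) * hcc

/-- Harmonicity of p - |x|²q means (|x|²Δ + 2d + 4n) q = Δp, and this operator is onto because the
constant is positive. -/
theorem exists_isSolidHarmonic_add (hd : 0 < d) (n : ℕ) (p : MvPolynomial (Fin d) ℝ)
    (hp : p.IsHomogeneous (n + 2)) :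
    ∃ h q, IsSolidHarmonic (n + 2) h ∧ q.IsHomogeneous n ∧ p = h + normSqPoly d * q := by
  have hlap := isHomogeneous_polyLap hp
  rw [Nat.add_sub_cancel] at hlap
  obtain ⟨q, hq, hq'⟩ := exists_normSqPoly_mul_polyLap_add n (2 * d + 4 * n) (by positivity) _ hlap
  refine ⟨p - normSqPoly d * q, q, ⟨hp.sub ?_, ?_⟩, hq, by ring⟩
  · have h2 := isHomogeneous_normSqPoly.mul hq
    rwa [add_comm] at h2
  · change polyLap _ = 0
    rw [polyLap_sub, polyLap_normSqPoly_mul hq, hq', sub_self]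

/-- The commutator of two derivations is a derivation, and this one kills every variable. -/
theorem pderiv_pderiv_comm (i j : Fin d) (p : MvPolynomial (Fin d) ℝ) :
    pderiv i (pderiv j p) = pderiv j (pderiv i p) := by
  have h : ⁅pderiv (R := ℝ) i, pderiv (R := ℝ) j⁆ = 0 := by
    refine MvPolynomial.derivation_ext fun l => ?_
    classical
    simp [Derivation.commutator_apply, pderiv_X, Pi.single_apply, apply_ite]
  have := congrArg (fun D => D p) h
  simpa [Derivation.commutator_apply, sub_eq_zero] using this

theorem isSolidHarmonic_pderiv {k : ℕ} {p : MvPolynomial (Fin d) ℝ} (hp : IsSolidHarmonic k p)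
    (i : Fin d) : IsSolidHarmonic (k - 1) (pderiv i p) := by
  refine ⟨hp.1.pderiv, ?_⟩
  have h : ∀ j, pderiv j (pderiv j (pderiv i p)) = pderiv i (pderiv j (pderiv j p)) := fun j => by
    rw [pderiv_pderiv_comm j i p, pderiv_pderiv_comm j i]
  simp only [h, ← map_sum, hp.2, map_zero]

end Polynomials

/-! ### Completeness of spherical harmonics in L² of the sphere -/

section Completeness

variable {d : ℕ}

instance : IsFiniteMeasure (sphereMeasure d) := by unfold sphereMeasure; infer_instance

/-- The value of a real polynomial at a point of `ℝ^d`. -/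
def polyVal (p : MvPolynomial (Fin d) ℝ) (x : Eucl d) : ℝ := MvPolynomial.eval (fun i => x i) p

theorem continuous_polyVal (p : MvPolynomial (Fin d) ℝ) : Continuous (polyVal p) := by
  unfold polyVal
  exact (MvPolynomial.continuous_eval p).comp (by fun_prop)

theorem polyVal_smul {k : ℕ} {p : MvPolynomial (Fin d) ℝ} (hp : p.IsHomogeneous k) (r : ℝ)
    (x : Eucl d) : polyVal p (r • x) = r ^ k * polyVal p x := by
  simp only [polyVal, MvPolynomial.eval_eq', Finset.mul_sum]
  refine Finset.sum_congr rfl fun e he => ?_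
  have hdeg : ∑ i, e i = k := by
    have h1 := hp (MvPolynomial.mem_support_iff.1 he)
    rw [← h1, Finsupp.weight_apply, Finsupp.sum_fintype _ _ (by simp)]
    simp
  simp only [PiLp.smul_apply, smul_eq_mul, mul_pow, Finset.prod_mul_distrib,
    Finset.prod_pow_eq_pow_sum, hdeg]
  ring

theorem sphereMoment_eq (f : Metric.sphere (0 : Eucl d) 1 → ℂ) (p : MvPolynomial (Fin d) ℝ) :
    sphereMoment f p = ∫ ω, f ω * ((polyVal p ω : ℝ) : ℂ) ∂(sphereMeasure d) := rfl

theorem exists_bound_polyVal_sphere (p : MvPolynomial (Fin d) ℝ) :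
    ∃ C, ∀ ω : Metric.sphere (0 : Eucl d) 1, ‖((polyVal p ω : ℝ) : ℂ)‖ ≤ C := by
  have hc : Continuous fun ω : Metric.sphere (0 : Eucl d) 1 => ((polyVal p ω : ℝ) : ℂ) :=
    Complex.continuous_ofReal.comp ((continuous_polyVal p).comp continuous_subtype_val)
  obtain ⟨C, hC⟩ := isCompact_univ.exists_bound_of_continuousOn hc.continuousOn
  exact ⟨C, fun ω => hC ω trivial⟩

theorem integrable_mul_polyVal {f : Metric.sphere (0 : Eucl d) 1 → ℂ}
    (hf : Integrable f (sphereMeasure d)) (p : MvPolynomial (Fin d) ℝ) :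
    Integrable (fun ω => f ω * ((polyVal p ω : ℝ) : ℂ)) (sphereMeasure d) := by
  obtain ⟨C, hC⟩ := exists_bound_polyVal_sphere p
  refine hf.mul_bdd ?_ (ae_of_all _ hC)
  exact (Complex.continuous_ofReal.comp
    ((continuous_polyVal p).comp continuous_subtype_val)).aestronglyMeasurable

theorem sphereMoment_add {f : Metric.sphere (0 : Eucl d) 1 → ℂ}
    (hf : Integrable f (sphereMeasure d)) (p q : MvPolynomial (Fin d) ℝ) :
    sphereMoment f (p + q) = sphereMoment f p + sphereMoment f q := by
  rw [sphereMoment_eq, sphereMoment_eq, sphereMoment_eq,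
    ← integral_add (integrable_mul_polyVal hf p) (integrable_mul_polyVal hf q)]
  simp [polyVal, mul_add]

theorem sphereMoment_smul (f : Metric.sphere (0 : Eucl d) 1 → ℂ) (c : ℝ)
    (p : MvPolynomial (Fin d) ℝ) : sphereMoment f (c • p) = c * sphereMoment f p := by
  rw [sphereMoment_eq, sphereMoment_eq, ← integral_const_mul]
  simp [polyVal, mul_left_comm, MvPolynomial.smul_eval]

theorem polyVal_normSqPoly (x : Eucl d) : polyVal (normSqPoly d) x = ‖x‖ ^ 2 := by
  simp [polyVal, normSqPoly, EuclideanSpace.norm_sq_eq]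

/-- On the sphere |x|² = 1, so the splitting p = h + |x|²q replaces p by a polynomial of degree two
less. -/
theorem sphereMoment_eq_zero_of_isHomogeneous (hd : 0 < d)
    {f : Metric.sphere (0 : Eucl d) 1 → ℂ} (hf : Integrable f (sphereMeasure d))
    (h : ∀ k p, IsSolidHarmonic k p → sphereMoment f p = 0) (n : ℕ) :
    ∀ p : MvPolynomial (Fin d) ℝ, p.IsHomogeneous n → sphereMoment f p = 0 := by
  induction n using Nat.strong_induction_on with
  | _ n ih =>
    intro p hp
    by_cases hn : n < 2
    · exact h n p ⟨hp, polyLap_eq_zero_of_lt hn hp⟩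
    · obtain ⟨m, rfl⟩ := Nat.exists_eq_add_of_le' (not_lt.1 hn)
      obtain ⟨g, q, hg, hq, rfl⟩ := exists_isSolidHarmonic_add hd m p hp
      rw [sphereMoment_add hf, h _ _ hg, zero_add, ← ih m (by omega) q hq]
      refine integral_congr_ae (ae_of_all _ fun ω => ?_)
      have h1 : polyVal (normSqPoly d) ω = 1 := by simp [polyVal_normSqPoly]
      have h2 : polyVal (normSqPoly d * q) ω = polyVal (normSqPoly d) ω * polyVal q ω := by
        simp [polyVal]
      rw [h1, one_mul] at h2
      simp only [polyVal] at h2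
      simp only [h2]

theorem sphereMoment_eq_zero (hd : 0 < d)
    {f : Metric.sphere (0 : Eucl d) 1 → ℂ} (hf : Integrable f (sphereMeasure d))
    (h : ∀ k p, IsSolidHarmonic k p → sphereMoment f p = 0) (p : MvPolynomial (Fin d) ℝ) :
    sphereMoment f p = 0 := by
  have key : ∀ s : Finset ℕ, sphereMoment f (∑ i ∈ s, MvPolynomial.homogeneousComponent i p) = 0 := by
    intro s
    induction s using Finset.induction_on with
    | empty => simp [sphereMoment]
    | insert a s ha ih =>
      rw [Finset.sum_insert ha, sphereMoment_add hf, ih, add_zero]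
      exact sphereMoment_eq_zero_of_isHomogeneous hd hf h a _
        (MvPolynomial.homogeneousComponent_isHomogeneous a p)
  rw [← MvPolynomial.sum_homogeneousComponent p]
  exact key _

/-- The restriction of polynomials to the sphere. -/
def sphereRestrict (d : ℕ) :
    MvPolynomial (Fin d) ℝ →ₐ[ℝ] C(Metric.sphere (0 : Eucl d) 1, ℝ) :=
  MvPolynomial.aeval fun i => ⟨fun ω => (ω : Eucl d) i, by fun_prop⟩

theorem sphereRestrict_apply (p : MvPolynomial (Fin d) ℝ) (ω : Metric.sphere (0 : Eucl d) 1) :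
    sphereRestrict d p ω = polyVal p ω := by
  induction p using MvPolynomial.induction_on with
  | C a => simp [sphereRestrict, polyVal]
  | add p q hp hq => simp [polyVal] at hp hq ⊢; rw [hp, hq]
  | mul_X p i hp => simp [polyVal] at hp ⊢; rw [hp]; simp [sphereRestrict]

/-- Stone–Weierstrass: the coordinate functions separate points. -/
theorem dense_range_sphereRestrict : DenseRange (sphereRestrict d) := by
  have h := ContinuousMap.subalgebra_topologicalClosure_eq_top_of_separatesPoints
    (sphereRestrict d).range ?_
  · have h2 : ((sphereRestrict d).range.topologicalClosure : Set C(Metric.sphere (0 : Eucl d) 1, ℝ)) =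
        Set.univ := by rw [h]; rfl
    rw [Subalgebra.topologicalClosure_coe] at h2
    rw [DenseRange, dense_iff_closure_eq, ← h2]
    rfl
  · intro x y hxy
    obtain ⟨i, hi⟩ : ∃ i, (x : Eucl d) i ≠ (y : Eucl d) i := by
      by_contra! hcon
      exact hxy (Subtype.ext (PiLp.ext hcon))
    refine ⟨_, ⟨sphereRestrict d (MvPolynomial.X i), ⟨MvPolynomial.X i, rfl⟩, rfl⟩, ?_⟩
    simpa [sphereRestrict_apply, polyVal] using hi

/-- For integrable f the pairing is Lipschitz in g for the sup norm, and it vanishes on the dense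
set of polynomials. -/
theorem integral_mul_continuous_eq_zero (hd : 0 < d)
    {f : Metric.sphere (0 : Eucl d) 1 → ℂ} (hf : Integrable f (sphereMeasure d))
    (h : ∀ k p, IsSolidHarmonic k p → sphereMoment f p = 0)
    (g : C(Metric.sphere (0 : Eucl d) 1, ℝ)) : ∫ ω, f ω * (g ω : ℂ) ∂(sphereMeasure d) = 0 := by
  have hbd : ∀ (g : C(Metric.sphere (0 : Eucl d) 1, ℝ)) ω, ‖((g ω : ℝ) : ℂ)‖ ≤ ‖g‖ := fun g ω => by
    simpa using g.norm_coe_le_norm ω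
  have hInt : ∀ g : C(Metric.sphere (0 : Eucl d) 1, ℝ),
      Integrable (fun ω => f ω * (g ω : ℂ)) (sphereMeasure d) := fun g =>
    hf.mul_bdd (c := ‖g‖) (by fun_prop) (ae_of_all _ (hbd g))
  have hcont : Continuous fun g : C(Metric.sphere (0 : Eucl d) 1, ℝ) =>
      ∫ ω, f ω * (g ω : ℂ) ∂(sphereMeasure d) := by
    refine (LipschitzWith.of_dist_le_mul (K := (∫ ω, ‖f ω‖ ∂(sphereMeasure d)).toNNReal)
      fun g g' => ?_).continuous
    rw [dist_eq_norm, ← integral_sub (hInt g) (hInt g'),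
      Real.coe_toNNReal _ (integral_nonneg fun _ => norm_nonneg _), ← integral_mul_const]
    refine norm_integral_le_of_norm_le (hf.norm.mul_const _) (ae_of_all _ fun ω => ?_)
    rw [← mul_sub, norm_mul, dist_eq_norm]
    gcongr
    simpa using hbd (g - g') ω
  have := dense_range_sphereRestrict.equalizer hcont (continuous_const (y := (0 : ℂ))) ?_
  · exact congrFun this g
  · funext p
    simp only [Function.comp, sphereRestrict_apply]
    exact sphereMoment_eq_zero hd hf h p

/-- Spherical harmonics are complete in `L²` of the sphere. -/
theorem ae_eq_zero_of_sphereMoment_eq_zero (hd : 0 < d)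
    {f : Metric.sphere (0 : Eucl d) 1 → ℂ} (hf : MemLp f 2 (sphereMeasure d))
    (h : ∀ k p, IsSolidHarmonic k p → sphereMoment f p = 0) : f =ᵐ[sphereMeasure d] 0 := by
  have hfi := hf.integrable one_le_two
  have hz : hf.toLp f = 0 := by
    refine (ContinuousMap.toLp_denseRange ℂ (sphereMeasure d) ℂ (p := 2)
      (by simp)).eq_zero_of_inner_right ℂ fun g => ?_
    -- The real test functions are the real and imaginary parts of g; the inner product conjugates
    -- g, whence the minus sign in `h3`.
    have h1 := integral_mul_continuous_eq_zero hd hfi h ⟨fun ω => (g ω).re, by fun_prop⟩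
    have h2 := integral_mul_continuous_eq_zero hd hfi h ⟨fun ω => (g ω).im, by fun_prop⟩
    have hb : ∀ v : C(Metric.sphere (0 : Eucl d) 1, ℝ),
        Integrable (fun ω => f ω * (v ω : ℂ)) (sphereMeasure d) := fun v =>
      hfi.mul_bdd (c := ‖v‖) (by fun_prop)
        (ae_of_all _ fun ω => by simpa using v.norm_coe_le_norm ω)
    have h3 : ∫ ω, (f ω * (((g ω).re : ℝ) : ℂ) - Complex.I * (f ω * (((g ω).im : ℝ) : ℂ)))
        ∂(sphereMeasure d) = 0 := by
      have hb1 : Integrable (fun ω => f ω * (((g ω).re : ℝ) : ℂ)) (sphereMeasure d) :=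
        hb ⟨fun ω => (g ω).re, by fun_prop⟩
      have hb2 : Integrable (fun ω => f ω * (((g ω).im : ℝ) : ℂ)) (sphereMeasure d) :=
        hb ⟨fun ω => (g ω).im, by fun_prop⟩
      rw [integral_sub hb1 (hb2.const_mul _), integral_const_mul]
      simp only [ContinuousMap.coe_mk] at h1 h2
      rw [h1, h2]; simp
    rw [MeasureTheory.L2.inner_def, ← h3]
    refine integral_congr_ae ?_
    filter_upwards [hf.coeFn_toLp, ContinuousMap.coeFn_toLp (𝕜 := ℂ) (p := 2) (sphereMeasure d) g]
      with ω h4 h5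
    rw [h4, h5, RCLike.inner_apply]
    nth_rewrite 1 [← Complex.re_add_im (g ω)]
    simp only [map_add, map_mul, Complex.conj_ofReal, Complex.conj_I]
    ring
  have h0 := hf.coeFn_toLp
  rw [hz] at h0
  exact h0.symm.trans (Lp.coeFn_zero _ _ _)

/-- Interchanging quantification over harmonic polynomials and almost everywhere. -/
theorem ae_forall_sphereMoment {Y : Type*} [MeasurableSpace Y] {μ : Measure Y}
    {f h : Y → Metric.sphere (0 : Eucl d) 1 → ℂ} (c : ℕ → ℂ)
    (hf : ∀ᵐ y ∂μ, Integrable (f y) (sphereMeasure d))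
    (hh : ∀ᵐ y ∂μ, Integrable (h y) (sphereMeasure d))
    (H : ∀ k p, IsSolidHarmonic k p → ∀ᵐ y ∂μ, sphereMoment (h y) p = c k * sphereMoment (f y) p) :
    ∀ᵐ y ∂μ, ∀ k p, IsSolidHarmonic k p → sphereMoment (h y) p = c k * sphereMoment (f y) p := by
  rw [ae_all_iff]
  intro k
  -- Harmonic polynomials of degree k form a finitely generated space, so only finitely many
  -- exceptional null sets occur for each k.
  let Hk : Submodule ℝ (MvPolynomial (Fin d) ℝ) :=
    { carrier := {p | IsSolidHarmonic k p}
      zero_mem' := ⟨MvPolynomial.isHomogeneous_zero _ _ _, by simp⟩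
      add_mem' := fun {a b} ha hb => ⟨ha.1.add hb.1, by
        have := polyLap_add a b
        unfold polyLap at this
        rw [this, ha.2, hb.2, add_zero]⟩
      smul_mem' := fun a b hb => ⟨by
        rw [MvPolynomial.smul_eq_C_mul]
        simpa using (MvPolynomial.isHomogeneous_C (Fin d) a).mul hb.1, by
        have := polyLap_C_mul a b
        unfold polyLap at this
        rw [MvPolynomial.smul_eq_C_mul, this, hb.2, mul_zero]⟩ }
  have hle : Hk ≤ MvPolynomial.homogeneousSubmodule (Fin d) ℝ k := fun p hp => hp.1
  have : Module.Finite ℝ (MvPolynomial.homogeneousSubmodule (Fin d) ℝ k) :=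
    Module.Finite.iff_fg.2 (MvPolynomial.homogeneousSubmodule_fg _ _ k)
  have hfg : Hk.FG := Submodule.FG.of_le_of_isNoetherian hle
  obtain ⟨s, hs⟩ := hfg
  have hall : ∀ᵐ y ∂μ, ∀ p ∈ s, sphereMoment (h y) p = c k * sphereMoment (f y) p := by
    rw [Finset.eventually_all]
    exact fun p hp => H k p (hs ▸ Submodule.subset_span hp : p ∈ Hk)
  filter_upwards [hall, hf, hh] with y hy hfy hhy p hp
  have hp' : p ∈ Submodule.span ℝ (s : Set (MvPolynomial (Fin d) ℝ)) := by rw [hs]; exact hp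
  clear hp
  induction hp' using Submodule.span_induction with
  | mem x hx => exact hy x hx
  | zero => simp [sphereMoment]
  | add a b _ _ ha hb => rw [sphereMoment_add hhy, sphereMoment_add hfy, ha, hb, mul_add]
  | smul a b _ hb => rw [sphereMoment_smul, sphereMoment_smul, hb, mul_left_comm]

end Completeness


/-! ### Polar coordinates in `ℝ⁴` -/

section Polar

/-- The unit sphere of `ℝ⁴`. -/
abbrev S3 : Type := Metric.sphere (0 : Eucl 4) 1

/-- The measure `rⁿ dr` on the half line. -/
def radialMeasure (n : ℕ) : Measure ℝ :=
  (volume.restrict (Set.Ioi 0)).withDensity fun r => ENNReal.ofReal (r ^ n)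

/-- The polar coordinate map. -/
def polarMap (q : ℝ × S3) : Eucl 4 := q.1 • (q.2 : Eucl 4)

theorem continuous_polarMap : Continuous polarMap := by unfold polarMap; fun_prop

instance (n : ℕ) : SigmaFinite (radialMeasure n) := by
  unfold radialMeasure
  exact SigmaFinite.withDensity_of_ne_top (ae_of_all _ fun r => ENNReal.ofReal_ne_top)

theorem radialMeasure_ac (n : ℕ) : radialMeasure n ≪ volume.restrict (Set.Ioi 0) :=
  withDensity_absolutelyContinuous _ _

theorem ac_radialMeasure (n : ℕ) : volume.restrict (Set.Ioi 0) ≪ radialMeasure n := by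
  refine withDensity_absolutelyContinuous' (by fun_prop) ?_
  filter_upwards [ae_restrict_mem measurableSet_Ioi] with r hr
  simpa using pow_pos hr n

theorem ae_radialMeasure_iff (n : ℕ) {p : ℝ → Prop} :
    (∀ᵐ r ∂(radialMeasure n), p r) ↔ ∀ᵐ r ∂(volume.restrict (Set.Ioi (0 : ℝ))), p r :=
  ⟨fun h => (ac_radialMeasure n).ae_le h, fun h => (radialMeasure_ac n).ae_le h⟩

theorem ae_radialMeasure_pos (n : ℕ) : ∀ᵐ r ∂(radialMeasure n), 0 < r :=
  (ae_radialMeasure_iff n).2 (ae_restrict_mem measurableSet_Ioi)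

theorem lintegral_radialMeasure (n : ℕ) (f : ℝ → ℝ≥0∞) :
    ∫⁻ r, f r ∂(radialMeasure n) = ∫⁻ r in Set.Ioi 0, ENNReal.ofReal (r ^ n) * f r := by
  unfold radialMeasure
  rw [lintegral_withDensity_eq_lintegral_mul_non_measurable _ (by fun_prop) (by simp)]
  rfl

theorem integral_radialMeasure (n : ℕ) (f : ℝ → ℂ) :
    ∫ r, f r ∂(radialMeasure n) = ∫ r in Set.Ioi (0 : ℝ), (r ^ n : ℝ) * f r := by
  unfold radialMeasure
  rw [integral_withDensity_eq_integral_toReal_smul (by fun_prop) (by simp)]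
  refine setIntegral_congr_fun measurableSet_Ioi fun r hr => ?_
  rw [ENNReal.toReal_ofReal (pow_nonneg (le_of_lt hr) n), Complex.real_smul]

theorem map_val_volumeIoiPow (n : ℕ) :
    (Measure.volumeIoiPow n).map (Subtype.val : Set.Ioi (0 : ℝ) → ℝ) = radialMeasure n := by
  ext s hs
  rw [Measure.map_apply measurable_subtype_coe hs, Measure.volumeIoiPow, radialMeasure,
    withDensity_apply _ (measurable_subtype_coe hs), withDensity_apply _ hs,
    ← lintegral_indicator (measurable_subtype_coe hs), ← lintegral_indicator hs]
  have := lintegral_subtype_comap (μ := (volume : Measure ℝ)) (s := Set.Ioi (0 : ℝ))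
    measurableSet_Ioi (s.indicator fun r => ENNReal.ofReal (r ^ n))
  rw [← this]
  rfl

theorem measurePreserving_polarMap :
    MeasurePreserving polarMap ((radialMeasure 3).prod (sphereMeasure 4)) volume := by
  refine ⟨continuous_polarMap.measurable, ?_⟩
  have h1 := Measure.measurePreserving_homeomorphUnitSphereProd (volume : Measure (Eucl 4))
  rw [show Module.finrank ℝ (Eucl 4) - 1 = 3 by simp] at h1
  have h2 := (h1.symm (homeomorphUnitSphereProd (Eucl 4)).toMeasurableEquiv).map_eq
  have h3 : (radialMeasure 3).prod (sphereMeasure 4) =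
      ((sphereMeasure 4).prod (Measure.volumeIoiPow 3)).map
        (Prod.map Subtype.val id ∘ Prod.swap) := by
    rw [← Measure.map_map (by fun_prop) measurable_swap, Measure.prod_swap,
      ← Measure.map_prod_map _ _ measurable_subtype_coe measurable_id, map_val_volumeIoiPow,
      Measure.map_id]
  rw [h3, Measure.map_map continuous_polarMap.measurable (by fun_prop)]
  have h4 : polarMap ∘ (Prod.map Subtype.val id ∘ Prod.swap) =
      (Subtype.val : ({0}ᶜ : Set (Eucl 4)) → Eucl 4) ∘
        (homeomorphUnitSphereProd (Eucl 4)).toMeasurableEquiv.symm := by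
    funext q
    simp [polarMap]
  rw [h4, ← Measure.map_map measurable_subtype_coe (by fun_prop)]
  change Measure.map _ (Measure.map _ ((volume : Measure (Eucl 4)).toSphere.prod _)) = _
  rw [h2, map_comap_subtype_coe (measurableSet_singleton _).compl]
  exact Measure.restrict_eq_self_of_ae_mem (by simp [ae_iff])

theorem lintegral_polar {f : Eucl 4 → ℝ≥0∞} (hf : AEMeasurable f) :
    ∫⁻ x, f x = ∫⁻ r, ∫⁻ ω, f (r • (ω : Eucl 4)) ∂(sphereMeasure 4) ∂(radialMeasure 3) := by
  rw [← measurePreserving_polarMap.map_eq] at hf ⊢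
  rw [lintegral_map' hf continuous_polarMap.aemeasurable, lintegral_prod]
  · rfl
  · exact hf.comp_measurable continuous_polarMap.measurable

theorem integrable_polar {f : Eucl 4 → ℂ} (hf : Integrable f) :
    Integrable (fun q : ℝ × S3 => f (q.1 • (q.2 : Eucl 4)))
      ((radialMeasure 3).prod (sphereMeasure 4)) :=
  measurePreserving_polarMap.integrable_comp_of_integrable hf

theorem integral_polar {f : Eucl 4 → ℂ} (hf : Integrable f) :
    ∫ x, f x = ∫ r, ∫ ω, f (r • (ω : Eucl 4)) ∂(sphereMeasure 4) ∂(radialMeasure 3) := by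
  have h1 := integrable_polar hf
  rw [integral_integral h1]
  rw [← measurePreserving_polarMap.map_eq] at hf ⊢
  rw [integral_map continuous_polarMap.aemeasurable hf.1]
  rfl

theorem ae_polar {p : Eucl 4 → Prop} (h : ∀ᵐ x, p x) :
    ∀ᵐ r ∂(volume.restrict (Set.Ioi (0 : ℝ))), ∀ᵐ ω : S3 ∂(sphereMeasure 4), p (r • (ω : Eucl 4)) := by
  rw [← ae_radialMeasure_iff 3]
  exact Measure.ae_ae_of_ae_prod (measurePreserving_polarMap.quasiMeasurePreserving.ae h)

theorem ae_eq_of_ae_polar {f g : Eucl 4 → ℂ} (hf : AEStronglyMeasurable f)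
    (hg : AEStronglyMeasurable g)
    (h : ∀ᵐ r ∂(volume.restrict (Set.Ioi (0 : ℝ))), ∀ᵐ ω : S3 ∂(sphereMeasure 4),
      f (r • (ω : Eucl 4)) = g (r • (ω : Eucl 4))) : f =ᵐ[volume] g := by
  have h0 : ∫⁻ x, ‖(f - g) x‖ₑ = 0 := by
    rw [lintegral_polar (hf.sub hg).enorm]
    refine (lintegral_congr_ae ((ae_radialMeasure_iff 3).2 ?_)).trans lintegral_zero
    filter_upwards [h] with r hr
    refine (lintegral_congr_ae ?_).trans lintegral_zero
    filter_upwards [hr] with ω hω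
    simp [hω]
  rw [lintegral_eq_zero_iff' (hf.sub hg).enorm] at h0
  filter_upwards [h0] with x hx
  simpa [sub_eq_zero] using hx

/-- The measure `dx / |x|²` on `ℝ⁴`. -/
def weightMeasure : Measure (Eucl 4) := volume.withDensity fun x => (‖x‖ₑ ^ 2)⁻¹

theorem measurable_weight : Measurable fun x : Eucl 4 => (‖x‖ₑ ^ 2)⁻¹ := by fun_prop

instance : SFinite weightMeasure := by unfold weightMeasure; infer_instance

theorem lintegral_weightMeasure {f : Eucl 4 → ℝ≥0∞} (hf : AEMeasurable f) :
    ∫⁻ x, f x ∂weightMeasure = ∫⁻ x, f x / ‖x‖ₑ ^ 2 := by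
  rw [weightMeasure, lintegral_withDensity_eq_lintegral_mul₀ measurable_weight.aemeasurable hf]
  refine lintegral_congr fun x => ?_
  rw [Pi.mul_apply, mul_comm, div_eq_mul_inv]

theorem ac_weightMeasure : (volume : Measure (Eucl 4)) ≪ weightMeasure :=
  withDensity_absolutelyContinuous' measurable_weight.aemeasurable
    (ae_of_all _ fun x => by simp)

theorem norm_smul_sphere {r : ℝ} (hr : 0 < r) (ω : S3) : ‖r • (ω : Eucl 4)‖ = r := by
  rw [norm_smul, norm_eq_of_mem_sphere ω, mul_one, Real.norm_of_nonneg hr.le]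

/-- Dividing by |x|² turns the radial density r³ into r. Hence `radialMeasure 1` carries the
space-time norm and `radialMeasure 3` the norm of the data. -/
theorem measurePreserving_polarMap_weight :
    MeasurePreserving polarMap ((radialMeasure 1).prod (sphereMeasure 4)) weightMeasure := by
  refine ⟨continuous_polarMap.measurable, ?_⟩
  ext s hs
  have hind : Measurable (s.indicator (1 : Eucl 4 → ℝ≥0∞)) := measurable_one.indicator hs
  rw [← lintegral_indicator_one hs, ← lintegral_indicator_one hs,
    lintegral_map hind continuous_polarMap.measurable,
    lintegral_prod (fun a => s.indicator 1 (polarMap a))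
      (hind.comp continuous_polarMap.measurable).aemeasurable,
    lintegral_weightMeasure hind.aemeasurable, lintegral_polar (by fun_prop),
    lintegral_radialMeasure, lintegral_radialMeasure]
  refine setLIntegral_congr_fun measurableSet_Ioi fun r hr => ?_
  have hr' : (0 : ℝ) < r := hr
  have hne : ENNReal.ofReal r ≠ 0 := by simpa using hr'
  have h1 : ∀ ω : S3, ‖r • (ω : Eucl 4)‖ₑ = ENNReal.ofReal r := fun ω => by
    rw [← ofReal_norm, norm_smul_sphere hr']
  simp only [h1]
  have hm : Measurable fun ω : S3 => s.indicator (1 : Eucl 4 → ℝ≥0∞) (polarMap (r, ω)) :=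
    hind.comp (continuous_polarMap.measurable.comp (measurable_const.prodMk measurable_id))
  change _ = _ * ∫⁻ ω : S3, s.indicator 1 (polarMap (r, ω)) / ENNReal.ofReal r ^ 2 ∂_
  rw [← lintegral_const_mul _ hm, ← lintegral_const_mul _ (hm.div_const _)]
  refine lintegral_congr fun ω => ?_
  rw [ENNReal.ofReal_pow hr'.le, ENNReal.ofReal_pow hr'.le, div_eq_mul_inv, mul_comm _ (_⁻¹),
    ← mul_assoc]
  congr 1
  rw [pow_succ (ENNReal.ofReal r) 2, mul_comm, ← mul_assoc,
    ENNReal.inv_mul_cancel (by simpa using hr') (by simp), one_mul, pow_one]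

end Polar


/-! ### Uniqueness -/

section Uniqueness

/-- Testing against a bump function equal to 1 on a ball gives integrability on that ball. -/
theorem Represents.locallyIntegrable {d : ℕ} {T : Distr d} {v : Eucl d → ℂ} (h : Represents T v) :
    LocallyIntegrable v := by
  intro x
  let f : ContDiffBump x := ⟨1, 2, one_pos, one_lt_two⟩
  have hf : ContDiff ℝ (⊤ : ℕ∞) (fun y => ((f y : ℝ) : ℂ)) := Complex.ofRealCLM.contDiff.comp f.contDiff
  have hc : HasCompactSupport (fun y => ((f y : ℝ) : ℂ)) :=
    f.hasCompactSupport.comp_left Complex.ofReal_zero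
  have hi := (h (hc.toSchwartzMap hf)).1
  refine ⟨Metric.ball x 1, Metric.ball_mem_nhds x one_pos, ?_⟩
  refine (hi.integrableOn (s := Metric.ball x 1)).congr_fun (fun y hy => ?_) measurableSet_ball
  have h1 : f y = 1 := f.one_of_mem_closedBall (Metric.ball_subset_closedBall hy)
  simp [h1]

theorem Represents.ae_eq {d : ℕ} {T : Distr d} {v v' : Eucl d → ℂ} (h : Represents T v)
    (h' : Represents T v') : v =ᵐ[volume] v' := by
  refine ae_eq_of_integral_contDiff_smul_eq h.locallyIntegrable h'.locallyIntegrable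
    fun g hg hgc => ?_
  have hf : ContDiff ℝ (⊤ : ℕ∞) (fun y => ((g y : ℝ) : ℂ)) := Complex.ofRealCLM.contDiff.comp hg
  have hc : HasCompactSupport (fun y => ((g y : ℝ) : ℂ)) := hgc.comp_left Complex.ofReal_zero
  have h1 := (h (hc.toSchwartzMap hf)).2
  have h2 := (h' (hc.toSchwartzMap hf)).2
  rw [h1] at h2
  simpa using h2

theorem Represents.congr {d : ℕ} {T : Distr d} {v v' : Eucl d → ℂ} (h : Represents T v)
    (h' : v =ᵐ[volume] v') : Represents T v' := by
  intro φ
  have h1 : (fun x => φ x * v x) =ᵐ[volume] fun x => φ x * v' x := by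
    filter_upwards [h'] with x hx
    rw [hx]
  exact ⟨(h φ).1.congr h1, by rw [(h φ).2, integral_congr_ae h1]⟩

theorem Represents.distr_eq {d : ℕ} {T T' : Distr d} {v : Eucl d → ℂ} (h : Represents T v)
    (h' : Represents T' v) : T = T' := by
  ext φ
  rw [(h φ).2, (h' φ).2]

/-- The representatives of T agree on almost every sphere, so there w - w' has vanishing moments
against all harmonics, and completeness applies. -/
theorem IsAngularPower.unique {σ : ℝ} {T S S' : Distr 4} (h : IsAngularPower σ T S)
    (h' : IsAngularPower σ T S') : S = S' := by
  obtain ⟨v, w, hv, hw, H⟩ := h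
  obtain ⟨v', w', hv', hw', H'⟩ := h'
  have hww : w =ᵐ[volume] w' := by
    refine ae_eq_of_ae_polar hw.locallyIntegrable.aestronglyMeasurable
      hw'.locallyIntegrable.aestronglyMeasurable ?_
    filter_upwards [H, H', ae_polar (hv.ae_eq hv')] with r hr hr' hvr
    have h0 := ae_eq_zero_of_sphereMoment_eq_zero (by norm_num) (hr.2.1.sub hr'.2.1) ?_
    · filter_upwards [h0] with ω hω
      simpa [sub_eq_zero] using hω
    · intro k p hp
      have hm : sphereMoment (fun ω : S3 => v (r • (ω : Eucl 4))) p =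
          sphereMoment (fun ω : S3 => v' (r • (ω : Eucl 4))) p := by
        refine integral_congr_ae ?_
        filter_upwards [hvr] with ω hω
        rw [hω]
      have e := hr.2.2 k p hp
      rw [hm, ← hr'.2.2 k p hp, sphereMoment_eq, sphereMoment_eq] at e
      rw [sphereMoment_eq, ← sub_eq_zero.2 e,
        ← integral_sub (integrable_mul_polyVal (hr.2.1.integrable one_le_two) p)
          (integrable_mul_polyVal (hr'.2.1.integrable one_le_two) p)]
      simp [sub_mul]
  exact (hw.congr hww).distr_eq hw'

theorem weightedIntegral_congr {g g' : ℝ → Eucl 4 → ℂ} (h : ∀ᵐ t, g t =ᵐ[volume] g' t) :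
    weightedIntegral g = weightedIntegral g' := by
  refine lintegral_congr_ae ?_
  filter_upwards [h] with t ht
  refine lintegral_congr_ae ?_
  filter_upwards [ht] with x hx
  rw [hx]

/-- Reduces an identity for every admissible g to the construction of a single g. -/
theorem IsAngularPowerOf.weightedIntegral_eq {σ : ℝ} {u : ℝ → Distr 4} {g g' : ℝ → Eucl 4 → ℂ}
    (h : IsAngularPowerOf σ u g) (h' : IsAngularPowerOf σ u g') :
    weightedIntegral g = weightedIntegral g' := by
  refine weightedIntegral_congr ?_
  filter_upwards [h.eq, h'.eq] with t ⟨S, hS, hg⟩ ⟨S', hS', hg'⟩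
  rw [← hS.unique hS'] at hg'
  exact hg.ae_eq hg'

theorem IsLaplacianAngularPowerOf.weightedIntegral_eq {κ σ : ℝ} {u : ℝ → Distr 4}
    {g g' : ℝ → Eucl 4 → ℂ} (h : IsLaplacianAngularPowerOf κ σ u g)
    (h' : IsLaplacianAngularPowerOf κ σ u g') : weightedIntegral g = weightedIntegral g' := by
  refine weightedIntegral_congr ?_
  filter_upwards [h.eq, h'.eq] with t ⟨S, hS, hg⟩ ⟨S', hS', hg'⟩
  rw [← hS.unique hS'] at hg'
  exact hg.ae_eq hg'

end Uniqueness


/-! ### Gaussian integrals of solid harmonics -/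

section Gaussian

open MvPolynomial (pderiv X)

theorem hasDerivAt_polyVal {d : ℕ} (p : MvPolynomial (Fin d) ℝ) (i : Fin d) (x : Eucl d) :
    HasLineDerivAt ℝ (polyVal p) (polyVal (pderiv i p) x) x (EuclideanSpace.single i 1) := by
  unfold HasLineDerivAt
  induction p using MvPolynomial.induction_on with
  | C a => simpa [polyVal] using hasDerivAt_const (0 : ℝ) a
  | add p q hp hq => simpa [polyVal] using hp.fun_add hq
  | mul_X p j hp =>
    have h1 : HasDerivAt (fun t : ℝ => polyVal (X j) (x + t • EuclideanSpace.single i (1 : ℝ)))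
        (polyVal (pderiv i (X j)) x) 0 := by
      have h2 : (fun t : ℝ => polyVal (X j : MvPolynomial (Fin d) ℝ)
          (x + t • EuclideanSpace.single i (1 : ℝ))) =
          fun t => x j + t * (Pi.single i (1 : ℝ) : Fin d → ℝ) j := by
        classical
        funext t; simp [polyVal, Pi.single_apply]
      rw [h2]
      have h3 : polyVal (pderiv i (X j)) x = (Pi.single i (1 : ℝ) : Fin d → ℝ) j := by
        classical
        rw [MvPolynomial.pderiv_X, Pi.single_apply, Pi.single_apply]
        split_ifs <;> simp_all [polyVal]
      rw [h3]
      simpa using ((hasDerivAt_id (0 : ℝ)).mul_const _).const_add (x j)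
    have h := hp.fun_mul h1
    have e : polyVal (pderiv i (p * X j)) x =
        polyVal (pderiv i p) x * polyVal (X j) (x + (0 : ℝ) • EuclideanSpace.single i (1 : ℝ)) +
        polyVal p (x + (0 : ℝ) • EuclideanSpace.single i (1 : ℝ)) * polyVal (pderiv i (X j)) x := by
      simp [polyVal]; ring
    rw [e]
    simpa [polyVal] using h

theorem exists_polyVal_le {d k : ℕ} {p : MvPolynomial (Fin d) ℝ} (hp : p.IsHomogeneous k) :
    ∃ C, 0 ≤ C ∧ ∀ x : Eucl d, |polyVal p x| ≤ C * ‖x‖ ^ k := by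
  obtain ⟨C, hC⟩ := exists_bound_polyVal_sphere p
  -- The maximum covers degree zero at x = 0, where scaling to the sphere says nothing.
  refine ⟨max C |polyVal p 0|, le_max_of_le_right (abs_nonneg _), fun x => ?_⟩
  by_cases hx : x = 0
  · subst hx
    rcases Nat.eq_zero_or_pos k with rfl | hk
    · simp
    · have := polyVal_smul hp 0 0
      simp only [zero_smul, zero_pow hk.ne', zero_mul] at this
      simp [this, zero_pow hk.ne']
  · have hx' : 0 < ‖x‖ := norm_pos_iff.2 hx
    have h1 : x = ‖x‖ • (‖x‖⁻¹ • x) := by rw [smul_inv_smul₀ hx'.ne']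
    have h2 : ‖x‖⁻¹ • x ∈ Metric.sphere (0 : Eucl d) 1 := by
      simp [norm_smul, hx'.ne']
    have h3 := hC ⟨_, h2⟩
    rw [h1, polyVal_smul hp, ← h1, abs_mul, abs_of_pos (pow_pos hx' k), mul_comm]
    gcongr
    refine le_max_of_le_left ?_
    simpa using h3

theorem integrable_norm_pow_mul_exp {a : ℝ} (ha : 0 < a) (n : ℕ) :
    Integrable (fun x : Eucl 4 => ‖x‖ ^ n * Real.exp (-a * ‖x‖ ^ 2)) := by
  rw [integrable_fun_norm_addHaar volume (f := fun r : ℝ => r ^ n * Real.exp (-a * r ^ 2))]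
  have h := integrableOn_rpow_mul_exp_neg_mul_sq ha (s := (3 + n : ℕ)) (by
    have : (0 : ℝ) ≤ (3 + n : ℕ) := Nat.cast_nonneg _
    linarith)
  refine h.congr_fun (fun r hr => ?_) measurableSet_Ioi
  simp only [Real.rpow_natCast, finrank_euclideanSpace, Fintype.card_fin, smul_eq_mul]
  rw [pow_add, mul_assoc]

/-- The Gaussian `exp(-πz|x|² + 2πi x·ξ)`. -/
def gaussWave (z : ℂ) (ξ x : Eucl 4) : ℂ :=
  Complex.exp (-(Real.pi * z) * ‖x‖ ^ 2 + 2 * Real.pi * Complex.I * inner ℝ ξ x)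

theorem continuous_gaussWave (z : ℂ) (ξ : Eucl 4) : Continuous (gaussWave z ξ) := by
  unfold gaussWave; fun_prop

theorem norm_gaussWave (z : ℂ) (ξ x : Eucl 4) :
    ‖gaussWave z ξ x‖ = Real.exp (-(Real.pi * z.re) * ‖x‖ ^ 2) := by
  rw [gaussWave, Complex.norm_exp]
  congr 1
  simp [← Complex.ofReal_pow]

theorem integrable_polyVal_mul_gaussWave {z : ℂ} (hz : 0 < z.re) (ξ : Eucl 4) {n : ℕ}
    {p : MvPolynomial (Fin 4) ℝ} (hp : p.IsHomogeneous n) :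
    Integrable fun x => ((polyVal p x : ℝ) : ℂ) * gaussWave z ξ x := by
  obtain ⟨C, hC0, hC⟩ := exists_polyVal_le hp
  refine ((integrable_norm_pow_mul_exp (mul_pos Real.pi_pos hz) n).const_mul C).mono'
    ?_ (ae_of_all _ fun x => ?_)
  · exact ((Complex.continuous_ofReal.comp (continuous_polyVal p)).mul
      (continuous_gaussWave z ξ)).aestronglyMeasurable
  · rw [norm_mul, norm_gaussWave, Complex.norm_real, Real.norm_eq_abs, ← mul_assoc]
    gcongr
    exact hC x

theorem hasLineDerivAt_gaussWave (z : ℂ) (ξ x : Eucl 4) (i : Fin 4) :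
    HasLineDerivAt ℝ (gaussWave z ξ)
      ((-(2 * Real.pi * z) * x i + 2 * Real.pi * Complex.I * ξ i) * gaussWave z ξ x) x
      (EuclideanSpace.single i 1) := by
  unfold HasLineDerivAt
  have hn : ∀ t : ℝ, ((‖x + t • EuclideanSpace.single i (1 : ℝ)‖ : ℝ) : ℂ) ^ 2 =
      (‖x‖ : ℂ) ^ 2 + 2 * t * x i + t ^ 2 := by
    intro t
    rw [← Complex.ofReal_pow, norm_add_sq_real, inner_smul_right,
      EuclideanSpace.inner_single_right, norm_smul]
    simp [mul_assoc, ← Complex.ofReal_pow]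
  have hin : ∀ t : ℝ, ((inner ℝ ξ (x + t • EuclideanSpace.single i (1 : ℝ)) : ℝ) : ℂ) =
      inner ℝ ξ x + t * ξ i := by
    intro t
    rw [inner_add_right, inner_smul_right, EuclideanSpace.inner_single_right]
    simp
  have hE : ∀ t : ℝ, gaussWave z ξ (x + t • EuclideanSpace.single i (1 : ℝ)) =
      Complex.exp (-(Real.pi * z) * ((‖x‖ : ℂ) ^ 2 + 2 * t * x i + t ^ 2) +
        2 * Real.pi * Complex.I * (inner ℝ ξ x + t * ξ i)) := by
    intro t
    rw [gaussWave, hn, hin]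
  simp_rw [hE]
  have h0 : HasDerivAt (fun t : ℂ => -(Real.pi * z) * ((‖x‖ : ℂ) ^ 2 + 2 * t * x i + t ^ 2) +
        2 * Real.pi * Complex.I * (inner ℝ ξ x + t * ξ i))
      (-(2 * Real.pi * z) * x i + 2 * Real.pi * Complex.I * ξ i) ((0 : ℝ) : ℂ) := by
    have h1 := ((hasDerivAt_id ((0 : ℝ) : ℂ)).const_mul 2).mul_const (x i : ℂ)
    have h2 := ((h1.const_add ((‖x‖ : ℂ) ^ 2)).add ((hasDerivAt_id ((0 : ℝ) : ℂ)).pow 2)).const_mul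
      (-(Real.pi * z))
    have h3 := (((hasDerivAt_id ((0 : ℝ) : ℂ)).mul_const (ξ i : ℂ)).const_add
      ((inner ℝ ξ x : ℝ) : ℂ)).const_mul (2 * Real.pi * Complex.I)
    refine (h2.fun_add h3).congr_deriv ?_
    simp; ring
  refine h0.cexp.comp_ofReal.congr_deriv ?_
  rw [mul_comm, gaussWave]
  simp

/-- The Gaussian Fourier integral of a polynomial. -/
def gaussInt (z : ℂ) (ξ : Eucl 4) (p : MvPolynomial (Fin 4) ℝ) : ℂ :=
  ∫ x, ((polyVal p x : ℝ) : ℂ) * gaussWave z ξ x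

/-- Integration by parts: differentiating the Gaussian wave brings down -2πz xᵢ + 2πi ξᵢ, so
multiplication by a coordinate is traded for a derivative. -/
theorem gaussInt_pderiv {z : ℂ} (hz : 0 < z.re) (ξ : Eucl 4) {n : ℕ}
    {p : MvPolynomial (Fin 4) ℝ} (hp : p.IsHomogeneous n) (i : Fin 4) :
    gaussInt z ξ (pderiv i p) =
      2 * Real.pi * z * gaussInt z ξ (X i * p) - 2 * Real.pi * Complex.I * ξ i * gaussInt z ξ p := by
  have hX : (X i * p).IsHomogeneous (1 + n) := (MvPolynomial.isHomogeneous_X ℝ i).mul hp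
  have i1 := integrable_polyVal_mul_gaussWave hz ξ (hp.pderiv (i := i))
  have i2 := integrable_polyVal_mul_gaussWave hz ξ hp
  have i3 := integrable_polyVal_mul_gaussWave hz ξ hX
  have e : ∀ x : Eucl 4, ((polyVal p x : ℝ) : ℂ) *
      ((-(2 * Real.pi * z) * x i + 2 * Real.pi * Complex.I * ξ i) * gaussWave z ξ x) =
      -(2 * Real.pi * z) * (((polyVal (X i * p) x : ℝ) : ℂ) * gaussWave z ξ x) +
      (2 * Real.pi * Complex.I * ξ i) * (((polyVal p x : ℝ) : ℂ) * gaussWave z ξ x) := by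
    intro x
    have : polyVal (X i * p) x = x i * polyVal p x := by simp [polyVal]
    rw [this]; push_cast; ring
  have key := integral_bilinear_hasLineDerivAt_right_eq_neg_left_of_integrable
    (μ := (volume : Measure (Eucl 4))) (B := ContinuousLinearMap.mul ℝ ℂ)
    (f := fun x => ((polyVal p x : ℝ) : ℂ)) (f' := fun x => ((polyVal (pderiv i p) x : ℝ) : ℂ))
    (g := gaussWave z ξ) (g' := fun x =>
      (-(2 * Real.pi * z) * x i + 2 * Real.pi * Complex.I * ξ i) * gaussWave z ξ x)
    (v := EuclideanSpace.single i 1) i1 (by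
      simp only [ContinuousLinearMap.mul_apply']
      simp_rw [e]
      exact (i3.const_mul _).add (i2.const_mul _)) i2
    (fun x _ => (hasDerivAt_polyVal p i x).ofReal_comp)
    (fun x _ => hasLineDerivAt_gaussWave z ξ x i)
  simp only [ContinuousLinearMap.mul_apply'] at key
  simp_rw [e] at key
  rw [integral_add (i3.const_mul _) (i2.const_mul _), integral_const_mul, integral_const_mul] at key
  unfold gaussInt
  linear_combination key

theorem gaussInt_sum {z : ℂ} (hz : 0 < z.re) (ξ : Eucl 4) {n : ℕ}
    (p : Fin 4 → MvPolynomial (Fin 4) ℝ) (hp : ∀ i, (p i).IsHomogeneous n) :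
    gaussInt z ξ (∑ i, p i) = ∑ i, gaussInt z ξ (p i) := by
  unfold gaussInt
  rw [← integral_finsetSum _ fun i _ => integrable_polyVal_mul_gaussWave hz ξ (hp i)]
  simp [polyVal, Finset.sum_mul]

theorem gaussInt_nsmul (z : ℂ) (ξ : Eucl 4) (n : ℕ) (p : MvPolynomial (Fin 4) ℝ) :
    gaussInt z ξ (n • p) = n * gaussInt z ξ p := by
  unfold gaussInt
  rw [← integral_const_mul]
  simp [polyVal, mul_assoc]

/-- The Gaussian Fourier integral of a solid harmonic. -/
theorem gaussInt_isSolidHarmonic {z : ℂ} (hz : 0 < z.re) (ξ : Eucl 4) (k : ℕ) :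
    ∀ p, IsSolidHarmonic k p → gaussInt z ξ p =
      (Complex.I / z) ^ k * polyVal p ξ * gaussInt z ξ 1 := by
  have hz0 : z ≠ 0 := by rintro rfl; simp at hz
  induction k with
  | zero =>
    intro p hp
    have h0 := hp.1
    rw [← MvPolynomial.totalDegree_zero_iff_isHomogeneous,
      MvPolynomial.totalDegree_eq_zero_iff_eq_C] at h0
    rw [h0]
    simp [gaussInt, polyVal, ← integral_const_mul]
  | succ k ih =>
    intro p hp
    have hd := fun i => isSolidHarmonic_pderiv hp i
    simp only [Nat.add_sub_cancel] at hd
    -- Euler's identity writes (k+1)p as Σ xᵢ ∂ᵢp. After integration by parts the second derivatives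
    -- sum to Δp = 0, and what remains involves only ∂ᵢp, which is harmonic of degree k and known by
    -- induction.
    have h1 : ∀ i, gaussInt z ξ (X i * pderiv i p) =
        (2 * Real.pi * z)⁻¹ * gaussInt z ξ (pderiv i (pderiv i p)) +
        Complex.I / z * ξ i * gaussInt z ξ (pderiv i p) := by
      intro i
      rw [gaussInt_pderiv hz ξ (hd i).1]
      have : (Real.pi : ℂ) ≠ 0 := by exact_mod_cast Real.pi_ne_zero
      field_simp
      ring
    have h2 := congrArg (gaussInt z ξ) hp.1.sum_X_mul_pderiv
    rw [gaussInt_nsmul, gaussInt_sum hz ξ (n := 1 + k) _ fun i =>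
      (MvPolynomial.isHomogeneous_X ℝ i).mul (hd i).1] at h2
    simp only [h1, Finset.sum_add_distrib, ← Finset.mul_sum] at h2
    rw [← gaussInt_sum hz ξ (n := k - 1) _ fun i => (hd i).1.pderiv, hp.2] at h2
    have h3 := congrArg (fun q => polyVal q ξ) hp.1.sum_X_mul_pderiv
    simp only [polyVal, map_sum, map_mul, MvPolynomial.eval_X, nsmul_eq_mul, map_natCast] at h3
    have h3' : ∑ i, ξ i * polyVal (pderiv i p) ξ = (k + 1 : ℕ) * polyVal p ξ := h3
    have h4 : ∑ i, Complex.I / z * ξ i * gaussInt z ξ (pderiv i p) =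
        (Complex.I / z) ^ (k + 1) * ((∑ i, ξ i * polyVal (pderiv i p) ξ : ℝ) : ℂ) *
          gaussInt z ξ 1 := by
      rw [Complex.ofReal_sum, Finset.mul_sum, Finset.sum_mul]
      refine Finset.sum_congr rfl fun i _ => ?_
      rw [ih _ (hd i)]
      push_cast
      ring
    rw [h4, h3'] at h2
    have h5 : gaussInt z ξ 0 = 0 := by simp [gaussInt, polyVal]
    have h6 : ((k + 1 : ℕ) : ℂ) ≠ 0 := by exact_mod_cast Nat.succ_ne_zero k
    rw [h5, mul_zero, zero_add] at h2
    refine mul_left_cancel₀ h6 ?_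
    rw [← h2]
    push_cast
    ring

theorem gaussInt_one {z : ℂ} (hz : 0 < z.re) (ξ : Eucl 4) :
    gaussInt z ξ 1 = z⁻¹ ^ 2 * Complex.exp (-Real.pi * ‖ξ‖ ^ 2 / z) := by
  have hz0 : z ≠ 0 := by rintro rfl; simp at hz
  have hpi : (Real.pi : ℂ) ≠ 0 := by exact_mod_cast Real.pi_ne_zero
  have h := GaussianFourier.integral_cexp_neg_mul_sq_norm_add (V := Eucl 4) (b := Real.pi * z)
    (by simpa using mul_pos Real.pi_pos hz) (2 * Real.pi * Complex.I) ξ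
  have e : gaussInt z ξ 1 = ∫ v : Eucl 4, Complex.exp (-(Real.pi * z) * ‖v‖ ^ 2 +
      2 * Real.pi * Complex.I * inner ℝ ξ v) := by
    simp [gaussInt, polyVal, gaussWave]
  rw [e, h]
  have h1 : (Real.pi / (Real.pi * z) : ℂ) = z⁻¹ := by field_simp
  -- In dimension four the exponent d/2 is the integer 2, so no branch of a complex power enters.
  have h2 : ((Module.finrank ℝ (Eucl 4) : ℕ) : ℂ) / 2 = ((2 : ℕ) : ℂ) := by simp; norm_num
  rw [h1, h2, Complex.cpow_natCast]
  congr 2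
  rw [mul_pow, mul_pow, Complex.I_sq]
  field_simp
  ring

theorem gaussInt_eq {z : ℂ} (hz : 0 < z.re) (ξ : Eucl 4) {k : ℕ} {p : MvPolynomial (Fin 4) ℝ}
    (hp : IsSolidHarmonic k p) : gaussInt z ξ p =
      Complex.I ^ k * z⁻¹ ^ (k + 2) * polyVal p ξ * Complex.exp (-Real.pi * ‖ξ‖ ^ 2 / z) := by
  rw [gaussInt_isSolidHarmonic hz ξ k p hp, gaussInt_one hz]
  ring

end Gaussian


/-! ### Fourier transforms of harmonics on the sphere, and orthogonality of degrees -/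

section SphereFourier

/-- The Fourier transform of a polynomial times the surface measure of the sphere. -/
def sphereFourier (p : MvPolynomial (Fin 4) ℝ) (y : Eucl 4) : ℂ :=
  ∫ ω : S3, ((polyVal p ω : ℝ) : ℂ) * Complex.exp (2 * Real.pi * Complex.I * inner ℝ y (ω : Eucl 4))
    ∂(sphereMeasure 4)

theorem norm_cexp_two_pi_I_mul (a : ℝ) : ‖Complex.exp (2 * Real.pi * Complex.I * a)‖ = 1 := by
  rw [Complex.norm_exp]; simp

theorem continuous_sphereFourier (p : MvPolynomial (Fin 4) ℝ) : Continuous (sphereFourier p) := by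
  obtain ⟨C, hC⟩ := exists_bound_polyVal_sphere p
  have hp := continuous_polyVal p
  refine continuous_of_dominated (bound := fun _ => C) (fun y => ?_) (fun y => ?_)
    (integrable_const C) (ae_of_all _ fun ω => ?_)
  · exact Continuous.aestronglyMeasurable (by fun_prop)
  · refine ae_of_all _ fun ω => ?_
    rw [norm_mul, norm_cexp_two_pi_I_mul, mul_one]
    exact hC ω
  · fun_prop

theorem exists_bound_sphereFourier (p : MvPolynomial (Fin 4) ℝ) :
    ∃ C, 0 ≤ C ∧ ∀ y, ‖sphereFourier p y‖ ≤ C := by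
  obtain ⟨C, hC⟩ := exists_bound_polyVal_sphere p
  refine ⟨max C 0 * (sphereMeasure 4).real Set.univ, by positivity, fun y => ?_⟩
  refine norm_integral_le_of_norm_le_const (ae_of_all _ fun ω => ?_)
  rw [norm_mul, norm_cexp_two_pi_I_mul, mul_one]
  exact (hC ω).trans (le_max_left _ _)

/-- Polar coordinates: homogeneity contributes rⁿ, the volume r³, and the angular integral is
`sphereFourier`. -/
theorem gaussInt_eq_integral_radial {z : ℂ} (hz : 0 < z.re) (ξ : Eucl 4) {n : ℕ}
    {p : MvPolynomial (Fin 4) ℝ} (hp : p.IsHomogeneous n) :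
    gaussInt z ξ p = ∫ r in Set.Ioi (0 : ℝ),
      Complex.exp (-(Real.pi * z) * r ^ 2) * (((r ^ (n + 3) : ℝ) : ℂ) * sphereFourier p (r • ξ)) := by
  rw [gaussInt, integral_polar (integrable_polyVal_mul_gaussWave hz ξ hp), integral_radialMeasure]
  refine setIntegral_congr_fun measurableSet_Ioi fun r hr => ?_
  have hr' : (0 : ℝ) < r := hr
  simp only [sphereFourier, ← integral_const_mul]
  refine integral_congr_ae (ae_of_all _ fun ω => ?_)
  simp only [polyVal_smul hp, gaussWave, norm_smul_sphere hr', inner_smul_left, inner_smul_right,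
    Complex.exp_add]
  push_cast
  simp
  ring

/-- The inner product of two polynomials in `L²` of the sphere. -/
def sphereInner (p q : MvPolynomial (Fin 4) ℝ) : ℂ :=
  ∫ ω : S3, ((polyVal p ω : ℝ) : ℂ) * ((polyVal q ω : ℝ) : ℂ) ∂(sphereMeasure 4)

/-- Green's identity for the weight exp(-π|x|²): since Δp = 0, only the derivative of the Gaussian
survives, and Euler's identity turns x·∇p into k p. The left side is symmetric in p and q while the
right side shows the degree of p only. -/
theorem sum_gaussInt_pderiv_mul {k l : ℕ} {p q : MvPolynomial (Fin 4) ℝ} (hp : IsSolidHarmonic k p)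
    (hq : IsSolidHarmonic l q) :
    ∑ i, gaussInt 1 0 (MvPolynomial.pderiv i p * MvPolynomial.pderiv i q) =
      2 * Real.pi * (k * gaussInt 1 0 (p * q)) := by
  have h1 : ∀ i, gaussInt 1 0 (MvPolynomial.pderiv i p * MvPolynomial.pderiv i q) +
      gaussInt 1 0 (MvPolynomial.pderiv i (MvPolynomial.pderiv i p) * q) =
      2 * Real.pi * gaussInt 1 0 (MvPolynomial.X i * MvPolynomial.pderiv i p * q) := by
    intro i
    have h2 := gaussInt_pderiv (z := 1) (by simp) 0 ((hp.1.pderiv (i := i)).mul hq.1) i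
    simp only [PiLp.zero_apply, Complex.ofReal_zero, mul_zero, zero_mul, sub_zero, mul_one] at h2
    rw [← mul_assoc] at h2
    rw [← h2, MvPolynomial.pderiv_mul, gaussInt, gaussInt, gaussInt, ← integral_add
      (integrable_polyVal_mul_gaussWave (by simp) 0 ((hp.1.pderiv (i := i)).mul hq.1.pderiv))
      (integrable_polyVal_mul_gaussWave (by simp) 0 (hp.1.pderiv.pderiv.mul hq.1))]
    refine integral_congr_ae (ae_of_all _ fun x => ?_)
    simp [polyVal]
    ring
  have h3 : ∑ i, gaussInt 1 0 (MvPolynomial.pderiv i (MvPolynomial.pderiv i p) * q) = 0 := by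
    rw [← gaussInt_sum (by simp) 0 _ fun i => hp.1.pderiv.pderiv.mul hq.1, ← Finset.sum_mul, hp.2]
    simp [gaussInt, polyVal]
  have h4 : ∑ i, gaussInt 1 0 (MvPolynomial.X i * MvPolynomial.pderiv i p * q) =
      k * gaussInt 1 0 (p * q) := by
    rw [← gaussInt_sum (by simp) 0 _ fun i =>
      ((MvPolynomial.isHomogeneous_X ℝ i).mul hp.1.pderiv).mul hq.1, ← Finset.sum_mul,
      hp.1.sum_X_mul_pderiv, smul_mul_assoc, gaussInt_nsmul]
  rw [← h4, Finset.mul_sum, ← Finset.sum_congr rfl fun i _ => h1 i, Finset.sum_add_distrib, h3,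
    add_zero]

/-- Exchanging p and q in Green's identity gives (k - l) times the Gaussian integral of pq equal to
zero. In polar coordinates that integral is the spherical inner product times a positive radial
integral. -/
theorem sphereInner_eq_zero {k l : ℕ} {p q : MvPolynomial (Fin 4) ℝ} (hp : IsSolidHarmonic k p)
    (hq : IsSolidHarmonic l q) (hkl : k ≠ l) : sphereInner p q = 0 := by
  have h0 : gaussInt 1 0 (p * q) = 0 := by
    have h1 := sum_gaussInt_pderiv_mul hp hq
    have h2 := sum_gaussInt_pderiv_mul hq hp
    simp_rw [mul_comm (MvPolynomial.pderiv _ q), mul_comm q p] at h2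
    rw [h1] at h2
    have h3 : (2 * Real.pi : ℂ) ≠ 0 := by simp [Real.pi_ne_zero]
    have h4 : ((k : ℂ) - l) ≠ 0 := sub_ne_zero.2 (by exact_mod_cast hkl)
    have h5 : (2 * Real.pi : ℂ) * (((k : ℂ) - l) * gaussInt 1 0 (p * q)) = 0 := by
      linear_combination h2
    simpa [h3, h4] using h5
  rw [gaussInt_eq_integral_radial (by simp) 0 (hp.1.mul hq.1)] at h0
  have h1 : sphereFourier (p * q) 0 = sphereInner p q := by
    simp [sphereFourier, sphereInner, polyVal]
  simp only [smul_zero, h1, ← mul_assoc] at h0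
  rw [integral_mul_const] at h0
  rcases mul_eq_zero.1 h0 with h2 | h2
  · exfalso
    have h3 : ∫ r in Set.Ioi (0 : ℝ), (Real.exp (-Real.pi * r ^ 2) * r ^ (k + l + 3)) = 0 := by
      rw [← Complex.ofReal_eq_zero, ← h2, ← integral_complex_ofReal]
      refine integral_congr_ae (ae_of_all _ fun r => ?_)
      push_cast
      ring_nf
    have h4 : IntegrableOn (fun r : ℝ => Real.exp (-Real.pi * r ^ 2) * r ^ (k + l + 3))
        (Set.Ioi 0) := by
      refine (integrableOn_rpow_mul_exp_neg_mul_sq Real.pi_pos (s := (k + l + 3 : ℕ)) (by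
        have : (0 : ℝ) ≤ (k + l + 3 : ℕ) := Nat.cast_nonneg _
        linarith)).congr_fun (fun r _ => ?_) measurableSet_Ioi
      simp only [Real.rpow_natCast]
      ring
    have h5 : 0 < ∫ r in Set.Ioi (0 : ℝ), (Real.exp (-Real.pi * r ^ 2) * r ^ (k + l + 3)) := by
      refine (setIntegral_pos_iff_support_of_nonneg_ae ?_ h4).2 ?_
      · filter_upwards [ae_restrict_mem measurableSet_Ioi] with r hr
        have : (0 : ℝ) < r := hr
        simp only [Pi.zero_apply]
        positivity
      · refine lt_of_lt_of_le ?_ (measure_mono (show Set.Ioi (0 : ℝ) ⊆ _ from fun r hr => ?_))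
        · simp
        · have : (0 : ℝ) < r := hr
          refine ⟨?_, hr⟩
          simp only [Function.mem_support]
          positivity
    exact h5.ne' h3
  · exact h2

end SphereFourier

/-! ### Plancherel's theorem in the time variable -/

section Plancherel

variable {V : Type*} [NormedAddCommGroup V] [InnerProductSpace ℝ V] [FiniteDimensional ℝ V]
  [MeasurableSpace V] [BorelSpace V]

theorem integral_fourier_mul_eq_flip {f g : V → ℂ} (hf : Integrable f) (hg : Integrable g) :
    ∫ x, 𝓕 f x * g x = ∫ x, f x * 𝓕 g x := by
  simpa using! VectorFourier.integral_fourierIntegral_smul_eq_flip (L := innerₗ V)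
    (μ := volume) (ν := volume) Real.continuous_fourierChar continuous_inner hf hg

/-- The L² extension and the Fourier integral have the same pairing with every test function. -/
theorem coeFn_fourier_toLp {f : V → ℂ} (h1 : Integrable f) (h2 : MemLp f 2) :
    (𝓕 (h2.toLp f) : Lp ℂ 2 (volume : Measure V)) =ᵐ[volume] 𝓕 f := by
  have hloc : LocallyIntegrable (𝓕 (h2.toLp f) : Lp ℂ 2 (volume : Measure V)) :=
    (Lp.memLp _).locallyIntegrable one_le_two
  have hcont : Continuous (𝓕 f) :=
    VectorFourier.fourierIntegral_continuous Real.continuous_fourierChar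
      (by exact continuous_inner) h1
  refine ae_eq_of_integral_contDiff_smul_eq hloc hcont.locallyIntegrable fun g hg hgc => ?_
  have hf : ContDiff ℝ (⊤ : ℕ∞) (fun y => ((g y : ℝ) : ℂ)) := Complex.ofRealCLM.contDiff.comp hg
  have hc : HasCompactSupport (fun y => ((g y : ℝ) : ℂ)) := hgc.comp_left Complex.ofReal_zero
  let G : 𝓢(V, ℂ) := hc.toSchwartzMap hf
  have e1 := congrArg (fun T => T G) (Lp.fourier_toTemperedDistribution_eq (h2.toLp f))
  simp only [TemperedDistribution.fourier_apply, Lp.toTemperedDistribution_apply] at e1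
  have e2 : ∫ x, (𝓕 G) x • (h2.toLp f) x = ∫ x, (𝓕 G) x • f x :=
    integral_congr_ae (by filter_upwards [h2.coeFn_toLp] with x hx; rw [hx])
  have e3 := integral_fourier_mul_eq_flip (f := (G : V → ℂ)) (g := f) G.integrable h1
  have hG : ∀ x, G x = ((g x : ℝ) : ℂ) := fun x => rfl
  rw [e2] at e1
  simp only [SchwartzMap.fourier_coe, smul_eq_mul] at e1
  rw [e3] at e1
  simpa [hG] using e1.symm

theorem memLp_fourier {f : V → ℂ} (h1 : Integrable f) (h2 : MemLp f 2) : MemLp (𝓕 f) 2 :=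
  (memLp_congr_ae (coeFn_fourier_toLp h1 h2)).1 (Lp.memLp _)

theorem integral_conj_fourier_mul_fourier {f g : V → ℂ} (h1 : Integrable f) (h2 : MemLp f 2)
    (h3 : Integrable g) (h4 : MemLp g 2) :
    ∫ x, (starRingEnd ℂ) (𝓕 f x) * 𝓕 g x = ∫ x, (starRingEnd ℂ) (f x) * g x := by
  have h := Lp.inner_fourier_eq (h2.toLp f) (h4.toLp g)
  rw [L2.inner_def, L2.inner_def] at h
  have e1 : ∫ x, inner ℂ ((h2.toLp f) x) ((h4.toLp g) x) = ∫ x, (starRingEnd ℂ) (f x) * g x := by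
    refine integral_congr_ae ?_
    filter_upwards [h2.coeFn_toLp, h4.coeFn_toLp] with x hx hx'
    rw [hx, hx', RCLike.inner_apply, mul_comm]
  rw [← e1, ← h]
  refine integral_congr_ae ?_
  filter_upwards [coeFn_fourier_toLp h1 h2, coeFn_fourier_toLp h3 h4] with x hx hx'
  rw [hx, hx', RCLike.inner_apply, mul_comm]

end Plancherel


/-! ### Half-waves as functions of time: Plancherel through the dispersion relation -/

section TimeSignal

/-- A dispersion relation: the frequency `φ(ρ)` in time of waves of frequency `ρ` in space. -/
structure Dispersion where
  /-- the frequency in time -/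
  φ : ℝ → ℝ
  /-- its derivative -/
  φ' : ℝ → ℝ
  continuous_φ : Continuous φ
  continuous_φ' : Continuous φ'
  hasDerivAt : ∀ ρ, 0 < ρ → HasDerivAt φ (φ' ρ) ρ
  deriv_pos : ∀ ρ, 0 < ρ → 0 < φ' ρ
  pos : ∀ ρ, 0 < ρ → 0 < φ ρ

/-- The sign of a half-wave. -/
def sgn (s : Bool) : ℝ := if s then 1 else -1

theorem abs_sgn (s : Bool) : |sgn s| = 1 := by cases s <;> simp [sgn]

theorem sgn_mul_self (s : Bool) : sgn s * sgn s = 1 := by cases s <;> simp [sgn]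

variable (D : Dispersion)

theorem Dispersion.injOn : Set.InjOn D.φ (Set.Ioi 0) := by
  refine (strictMonoOn_of_deriv_pos (convex_Ioi 0) D.continuous_φ.continuousOn fun ρ hρ => ?_).injOn
  rw [interior_Ioi] at hρ
  rw [(D.hasDerivAt ρ hρ).deriv]
  exact D.deriv_pos ρ hρ

/-- The function of time `∫ exp(∓itφ(ρ)) A(ρ) dρ`. -/
def timeSignal (s : Bool) (A : ℝ → ℂ) (t : ℝ) : ℂ :=
  ∫ ρ in Set.Ioi (0 : ℝ), Complex.exp (-(Complex.I * (sgn s * t * D.φ ρ))) * A ρ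

/-- The frequency in time, in cycles. -/
def cycleFreq (s : Bool) (ρ : ℝ) : ℝ := sgn s * D.φ ρ / (2 * Real.pi)

theorem hasDerivWithinAt_cycleFreq (s : Bool) : ∀ ρ ∈ Set.Ioi (0 : ℝ),
    HasDerivWithinAt (cycleFreq D s) (sgn s * D.φ' ρ / (2 * Real.pi)) (Set.Ioi 0) ρ :=
  fun ρ hρ => (((D.hasDerivAt ρ hρ).const_mul _).div_const _).hasDerivWithinAt

theorem injOn_cycleFreq (s : Bool) : Set.InjOn (cycleFreq D s) (Set.Ioi 0) := by
  intro a ha b hb hab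
  refine D.injOn ha hb ?_
  have h1 : (2 * Real.pi) ≠ 0 := by positivity
  have h2 : sgn s ≠ 0 := fun h => by simpa [h] using abs_sgn s
  unfold cycleFreq at hab
  field_simp at hab
  exact hab

theorem abs_deriv_cycleFreq (s : Bool) {ρ : ℝ} (hρ : 0 < ρ) :
    |sgn s * D.φ' ρ / (2 * Real.pi)| = D.φ' ρ / (2 * Real.pi) := by
  rw [abs_div, abs_mul, abs_sgn, one_mul, abs_of_pos (D.deriv_pos ρ hρ),
    abs_of_pos (by positivity)]

/-- The time spectrum of `timeSignal`. -/
def timeSpectrum (s : Bool) (A : ℝ → ℂ) : ℝ → ℂ :=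
  (cycleFreq D s '' Set.Ioi 0).indicator fun l =>
    (fun ρ => A ρ * (2 * Real.pi / D.φ' ρ : ℝ)) (Function.invFunOn (cycleFreq D s) (Set.Ioi 0) l)

theorem measurableSet_range_cycleFreq (s : Bool) :
    MeasurableSet (cycleFreq D s '' Set.Ioi 0) := by
  refine measurableSet_Ioi.image_of_continuousOn_injOn ?_ (injOn_cycleFreq D s)
  have := D.continuous_φ
  unfold cycleFreq
  fun_prop

theorem timeSpectrum_cycleFreq (s : Bool) (A : ℝ → ℂ) {ρ : ℝ} (hρ : 0 < ρ) :
    timeSpectrum D s A (cycleFreq D s ρ) = A ρ * (2 * Real.pi / D.φ' ρ : ℝ) := by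
  have h : cycleFreq D s ρ ∈ cycleFreq D s '' Set.Ioi 0 := ⟨ρ, hρ, rfl⟩
  rw [timeSpectrum, Set.indicator_of_mem h, (injOn_cycleFreq D s).leftInvOn_invFunOn hρ]

variable {D}

theorem integrable_timeSpectrum (s : Bool) {A : ℝ → ℂ} (hA : IntegrableOn A (Set.Ioi 0)) :
    Integrable (timeSpectrum D s A) := by
  have h : IntegrableOn (timeSpectrum D s A) (cycleFreq D s '' Set.Ioi 0) := by
    rw [integrableOn_image_iff_integrableOn_abs_deriv_smul measurableSet_Ioi
      (hasDerivWithinAt_cycleFreq D s) (injOn_cycleFreq D s)]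
    refine hA.congr_fun (fun ρ hρ => ?_) measurableSet_Ioi
    have h1 := (D.deriv_pos ρ hρ).ne'
    have h2 := Real.pi_ne_zero
    simp only [abs_deriv_cycleFreq D s hρ, timeSpectrum_cycleFreq D s A hρ, Complex.real_smul]
    have : ((D.φ' ρ / (2 * Real.pi) : ℝ) : ℂ) * ((2 * Real.pi / D.φ' ρ : ℝ) : ℂ) = 1 := by
      rw [← Complex.ofReal_mul, ← Complex.ofReal_one]
      congr 1
      field_simp
    linear_combination -(A ρ) * this
  rwa [integrableOn_iff_integrable_of_support_subset] at h
  unfold timeSpectrum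
  exact Set.support_indicator_subset

theorem memLp_timeSpectrum (s : Bool) {A : ℝ → ℂ} (hA : IntegrableOn A (Set.Ioi 0))
    (hA2 : IntegrableOn (fun ρ => ‖A ρ‖ ^ 2 / D.φ' ρ) (Set.Ioi 0)) :
    MemLp (timeSpectrum D s A) 2 := by
  rw [memLp_two_iff_integrable_sq_norm (integrable_timeSpectrum s hA).1]
  have h : IntegrableOn (fun l => ‖timeSpectrum D s A l‖ ^ 2) (cycleFreq D s '' Set.Ioi 0) := by
    rw [integrableOn_image_iff_integrableOn_abs_deriv_smul measurableSet_Ioi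
      (hasDerivWithinAt_cycleFreq D s) (injOn_cycleFreq D s)]
    refine IntegrableOn.congr_fun (hA2.const_mul (2 * Real.pi)) (fun ρ hρ => ?_) measurableSet_Ioi
    have h1 := D.deriv_pos ρ hρ
    simp only [abs_deriv_cycleFreq D s hρ, timeSpectrum_cycleFreq D s A hρ, norm_mul,
      Complex.norm_real, Real.norm_eq_abs, smul_eq_mul]
    rw [abs_of_pos (div_pos (by positivity) h1)]
    field_simp
  rwa [integrableOn_iff_integrable_of_support_subset] at h
  intro l hl
  by_contra hcon
  exact hl (by simp [timeSpectrum, Set.indicator_of_notMem hcon])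

/-- Substitute l = ±φ(ρ)/2π. The Jacobian φ'/2π cancels the factor 2π/φ' built into `timeSpectrum`.
-/
theorem timeSignal_eq_fourier (s : Bool) (A : ℝ → ℂ) :
    timeSignal D s A = 𝓕 (timeSpectrum D s A) := by
  funext t
  rw [Real.fourier_real_eq]
  have h1 : ∫ l, Real.fourierChar (-(l * t)) • timeSpectrum D s A l =
      ∫ l in cycleFreq D s '' Set.Ioi 0, Real.fourierChar (-(l * t)) • timeSpectrum D s A l := by
    rw [← integral_indicator (measurableSet_range_cycleFreq D s)]
    congr 1
    funext l
    by_cases hl : l ∈ cycleFreq D s '' Set.Ioi 0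
    · rw [Set.indicator_of_mem hl]
    · rw [Set.indicator_of_notMem hl, timeSpectrum, Set.indicator_of_notMem hl, smul_zero]
  rw [h1, integral_image_eq_integral_abs_deriv_smul measurableSet_Ioi
      (hasDerivWithinAt_cycleFreq D s) (injOn_cycleFreq D s)]
  refine setIntegral_congr_fun measurableSet_Ioi fun ρ hρ => ?_
  have h2 := (D.deriv_pos ρ hρ).ne'
  have h3 := Real.pi_ne_zero
  simp only [abs_deriv_cycleFreq D s hρ, timeSpectrum_cycleFreq D s A hρ, Complex.real_smul,
    Circle.smul_def, Real.fourierChar_apply, smul_eq_mul]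
  have h4 : ((D.φ' ρ / (2 * Real.pi) : ℝ) : ℂ) * ((2 * Real.pi / D.φ' ρ : ℝ) : ℂ) = 1 := by
    rw [← Complex.ofReal_mul, ← Complex.ofReal_one]
    congr 1
    field_simp
  have h5 : (((2 * Real.pi * -(cycleFreq D s ρ * t) : ℝ) : ℂ) * Complex.I) =
      -(Complex.I * (sgn s * t * D.φ ρ)) := by
    have : 2 * Real.pi * -(cycleFreq D s ρ * t) = -(sgn s * t * D.φ ρ) := by
      unfold cycleFreq; field_simp
    rw [this]; push_cast; ring
  rw [h5]
  linear_combination -(Complex.exp (-(Complex.I * (sgn s * t * D.φ ρ))) * A ρ) * h4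

theorem memLp_timeSignal (s : Bool) {A : ℝ → ℂ} (hA : IntegrableOn A (Set.Ioi 0))
    (hA2 : IntegrableOn (fun ρ => ‖A ρ‖ ^ 2 / D.φ' ρ) (Set.Ioi 0)) :
    MemLp (timeSignal D s A) 2 := by
  rw [timeSignal_eq_fourier]
  exact memLp_fourier (integrable_timeSpectrum s hA) (memLp_timeSpectrum s hA hA2)

/-- Plancherel in t, pulled back to ρ: two factors 2π/φ' against one Jacobian φ'/2π leave 2π/φ'. For
opposite signs the spectra lie on opposite half-lines, because φ > 0. -/
theorem integral_conj_timeSignal_mul_timeSignal (s s' : Bool) {A B : ℝ → ℂ}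
    (hA : IntegrableOn A (Set.Ioi 0))
    (hA2 : IntegrableOn (fun ρ => ‖A ρ‖ ^ 2 / D.φ' ρ) (Set.Ioi 0))
    (hB : IntegrableOn B (Set.Ioi 0))
    (hB2 : IntegrableOn (fun ρ => ‖B ρ‖ ^ 2 / D.φ' ρ) (Set.Ioi 0)) :
    ∫ t, (starRingEnd ℂ) (timeSignal D s A t) * timeSignal D s' B t =
      if s = s' then 2 * Real.pi * ∫ ρ in Set.Ioi (0 : ℝ), (starRingEnd ℂ) (A ρ) * B ρ / D.φ' ρ
      else 0 := by
  rw [timeSignal_eq_fourier, timeSignal_eq_fourier, integral_conj_fourier_mul_fourier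
    (integrable_timeSpectrum s hA) (memLp_timeSpectrum s hA hA2)
    (integrable_timeSpectrum s' hB) (memLp_timeSpectrum s' hB hB2)]
  split_ifs with hs
  · subst hs
    have h1 : ∫ l, (starRingEnd ℂ) (timeSpectrum D s A l) * timeSpectrum D s B l =
        ∫ l in cycleFreq D s '' Set.Ioi 0,
          (starRingEnd ℂ) (timeSpectrum D s A l) * timeSpectrum D s B l := by
      rw [← integral_indicator (measurableSet_range_cycleFreq D s)]
      congr 1
      funext l
      by_cases hl : l ∈ cycleFreq D s '' Set.Ioi 0
      · rw [Set.indicator_of_mem hl]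
      · rw [Set.indicator_of_notMem hl, timeSpectrum, Set.indicator_of_notMem hl]
        simp
    rw [h1, integral_image_eq_integral_abs_deriv_smul measurableSet_Ioi
      (hasDerivWithinAt_cycleFreq D s) (injOn_cycleFreq D s), ← integral_const_mul]
    refine setIntegral_congr_fun measurableSet_Ioi fun ρ hρ => ?_
    have h2 : ((D.φ' ρ : ℝ) : ℂ) ≠ 0 := by exact_mod_cast (D.deriv_pos ρ hρ).ne'
    have h3 : (Real.pi : ℂ) ≠ 0 := by exact_mod_cast Real.pi_ne_zero
    simp only [abs_deriv_cycleFreq D s hρ, timeSpectrum_cycleFreq D s _ hρ, Complex.real_smul,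
      map_mul, Complex.conj_ofReal]
    push_cast
    field_simp
  · refine (integral_congr_ae (ae_of_all _ fun l => ?_)).trans (integral_zero _ _)
    by_contra hne
    have hl : l ∈ cycleFreq D s '' Set.Ioi 0 := by
      by_contra hcon
      exact hne (by simp [timeSpectrum, Set.indicator_of_notMem hcon])
    have hl' : l ∈ Set.image (cycleFreq D s') (Set.Ioi 0) := by
      by_contra hcon
      exact hne (by simp [timeSpectrum, Set.indicator_of_notMem hcon])
    obtain ⟨a, ha, ha'⟩ := hl
    obtain ⟨b, hb, hb'⟩ := hl'
    have h1 := D.pos a ha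
    have h2 := D.pos b hb
    rw [← hb', cycleFreq, cycleFreq, div_left_inj' (by positivity)] at ha'
    cases s <;> cases s' <;> simp_all [sgn] <;> linarith

theorem lintegral_timeSignal (s : Bool) {A : ℝ → ℂ} (hA : IntegrableOn A (Set.Ioi 0))
    (hA2 : IntegrableOn (fun ρ => ‖A ρ‖ ^ 2 / D.φ' ρ) (Set.Ioi 0)) :
    ∫⁻ t, ‖timeSignal D s A t‖ₑ ^ 2 =
      ENNReal.ofReal (2 * Real.pi) *
        ∫⁻ ρ in Set.Ioi (0 : ℝ), ENNReal.ofReal (‖A ρ‖ ^ 2 / D.φ' ρ) := by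
  have h1 := integral_conj_timeSignal_mul_timeSignal s s hA hA2 hA hA2
  have h2 := (memLp_two_iff_integrable_sq_norm (memLp_timeSignal s hA hA2).1).1
    (memLp_timeSignal s hA hA2)
  rw [if_pos rfl] at h1
  have h3 : ∫ t, ‖timeSignal D s A t‖ ^ 2 =
      2 * Real.pi * ∫ ρ in Set.Ioi (0 : ℝ), ‖A ρ‖ ^ 2 / D.φ' ρ := by
    rw [← Complex.ofReal_inj]
    push_cast
    rw [← integral_complex_ofReal, ← integral_complex_ofReal]
    simp_rw [Complex.conj_mul'] at h1
    push_cast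
    exact h1
  have h4 : ∫⁻ t, ‖timeSignal D s A t‖ₑ ^ 2 = ∫⁻ t, ENNReal.ofReal (‖timeSignal D s A t‖ ^ 2) :=
    lintegral_congr fun t => by rw [ENNReal.ofReal_pow (norm_nonneg _), ofReal_norm]
  rw [h4, ← ofReal_integral_eq_lintegral_ofReal h2 (ae_of_all _ fun t => by positivity), h3,
    ENNReal.ofReal_mul (by positivity), ofReal_integral_eq_lintegral_ofReal hA2]
  filter_upwards [ae_restrict_mem measurableSet_Ioi] with ρ hρ
  have := D.deriv_pos ρ hρ
  simp only [Pi.zero_apply]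
  positivity

end TimeSignal


/-! ### The Funk–Hecke formula -/

section FunkHecke

/-- The dispersion relation of the Schrödinger equation. -/
def schrodingerDispersion : Dispersion where
  φ ρ := 2 * Real.pi ^ 2 * ρ ^ 2
  φ' ρ := 4 * Real.pi ^ 2 * ρ
  continuous_φ := by fun_prop
  continuous_φ' := by fun_prop
  pos ρ hρ := by positivity
  hasDerivAt ρ _ := ((hasDerivAt_pow 2 ρ).const_mul (2 * Real.pi ^ 2)).congr_deriv (by
    simp; ring)
  deriv_pos ρ hρ := by positivity

/-- A Gaussian profile times a bounded function. -/
def gaussProfile (n : ℕ) (K : ℝ → ℂ) (ρ : ℝ) : ℂ :=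
  ((ρ ^ (n + 3) * Real.exp (-Real.pi * ρ ^ 2) : ℝ) : ℂ) * K ρ

theorem integrableOn_pow_mul_exp {b : ℝ} (hb : 0 < b) (n : ℕ) :
    IntegrableOn (fun ρ : ℝ => ρ ^ n * Real.exp (-b * ρ ^ 2)) (Set.Ioi 0) := by
  refine (integrableOn_rpow_mul_exp_neg_mul_sq hb (s := (n : ℕ)) (by
    have : (0 : ℝ) ≤ n := Nat.cast_nonneg _
    linarith)).congr_fun (fun r _ => ?_) measurableSet_Ioi
  simp only [Real.rpow_natCast]

theorem integrableOn_gaussProfile (n : ℕ) {K : ℝ → ℂ} (hK : Continuous K) {C : ℝ}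
    (hC : ∀ ρ, ‖K ρ‖ ≤ C) : IntegrableOn (gaussProfile n K) (Set.Ioi 0) := by
  refine Integrable.mono' (Integrable.mul_const (integrableOn_pow_mul_exp Real.pi_pos (n + 3)) C)
    ?_ ?_
  · unfold gaussProfile
    exact Continuous.aestronglyMeasurable (by fun_prop)
  · filter_upwards [ae_restrict_mem measurableSet_Ioi] with ρ hρ
    have : (0 : ℝ) < ρ := hρ
    rw [gaussProfile, norm_mul, Complex.norm_real, Real.norm_of_nonneg (by positivity)]
    gcongr
    exact hC ρ

theorem norm_sq_gaussProfile_div (n : ℕ) (K : ℝ → ℂ) {ρ : ℝ} (hρ : 0 < ρ) :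
    ‖gaussProfile n K ρ‖ ^ 2 / schrodingerDispersion.φ' ρ =
      ρ ^ (2 * n + 5) * Real.exp (-(2 * Real.pi) * ρ ^ 2) * ‖K ρ‖ ^ 2 / (4 * Real.pi ^ 2) := by
  rw [gaussProfile, norm_mul, Complex.norm_real, Real.norm_of_nonneg (by positivity)]
  have : Real.exp (-(2 * Real.pi) * ρ ^ 2) = Real.exp (-Real.pi * ρ ^ 2) ^ 2 := by
    rw [← Real.exp_nat_mul]; congr 1; push_cast; ring
  rw [this]
  simp only [schrodingerDispersion]
  field_simp
  ring

theorem integrableOn_sq_gaussProfile (n : ℕ) {K : ℝ → ℂ} (hK : Continuous K) {C : ℝ}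
    (hC : ∀ ρ, ‖K ρ‖ ≤ C) :
    IntegrableOn (fun ρ => ‖gaussProfile n K ρ‖ ^ 2 / schrodingerDispersion.φ' ρ) (Set.Ioi 0) := by
  have h : IntegrableOn (fun ρ => ρ ^ (2 * n + 5) * Real.exp (-(2 * Real.pi) * ρ ^ 2) *
      ‖K ρ‖ ^ 2 / (4 * Real.pi ^ 2)) (Set.Ioi 0) := by
    refine Integrable.div_const ?_ _
    refine Integrable.mono' (Integrable.mul_const
      (integrableOn_pow_mul_exp (by positivity : 0 < 2 * Real.pi) (2 * n + 5)) (C ^ 2)) ?_ ?_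
    · exact Continuous.aestronglyMeasurable (by fun_prop)
    · filter_upwards [ae_restrict_mem measurableSet_Ioi] with ρ hρ
      have : (0 : ℝ) < ρ := hρ
      rw [Real.norm_of_nonneg (by positivity)]
      gcongr
      exact hC ρ
  exact h.congr_fun (fun ρ hρ => (norm_sq_gaussProfile_div n K hρ).symm) measurableSet_Ioi

/-- At z = 1 + 2πit the factor exp(-πzρ²) is the profile exp(-πρ²) times the Schrödinger phase
exp(-2π²itρ²), so a Gaussian integral of complex width is a time signal. -/
theorem timeSignal_gaussProfile_sphereFourier {n : ℕ} {p : MvPolynomial (Fin 4) ℝ}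
    (hp : p.IsHomogeneous n) (ξ : Eucl 4) (t : ℝ) :
    timeSignal schrodingerDispersion true (gaussProfile n fun ρ => sphereFourier p (ρ • ξ)) t =
      gaussInt (1 + 2 * Real.pi * t * Complex.I) ξ p := by
  rw [gaussInt_eq_integral_radial (by simp) ξ hp]
  refine setIntegral_congr_fun measurableSet_Ioi fun ρ hρ => ?_
  simp only [gaussProfile, schrodingerDispersion, sgn]
  push_cast
  have : Complex.exp (-(Real.pi * (1 + 2 * Real.pi * t * Complex.I)) * ρ ^ 2) =
      Complex.exp (-(Complex.I * (1 * t * (2 * Real.pi ^ 2 * ρ ^ 2)))) *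
        Complex.exp (-Real.pi * ρ ^ 2) := by
    rw [← Complex.exp_add]; congr 1; ring
  simp only [this]
  ring

/-- By `gaussInt_eq` the Gaussian integrals at two unit vectors differ only through the values of
the polynomials, so the difference K of the two sides has zero time signal. Plancherel in t forces K
= 0 almost everywhere on r > 0, and continuity everywhere there. -/
theorem sphereFourier_mul_polyVal {k : ℕ} {p q : MvPolynomial (Fin 4) ℝ} (hp : IsSolidHarmonic k p)
    (hq : IsSolidHarmonic k q) (θ θ' : S3) {r : ℝ} (hr : 0 < r) :
    ((polyVal q θ' : ℝ) : ℂ) * sphereFourier p (r • (θ : Eucl 4)) =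
      ((polyVal p θ : ℝ) : ℂ) * sphereFourier q (r • (θ' : Eucl 4)) := by
  let K : ℝ → ℂ := fun ρ => ((polyVal q θ' : ℝ) : ℂ) * sphereFourier p (ρ • (θ : Eucl 4)) -
      ((polyVal p θ : ℝ) : ℂ) * sphereFourier q (ρ • (θ' : Eucl 4))
  have hcp := continuous_sphereFourier p
  have hcq := continuous_sphereFourier q
  have hK : Continuous K := by fun_prop
  obtain ⟨C, hC0, hC⟩ := exists_bound_sphereFourier p
  obtain ⟨C', hC0', hC'⟩ := exists_bound_sphereFourier q
  have hKC : ∀ ρ, ‖K ρ‖ ≤ |polyVal q θ'| * C + |polyVal p θ| * C' := by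
    intro ρ
    refine (norm_sub_le _ _).trans ?_
    rw [norm_mul, norm_mul, Complex.norm_real, Complex.norm_real, Real.norm_eq_abs,
      Real.norm_eq_abs]
    gcongr
    · exact hC _
    · exact hC' _
  have h0 : ∀ t, timeSignal schrodingerDispersion true (gaussProfile k K) t = 0 := by
    intro t
    have h1 : timeSignal schrodingerDispersion true (gaussProfile k K) t =
        ((polyVal q θ' : ℝ) : ℂ) * timeSignal schrodingerDispersion true
          (gaussProfile k fun ρ => sphereFourier p (ρ • (θ : Eucl 4))) t -
        ((polyVal p θ : ℝ) : ℂ) * timeSignal schrodingerDispersion true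
          (gaussProfile k fun ρ => sphereFourier q (ρ • (θ' : Eucl 4))) t := by
      have hInt : ∀ (F : ℝ → ℂ), IntegrableOn F (Set.Ioi 0) → IntegrableOn (fun ρ =>
          Complex.exp (-(Complex.I * (sgn true * t * schrodingerDispersion.φ ρ))) * F ρ)
          (Set.Ioi 0) := by
        intro F hF
        have hc := schrodingerDispersion.continuous_φ
        refine Integrable.bdd_mul (c := 1) hF
          (Continuous.aestronglyMeasurable (by fun_prop)) (ae_of_all _ fun ρ => ?_)
        rw [Complex.norm_exp]
        simp
      unfold timeSignal
      rw [← integral_const_mul, ← integral_const_mul, ← integral_sub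
        ((hInt _ (integrableOn_gaussProfile k (by fun_prop) fun ρ => hC _)).const_mul _)
        ((hInt _ (integrableOn_gaussProfile k (by fun_prop) fun ρ => hC' _)).const_mul _)]
      refine integral_congr_ae (ae_of_all _ fun ρ => ?_)
      simp only [gaussProfile, K]
      ring
    rw [h1, timeSignal_gaussProfile_sphereFourier hp.1, timeSignal_gaussProfile_sphereFourier hq.1,
      gaussInt_eq (by simp) _ hp, gaussInt_eq (by simp) _ hq, norm_eq_of_mem_sphere,
      norm_eq_of_mem_sphere]
    ring
  have h2 := lintegral_timeSignal (D := schrodingerDispersion) true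
    (integrableOn_gaussProfile k hK hKC) (integrableOn_sq_gaussProfile k hK hKC)
  simp only [h0] at h2
  have h3 : ∫⁻ ρ in Set.Ioi (0 : ℝ), ENNReal.ofReal (‖gaussProfile k K ρ‖ ^ 2 /
      schrodingerDispersion.φ' ρ) = 0 := by
    have h4 := h2.symm
    simp only [enorm_zero, ne_eq, OfNat.ofNat_ne_zero, not_false_eq_true, zero_pow,
      lintegral_zero] at h4
    rcases mul_eq_zero.1 h4 with h5 | h5
    · exact absurd (ENNReal.ofReal_eq_zero.1 h5) (not_le.2 (by positivity))
    · exact h5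
  rw [lintegral_eq_zero_iff' (integrableOn_sq_gaussProfile k hK hKC).1.aemeasurable.ennreal_ofReal]
    at h3
  have h4 : K =ᵐ[volume.restrict (Set.Ioi 0)] fun _ => 0 := by
    filter_upwards [h3, ae_restrict_mem measurableSet_Ioi] with ρ hρ hρ'
    have hpos : (0 : ℝ) < ρ := hρ'
    rw [norm_sq_gaussProfile_div k K hpos] at hρ
    simp only [Pi.zero_apply, ENNReal.ofReal_eq_zero] at hρ
    by_contra hne
    have : 0 < ‖K ρ‖ := norm_pos_iff.2 hne
    exact absurd hρ (not_le.2 (by positivity))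
  have h5 := Measure.eqOn_open_of_ae_eq h4 isOpen_Ioi hK.continuousOn continuousOn_const
  exact sub_eq_zero.1 (h5 hr)

/-- There is a solid harmonic of degree `k` that does not vanish on the sphere. -/
def HasHarmonic (k : ℕ) : Prop :=
  ∃ (p : MvPolynomial (Fin 4) ℝ) (θ : S3), IsSolidHarmonic k p ∧ polyVal p θ ≠ 0

open Classical in
/-- The radial profile of the Fourier transform of a spherical harmonic of degree `k` on the
sphere; it is a multiple of `J_{k+1}(2πr) / r`. -/
def radialProfile (k : ℕ) (r : ℝ) : ℂ :=
  if h : HasHarmonic k then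
    sphereFourier h.choose (r • (h.choose_spec.choose : Eucl 4)) /
      ((polyVal h.choose h.choose_spec.choose : ℝ) : ℂ)
  else 0

theorem continuous_radialProfile (k : ℕ) : Continuous (radialProfile k) := by
  unfold radialProfile
  split_ifs with h
  · have := continuous_sphereFourier h.choose
    fun_prop
  · fun_prop

theorem exists_bound_radialProfile (k : ℕ) : ∃ C, 0 ≤ C ∧ ∀ r, ‖radialProfile k r‖ ≤ C := by
  unfold radialProfile
  split_ifs with h
  · obtain ⟨C, h0, hC⟩ := exists_bound_sphereFourier h.choose
    refine ⟨C / ‖((polyVal h.choose h.choose_spec.choose : ℝ) : ℂ)‖, by positivity, fun r => ?_⟩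
    rw [norm_div]
    gcongr
    exact hC _
  · exact ⟨0, le_rfl, fun r => by simp⟩

/-- The Funk–Hecke formula. -/
theorem sphereFourier_smul {k : ℕ} {p : MvPolynomial (Fin 4) ℝ} (hp : IsSolidHarmonic k p)
    {r : ℝ} (hr : 0 < r) (ω : S3) :
    sphereFourier p (r • (ω : Eucl 4)) = radialProfile k r * ((polyVal p ω : ℝ) : ℂ) := by
  by_cases h : HasHarmonic k
  · obtain ⟨h1, h2⟩ := h.choose_spec.choose_spec
    have h3 := sphereFourier_mul_polyVal hp h1 ω h.choose_spec.choose hr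
    have h4 : ((polyVal h.choose h.choose_spec.choose : ℝ) : ℂ) ≠ 0 := by exact_mod_cast h2
    rw [radialProfile, dif_pos h]
    field_simp
    linear_combination h3
  -- If no harmonic of degree k is nonzero on the sphere, both sides vanish, so the default value 0
  -- of `radialProfile` does no harm.
  · have h0 : ∀ ω : S3, polyVal p ω = 0 := fun ω => by
      by_contra hne
      exact h ⟨p, ω, hp, hne⟩
    simp [sphereFourier, h0]

theorem lintegral_gauss_moment {b : ℝ} (hb : 0 < b) (k : ℕ) :
    ∫⁻ r in Set.Ioi (0 : ℝ), ENNReal.ofReal (r ^ (2 * k + 1) * Real.exp (-b * r ^ 2)) =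
      ENNReal.ofReal (k.factorial / (2 * b ^ (k + 1))) := by
  rw [← ofReal_integral_eq_lintegral_ofReal (integrableOn_pow_mul_exp hb _)]
  · congr 1
    have h := integral_rpow_mul_exp_neg_mul_rpow (p := 2) (q := (2 * k + 1 : ℕ)) two_pos
      (by have : (0 : ℝ) ≤ (2 * k + 1 : ℕ) := Nat.cast_nonneg _
          linarith) hb
    have e : ((2 * k + 1 : ℕ) + 1 : ℝ) / 2 = k + 1 := by push_cast; ring
    rw [neg_div, e, Real.Gamma_nat_eq_factorial, Real.rpow_neg hb.le] at h
    rw [show ((k : ℝ) + 1) = ((k + 1 : ℕ) : ℝ) by push_cast; ring, Real.rpow_natCast] at h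
    simp only [Real.rpow_natCast, Real.rpow_ofNat] at h
    rw [h]
    field_simp
  · filter_upwards [ae_restrict_mem measurableSet_Ioi] with ρ hρ
    have : (0 : ℝ) < ρ := hρ
    simp only [Pi.zero_apply]
    positivity

theorem lintegral_inv_one_add_sq :
    ∫⁻ t : ℝ, ENNReal.ofReal ((1 + (2 * Real.pi * t) ^ 2)⁻¹) = ENNReal.ofReal (1 / 2) := by
  have hpi := Real.pi_pos
  have h1 : Integrable fun t : ℝ => (1 + (2 * Real.pi * t) ^ 2)⁻¹ :=
    integrable_inv_one_add_sq.comp_mul_left' (by positivity)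
  rw [← ofReal_integral_eq_lintegral_ofReal h1 (ae_of_all _ fun t => by positivity)]
  congr 1
  have h2 := Measure.integral_comp_mul_left (fun x : ℝ => (1 + x ^ 2)⁻¹) (2 * Real.pi)
  rw [h2, integral_univ_inv_one_add_sq, abs_of_pos (by positivity), smul_eq_mul]
  field_simp

/-- This is `gaussInt_eq` at ξ = rθ, divided by p(θ) ≠ 0 on both sides. -/
theorem timeSignal_gaussProfile_radialProfile {k : ℕ} (hk : HasHarmonic k) {r : ℝ} (hr : 0 < r)
    (t : ℝ) :
    timeSignal schrodingerDispersion true (gaussProfile k fun ρ => radialProfile k (ρ * r)) t =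
      Complex.I ^ k * (1 + 2 * Real.pi * t * Complex.I)⁻¹ ^ (k + 2) * r ^ k *
        Complex.exp (-Real.pi * r ^ 2 / (1 + 2 * Real.pi * t * Complex.I)) := by
  obtain ⟨p, θ, hp, hne⟩ := hk
  have hne' : ((polyVal p θ : ℝ) : ℂ) ≠ 0 := by exact_mod_cast hne
  refine mul_right_cancel₀ hne' ?_
  have h1 := timeSignal_gaussProfile_sphereFourier hp.1 (r • (θ : Eucl 4)) t
  rw [gaussInt_eq (by simp) _ hp, polyVal_smul hp.1, norm_smul_sphere hr] at h1
  have h2 : timeSignal schrodingerDispersion true (gaussProfile k fun ρ =>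
      sphereFourier p (ρ • r • (θ : Eucl 4))) t =
      timeSignal schrodingerDispersion true (gaussProfile k fun ρ => radialProfile k (ρ * r)) t *
        ((polyVal p θ : ℝ) : ℂ) := by
    rw [timeSignal, timeSignal, ← integral_mul_const]
    refine setIntegral_congr_fun measurableSet_Ioi fun ρ hρ => ?_
    simp only [gaussProfile, smul_smul, sphereFourier_smul hp (mul_pos hρ hr)]
    ring
  rw [← h2, h1]
  push_cast
  ring

theorem lintegral_radial_scale (e : ℝ → ℝ≥0∞) {ρ : ℝ} (hρ : 0 < ρ) :
    ENNReal.ofReal (ρ ^ 2) * ∫⁻ r, e (ρ * r) ∂(radialMeasure 1) = ∫⁻ r, e r ∂(radialMeasure 1) := by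
  rw [lintegral_radialMeasure, lintegral_radialMeasure]
  have h1 : (fun x => ρ * x) '' Set.Ioi 0 = Set.Ioi (0 : ℝ) := by
    rw [Set.image_mul_left_Ioi hρ, mul_zero]
  have h2 := lintegral_image_eq_lintegral_abs_deriv_mul measurableSet_Ioi
    (fun x (_ : x ∈ Set.Ioi (0 : ℝ)) => ((hasDerivAt_id x).const_mul ρ).hasDerivWithinAt)
    (fun a _ b _ h => mul_left_cancel₀ hρ.ne' h) (fun r => ENNReal.ofReal (r ^ 1) * e r)
  simp only [id_eq] at h2
  rw [h1] at h2
  rw [h2, ← lintegral_const_mul' _ _ ENNReal.ofReal_ne_top]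
  refine lintegral_congr fun r => ?_
  rw [mul_one, abs_of_pos hρ, ← mul_assoc, ← mul_assoc, ← ENNReal.ofReal_mul (by positivity),
    ← ENNReal.ofReal_mul (by positivity)]
  congr 2
  ring

/-- Plancherel in t for the explicit signal. With z = 1 + 2πit the left side comes from |z|² = 1 +
(2πt)² and Re(1/z) = |z|⁻². -/
theorem lintegral_gaussProfile_radialProfile {k : ℕ} (hk : HasHarmonic k) {r : ℝ} (hr : 0 < r) :
    ∫⁻ t : ℝ, ENNReal.ofReal (r ^ (2 * k) * (1 + (2 * Real.pi * t) ^ 2)⁻¹ ^ (k + 2) *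
        Real.exp (-(2 * Real.pi * (1 + (2 * Real.pi * t) ^ 2)⁻¹) * r ^ 2)) =
      ENNReal.ofReal (2 * Real.pi) * ∫⁻ ρ in Set.Ioi (0 : ℝ),
        ENNReal.ofReal (ρ ^ (2 * k + 5) * Real.exp (-(2 * Real.pi) * ρ ^ 2) / (4 * Real.pi ^ 2)) *
          ‖radialProfile k (ρ * r)‖ₑ ^ 2 := by
  obtain ⟨C, hC0, hC⟩ := exists_bound_radialProfile k
  have hcont := continuous_radialProfile k
  have hK : Continuous fun ρ => radialProfile k (ρ * r) := by fun_prop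
  have h := lintegral_timeSignal (D := schrodingerDispersion) true
    (integrableOn_gaussProfile k hK fun ρ => hC _) (integrableOn_sq_gaussProfile k hK fun ρ => hC _)
  have e1 : ∫⁻ ρ in Set.Ioi (0 : ℝ),
        ENNReal.ofReal (ρ ^ (2 * k + 5) * Real.exp (-(2 * Real.pi) * ρ ^ 2) / (4 * Real.pi ^ 2)) *
          ‖radialProfile k (ρ * r)‖ₑ ^ 2 = ∫⁻ ρ in Set.Ioi (0 : ℝ),
        ENNReal.ofReal (‖gaussProfile k (fun ρ => radialProfile k (ρ * r)) ρ‖ ^ 2 /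
          schrodingerDispersion.φ' ρ) := by
    refine setLIntegral_congr_fun measurableSet_Ioi fun ρ hρ => ?_
    have : (0 : ℝ) < ρ := hρ
    rw [norm_sq_gaussProfile_div k _ hρ, ← ofReal_norm, ← ENNReal.ofReal_pow (norm_nonneg _),
      ← ENNReal.ofReal_mul (by positivity)]
    congr 1
    ring
  rw [e1, ← h]
  refine lintegral_congr fun t => ?_
  rw [timeSignal_gaussProfile_radialProfile hk hr, ← ofReal_norm,
    ← ENNReal.ofReal_pow (norm_nonneg _)]
  congr 1
  have hn : ‖(1 + 2 * Real.pi * t * Complex.I : ℂ)‖ ^ 2 = 1 + (2 * Real.pi * t) ^ 2 := by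
    rw [← Complex.normSq_eq_norm_sq, Complex.normSq_apply]
    simp
    ring
  have hre : (-Real.pi * r ^ 2 / (1 + 2 * Real.pi * t * Complex.I) : ℂ).re =
      -(Real.pi * (1 + (2 * Real.pi * t) ^ 2)⁻¹) * r ^ 2 := by
    rw [Complex.div_re, Complex.normSq_eq_norm_sq, hn]
    simp [← Complex.ofReal_pow]
    ring
  rw [norm_mul, norm_mul, norm_mul, norm_pow, Complex.norm_I, one_pow, one_mul, norm_pow, norm_inv,
    norm_pow, Complex.norm_real, Real.norm_of_nonneg hr.le, Complex.norm_exp, hre, ← hn, ← inv_pow]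
  have : Real.exp (-(2 * Real.pi * ‖(1 + 2 * Real.pi * t * Complex.I : ℂ)‖⁻¹ ^ 2) * r ^ 2) =
      Real.exp (-(Real.pi * ‖(1 + 2 * Real.pi * t * Complex.I : ℂ)‖⁻¹ ^ 2) * r ^ 2) ^ 2 := by
    rw [← Real.exp_nat_mul]; congr 1; push_cast; ring
  rw [this]
  ring

/-- The normalisation of the radial profiles: `∫ J_{k+1}(r)² dr / r = 1 / (2(k+1))`. -/
theorem lintegral_radialProfile {k : ℕ} (hk : HasHarmonic k) :
    ∫⁻ r, ‖radialProfile k r‖ₑ ^ 2 ∂(radialMeasure 1) =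
      ENNReal.ofReal (2 * Real.pi ^ 2 / (k + 1)) := by
  have hpi := Real.pi_pos
  have hcont := continuous_radialProfile k
  set I := ∫⁻ r, ‖radialProfile k r‖ₑ ^ 2 ∂(radialMeasure 1) with hI
  -- Integrating Plancherel's identity against r dr determines the unknown norm. On the explicit
  -- side the r-integral is a Gaussian moment proportional to w^{-(k+1)}, so w^{k+2} leaves one
  -- factor w = 1/(1 + (2πt)²), whose time integral is 1/2.
  have hL : ∫⁻ r, (∫⁻ t : ℝ, ENNReal.ofReal (r ^ (2 * k) * (1 + (2 * Real.pi * t) ^ 2)⁻¹ ^ (k + 2) *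
        Real.exp (-(2 * Real.pi * (1 + (2 * Real.pi * t) ^ 2)⁻¹) * r ^ 2))) ∂(radialMeasure 1) =
      ENNReal.ofReal (k.factorial / (4 * (2 * Real.pi) ^ (k + 1))) := by
    rw [lintegral_lintegral_swap (by fun_prop)]
    have e : ∀ t : ℝ, ∫⁻ r, ENNReal.ofReal (r ^ (2 * k) *
        (1 + (2 * Real.pi * t) ^ 2)⁻¹ ^ (k + 2) *
        Real.exp (-(2 * Real.pi * (1 + (2 * Real.pi * t) ^ 2)⁻¹) * r ^ 2)) ∂(radialMeasure 1) =
        ENNReal.ofReal (k.factorial / (2 * (2 * Real.pi) ^ (k + 1))) *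
          ENNReal.ofReal ((1 + (2 * Real.pi * t) ^ 2)⁻¹) := by
      intro t
      set w := (1 + (2 * Real.pi * t) ^ 2)⁻¹ with hw
      have hw0 : 0 < w := by positivity
      have h1 : ∫⁻ r in Set.Ioi (0 : ℝ), ENNReal.ofReal (w ^ (k + 2)) *
          ENNReal.ofReal (r ^ (2 * k + 1) * Real.exp (-(2 * Real.pi * w) * r ^ 2)) =
          ENNReal.ofReal (w ^ (k + 2)) *
            ENNReal.ofReal (k.factorial / (2 * (2 * Real.pi * w) ^ (k + 1))) := by
        rw [lintegral_const_mul' _ _ ENNReal.ofReal_ne_top,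
          lintegral_gauss_moment (by positivity) k]
      rw [lintegral_radialMeasure, ← ENNReal.ofReal_mul (by positivity)]
      refine Eq.trans ?_ (h1.trans ?_)
      · refine setLIntegral_congr_fun measurableSet_Ioi fun r hr => ?_
        have : (0 : ℝ) < r := hr
        rw [← ENNReal.ofReal_mul (by positivity), ← ENNReal.ofReal_mul (by positivity)]
        congr 1
        ring
      · rw [← ENNReal.ofReal_mul (by positivity)]
        congr 1
        field_simp
        ring
    simp_rw [e]
    rw [lintegral_const_mul' _ _ ENNReal.ofReal_ne_top, lintegral_inv_one_add_sq,
      ← ENNReal.ofReal_mul (by positivity)]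
    congr 1
    field_simp
    norm_num
  -- On the other side the scaling r ↦ r/ρ extracts ρ⁻² and the norm I, leaving the Gaussian moment
  -- of ρ^{2k+3}.
  have hR : ∫⁻ r, (ENNReal.ofReal (2 * Real.pi) * ∫⁻ ρ in Set.Ioi (0 : ℝ),
        ENNReal.ofReal (ρ ^ (2 * k + 5) * Real.exp (-(2 * Real.pi) * ρ ^ 2) / (4 * Real.pi ^ 2)) *
          ‖radialProfile k (ρ * r)‖ₑ ^ 2) ∂(radialMeasure 1) =
      ENNReal.ofReal ((k + 1).factorial / (4 * Real.pi * (2 * Real.pi) ^ (k + 2))) * I := by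
    rw [lintegral_const_mul' _ _ ENNReal.ofReal_ne_top, lintegral_lintegral_swap (by fun_prop)]
    have e : ∫⁻ ρ in Set.Ioi (0 : ℝ), (∫⁻ r, ENNReal.ofReal (ρ ^ (2 * k + 5) *
        Real.exp (-(2 * Real.pi) * ρ ^ 2) / (4 * Real.pi ^ 2)) *
          ‖radialProfile k (ρ * r)‖ₑ ^ 2 ∂(radialMeasure 1)) =
        ∫⁻ ρ in Set.Ioi (0 : ℝ), ENNReal.ofReal (1 / (4 * Real.pi ^ 2)) * I *
          ENNReal.ofReal (ρ ^ (2 * (k + 1) + 1) * Real.exp (-(2 * Real.pi) * ρ ^ 2)) := by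
      refine setLIntegral_congr_fun measurableSet_Ioi fun ρ hρ => ?_
      have hρ' : (0 : ℝ) < ρ := hρ
      rw [lintegral_const_mul' _ _ ENNReal.ofReal_ne_top, hI,
        ← lintegral_radial_scale (fun r => ‖radialProfile k r‖ₑ ^ 2) hρ', ← mul_assoc,
        mul_right_comm, ← ENNReal.ofReal_mul (by positivity), ← ENNReal.ofReal_mul (by positivity)]
      congr 2
      ring
    rw [e, lintegral_const_mul _ (by fun_prop), lintegral_gauss_moment (by positivity) (k + 1),
      ← mul_assoc, ← mul_assoc, ← ENNReal.ofReal_mul (by positivity), mul_right_comm,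
      ← ENNReal.ofReal_mul (by positivity)]
    congr 2
    field_simp
  have hLR : ENNReal.ofReal (k.factorial / (4 * (2 * Real.pi) ^ (k + 1))) =
      ENNReal.ofReal ((k + 1).factorial / (4 * Real.pi * (2 * Real.pi) ^ (k + 2))) * I := by
    rw [← hL, ← hR]
    refine lintegral_congr_ae ?_
    filter_upwards [ae_radialMeasure_pos 1] with r hr
    exact lintegral_gaussProfile_radialProfile hk hr
  set c := ((k + 1).factorial / (4 * Real.pi * (2 * Real.pi) ^ (k + 2)) : ℝ) with hc
  have hc0 : 0 < c := by positivity
  have h1 : ENNReal.ofReal c⁻¹ * (ENNReal.ofReal c * I) = I := by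
    rw [← mul_assoc, ← ENNReal.ofReal_mul (by positivity), inv_mul_cancel₀ hc0.ne']
    simp
  rw [← h1, ← hLR, ← ENNReal.ofReal_mul (by positivity)]
  congr 1
  rw [hc, Nat.factorial_succ]
  push_cast
  field_simp
  ring

end FunkHecke


/-! ### Radial signals -/

section Signals

/-- A bounded measurable function supported in a compact subset of `(0, ∞)`. -/
def IsProfile (b : ℝ → ℂ) : Prop :=
  Measurable b ∧ ∃ ε R C, 0 < ε ∧ (∀ ρ, ‖b ρ‖ ≤ C) ∧ ∀ ρ, ρ ∉ Set.Icc ε R → b ρ = 0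

/-- Only a compact part of (0, ∞) matters, so the factor may be singular at 0 or unbounded at ∞;
amplitudes and symbols are such factors. -/
theorem IsProfile.mul {a b : ℝ → ℂ} (ha : Measurable a) (hac : ContinuousOn a (Set.Ioi 0))
    (hb : IsProfile b) : IsProfile fun ρ => a ρ * b ρ := by
  obtain ⟨hm, ε, R, C, hε, hC, hs⟩ := hb
  obtain ⟨C', hC'⟩ := (isCompact_Icc (a := ε) (b := R)).exists_bound_of_continuousOn
    (hac.mono fun x hx => hε.trans_le hx.1)
  refine ⟨ha.mul hm, ε, R, |C'| * |C|, hε, fun ρ => ?_, fun ρ hρ => by simp [hs ρ hρ]⟩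
  by_cases hρ : ρ ∈ Set.Icc ε R
  · rw [norm_mul]
    exact mul_le_mul ((hC' ρ hρ).trans (le_abs_self _)) ((hC ρ).trans (le_abs_self _))
      (norm_nonneg _) (abs_nonneg _)
  · simp only [hs ρ hρ, mul_zero, norm_zero]
    positivity

theorem IsProfile.conj_mul {a b : ℝ → ℂ} (ha : IsProfile a) (hb : IsProfile b) :
    IsProfile fun ρ => (starRingEnd ℂ) (a ρ) * b ρ := by
  obtain ⟨hm, ε, R, C, hε, hC, hs⟩ := ha
  obtain ⟨hm', -, -, C', -, hC', -⟩ := hb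
  refine ⟨(Complex.continuous_conj.measurable.comp hm).mul hm', ε, R, |C| * |C'|, hε, fun ρ => ?_,
    fun ρ hρ => by simp [hs ρ hρ]⟩
  rw [norm_mul, RCLike.norm_conj]
  exact mul_le_mul ((hC ρ).trans (le_abs_self _)) ((hC' ρ).trans (le_abs_self _))
      (norm_nonneg _) (abs_nonneg _)

theorem IsProfile.integrableOn {b : ℝ → ℂ} (hb : IsProfile b) : IntegrableOn b (Set.Ioi 0) := by
  obtain ⟨hm, ε, R, C, hε, hC, hs⟩ := hb
  have h1 : IntegrableOn b (Set.Icc ε R) :=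
    Measure.integrableOn_of_bounded (by simp) hm.aestronglyMeasurable (ae_of_all _ hC)
  rw [integrableOn_iff_integrable_of_support_subset] at h1
  · exact h1.integrableOn
  · intro ρ hρ
    by_contra hcon
    exact hρ (hs ρ hcon)

variable (D : Dispersion)

/-- The amplitude attached to a dispersion relation. -/
def Dispersion.amp (ρ : ℝ) : ℝ := Real.sqrt (D.φ' ρ / (4 * Real.pi ^ 2 * ρ))

theorem Dispersion.measurable_amp : Measurable D.amp := by
  have := D.continuous_φ'.measurable
  unfold Dispersion.amp
  fun_prop

theorem Dispersion.continuousOn_amp : ContinuousOn D.amp (Set.Ioi 0) := by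
  refine Real.continuous_sqrt.comp_continuousOn ?_
  refine D.continuous_φ'.continuousOn.div (by fun_prop) fun ρ hρ => ?_
  have : (0 : ℝ) < ρ := hρ
  positivity

theorem Dispersion.amp_sq {ρ : ℝ} (hρ : 0 < ρ) : D.amp ρ ^ 2 = D.φ' ρ / (4 * Real.pi ^ 2 * ρ) :=
  Real.sq_sqrt (by have := D.deriv_pos ρ hρ; positivity)

/-- The radial density of a mode at distance `r`. -/
def modeDensity (k : ℕ) (b : ℝ → ℂ) (r ρ : ℝ) : ℂ :=
  (ρ ^ 3 * D.amp ρ : ℝ) * b ρ * radialProfile k (ρ * r)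

variable {D}

theorem isProfile_modeDensity (k : ℕ) {b : ℝ → ℂ} (hb : IsProfile b) (r : ℝ) :
    IsProfile (modeDensity D k b r) := by
  have h1 := D.measurable_amp
  have h2 := D.continuousOn_amp
  have h3 := continuous_radialProfile k
  have h := hb.mul (a := fun ρ => ((ρ ^ 3 * D.amp ρ : ℝ) : ℂ) * radialProfile k (ρ * r))
    (by fun_prop) (by fun_prop)
  convert h using 1
  funext ρ
  rw [modeDensity]; ring

/-- This is what the amplitude is chosen for: amp² cancels φ', and ρ⁵/(4π²) remains whatever the
dispersion relation. -/
theorem conj_modeDensity_mul (k : ℕ) (b b' : ℝ → ℂ) (r : ℝ) {ρ : ℝ} (hρ : 0 < ρ) :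
    (starRingEnd ℂ) (modeDensity D k b r ρ) * modeDensity D k b' r ρ / D.φ' ρ =
      ((ρ ^ 5 / (4 * Real.pi ^ 2) : ℝ) : ℂ) * ((starRingEnd ℂ) (b ρ) * b' ρ) *
        ((‖radialProfile k (ρ * r)‖ ^ 2 : ℝ) : ℂ) := by
  have h1 := D.amp_sq hρ
  have h2 : ((D.φ' ρ : ℝ) : ℂ) ≠ 0 := by exact_mod_cast (D.deriv_pos ρ hρ).ne'
  have h3 : ((ρ ^ 3 * D.amp ρ : ℝ) : ℂ) * ((ρ ^ 3 * D.amp ρ : ℝ) : ℂ) =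
      ((ρ ^ 5 / (4 * Real.pi ^ 2) : ℝ) : ℂ) * D.φ' ρ := by
    rw [← Complex.ofReal_mul, ← Complex.ofReal_mul]
    congr 1
    calc _ = ρ ^ 6 * D.amp ρ ^ 2 := by ring
      _ = _ := by rw [h1]; field_simp
  simp only [modeDensity, map_mul, Complex.conj_ofReal, div_eq_iff h2]
  push_cast [← Complex.conj_mul']
  push_cast at h3
  linear_combination ((starRingEnd ℂ) (b ρ) * b' ρ * (starRingEnd ℂ) (radialProfile k (ρ * r)) *
    radialProfile k (ρ * r)) * h3

theorem norm_sq_modeDensity_div (k : ℕ) (b : ℝ → ℂ) (r : ℝ) {ρ : ℝ} (hρ : 0 < ρ) :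
    ‖modeDensity D k b r ρ‖ ^ 2 / D.φ' ρ =
      ρ ^ 5 / (4 * Real.pi ^ 2) * ‖b ρ‖ ^ 2 * ‖radialProfile k (ρ * r)‖ ^ 2 := by
  have h := conj_modeDensity_mul (D := D) k b b r hρ
  rw [Complex.conj_mul', Complex.conj_mul'] at h
  exact_mod_cast h

theorem integrableOn_sq_modeDensity (k : ℕ) {b : ℝ → ℂ} (hb : IsProfile b) (r : ℝ) :
    IntegrableOn (fun ρ => ‖modeDensity D k b r ρ‖ ^ 2 / D.φ' ρ) (Set.Ioi 0) := by
  have h3 := continuous_radialProfile k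
  have h := ((hb.conj_mul hb).mul (a := fun ρ => ((ρ ^ 5 / (4 * Real.pi ^ 2) : ℝ) : ℂ) *
    ((‖radialProfile k (ρ * r)‖ ^ 2 : ℝ) : ℂ)) (by fun_prop) (by fun_prop)).integrableOn.norm
  refine IntegrableOn.congr_fun h (fun ρ hρ => ?_) measurableSet_Ioi
  have hρ' : (0 : ℝ) < ρ := hρ
  simp only [norm_sq_modeDensity_div k b r hρ', norm_mul, RCLike.norm_conj, Complex.norm_real,
    Real.norm_eq_abs]
  rw [abs_of_nonneg (by positivity), abs_of_nonneg (by positivity)]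
  ring

variable (D) in
/-- The time signal of a mode at distance `r`. -/
def modeSignal (s : Bool) (k : ℕ) (b : ℝ → ℂ) (q : ℝ × ℝ) : ℂ :=
  timeSignal D s (modeDensity D k b q.2) q.1

theorem stronglyMeasurable_modeSignal (s : Bool) (k : ℕ) {b : ℝ → ℂ} (hb : IsProfile b) :
    StronglyMeasurable (modeSignal D s k b) := by
  have h1 := D.measurable_amp
  have h2 := D.continuous_φ
  have h3 := continuous_radialProfile k
  have h4 := hb.1
  have hm : StronglyMeasurable (fun z : (ℝ × ℝ) × ℝ =>
      Complex.exp (-(Complex.I * (sgn s * z.1.1 * D.φ z.2))) * modeDensity D k b z.1.2 z.2) := by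
    refine Measurable.stronglyMeasurable ?_
    unfold modeDensity
    fun_prop
  exact hm.integral_prod_right (ν := volume.restrict (Set.Ioi 0))

theorem lintegral_radialProfile_lt_top (k : ℕ) :
    ∫⁻ r, ‖radialProfile k r‖ₑ ^ 2 ∂(radialMeasure 1) < ⊤ := by
  by_cases hk : HasHarmonic k
  · rw [lintegral_radialProfile hk]; exact ENNReal.ofReal_lt_top
  · simp [radialProfile, hk]

theorem lintegral_radialProfile_scale (k : ℕ) {ρ : ℝ} (hρ : 0 < ρ) :
    ∫⁻ r, ‖radialProfile k (ρ * r)‖ₑ ^ 2 ∂(radialMeasure 1) =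
      ENNReal.ofReal (ρ ^ 2)⁻¹ * ∫⁻ r, ‖radialProfile k r‖ₑ ^ 2 ∂(radialMeasure 1) := by
  rw [← lintegral_radial_scale (fun r => ‖radialProfile k r‖ₑ ^ 2) hρ, ← mul_assoc,
    ← ENNReal.ofReal_mul (by positivity), inv_mul_cancel₀ (by positivity), ENNReal.ofReal_one,
    one_mul]

theorem integrable_norm_sq_radialProfile (k : ℕ) {ρ : ℝ} (hρ : 0 < ρ) :
    Integrable (fun r => ‖radialProfile k (ρ * r)‖ ^ 2) (radialMeasure 1) := by
  have h3 := continuous_radialProfile k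
  refine ⟨Continuous.aestronglyMeasurable (by fun_prop), ?_⟩
  have h : ∫⁻ r, ‖radialProfile k (ρ * r)‖ₑ ^ 2 ∂(radialMeasure 1) < ⊤ := by
    rw [lintegral_radialProfile_scale k hρ]
    exact ENNReal.mul_lt_top ENNReal.ofReal_lt_top (lintegral_radialProfile_lt_top k)
  refine lt_of_le_of_lt (le_of_eq (lintegral_congr fun r => ?_)) h
  simp [enorm_pow]

theorem integral_norm_sq_radialProfile {k : ℕ} (hk : HasHarmonic k) {ρ : ℝ} (hρ : 0 < ρ) :
    ∫ r, ‖radialProfile k (ρ * r)‖ ^ 2 ∂(radialMeasure 1) =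
      2 * Real.pi ^ 2 / (k + 1) / ρ ^ 2 := by
  have h3 := continuous_radialProfile k
  rw [integral_eq_lintegral_of_nonneg_ae (ae_of_all _ fun r => by positivity)
    (Continuous.aestronglyMeasurable (by fun_prop))]
  have h : ∫⁻ r, ENNReal.ofReal (‖radialProfile k (ρ * r)‖ ^ 2) ∂(radialMeasure 1) =
      ENNReal.ofReal (2 * Real.pi ^ 2 / (k + 1) / ρ ^ 2) := by
    have e : ∀ r, ENNReal.ofReal (‖radialProfile k (ρ * r)‖ ^ 2) =
        ‖radialProfile k (ρ * r)‖ₑ ^ 2 := fun r => by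
      rw [ENNReal.ofReal_pow (norm_nonneg _), ofReal_norm]
    simp_rw [e]
    rw [lintegral_radialProfile_scale k hρ, lintegral_radialProfile hk,
      ← ENNReal.ofReal_mul (by positivity)]
    congr 1
    field_simp
  rw [h, ENNReal.toReal_ofReal (by positivity)]

/-- Tonelli: the time norm at fixed r is given by Plancherel, and integrating in r by scaling leaves
a multiple of ∫ ρ³ |b|², finite for a profile. -/
theorem memLp_modeSignal (s : Bool) (k : ℕ) {b : ℝ → ℂ} (hb : IsProfile b) :
    MemLp (modeSignal D s k b) 2 (volume.prod (radialMeasure 1)) := by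
  have hsm := stronglyMeasurable_modeSignal (D := D) s k hb
  have hc := continuous_radialProfile k
  have hbm := hb.1
  refine ⟨hsm.aestronglyMeasurable, ?_⟩
  rw [eLpNorm_lt_top_iff_lintegral_rpow_enorm_lt_top two_ne_zero (by simp)]
  simp only [ENNReal.toReal_ofNat, ENNReal.rpow_ofNat]
  rw [lintegral_prod_symm _ (by fun_prop)]
  have e1 : ∀ r, ∫⁻ t, ‖modeSignal D s k b (t, r)‖ₑ ^ 2 = ENNReal.ofReal (2 * Real.pi) *
      ∫⁻ ρ in Set.Ioi (0 : ℝ), ENNReal.ofReal (ρ ^ 5 / (4 * Real.pi ^ 2) * ‖b ρ‖ ^ 2) *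
        ‖radialProfile k (ρ * r)‖ₑ ^ 2 := by
    intro r
    rw [show (∫⁻ t, ‖modeSignal D s k b (t, r)‖ₑ ^ 2) =
      ∫⁻ t, ‖timeSignal D s (modeDensity D k b r) t‖ₑ ^ 2 from rfl,
      lintegral_timeSignal s (isProfile_modeDensity k hb r).integrableOn
        (integrableOn_sq_modeDensity k hb r)]
    congr 1
    refine setLIntegral_congr_fun measurableSet_Ioi fun ρ hρ => ?_
    have hρ' : (0 : ℝ) < ρ := hρ
    rw [norm_sq_modeDensity_div k b r hρ', ENNReal.ofReal_mul (by positivity),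
      ENNReal.ofReal_pow (norm_nonneg _) 2, ofReal_norm]
  simp_rw [e1]
  rw [lintegral_const_mul' _ _ ENNReal.ofReal_ne_top, lintegral_lintegral_swap (by fun_prop)]
  refine ENNReal.mul_lt_top ENNReal.ofReal_lt_top ?_
  have e2 : ∫⁻ ρ in Set.Ioi (0 : ℝ), (∫⁻ r, ENNReal.ofReal (ρ ^ 5 / (4 * Real.pi ^ 2) *
      ‖b ρ‖ ^ 2) * ‖radialProfile k (ρ * r)‖ₑ ^ 2 ∂(radialMeasure 1)) =
      ∫⁻ ρ in Set.Ioi (0 : ℝ), ‖((ρ ^ 3 / (4 * Real.pi ^ 2) : ℝ) : ℂ) *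
        ((starRingEnd ℂ) (b ρ) * b ρ)‖ₑ *
          ∫⁻ r, ‖radialProfile k r‖ₑ ^ 2 ∂(radialMeasure 1) := by
    refine setLIntegral_congr_fun measurableSet_Ioi fun ρ hρ => ?_
    have hρ' : (0 : ℝ) < ρ := hρ
    rw [lintegral_const_mul' _ _ ENNReal.ofReal_ne_top, lintegral_radialProfile_scale k hρ',
      ← mul_assoc, ← ENNReal.ofReal_mul (by positivity)]
    congr 1
    rw [← ofReal_norm, Complex.conj_mul']
    congr 1
    rw [norm_mul, norm_pow, Complex.norm_real, Complex.norm_real, norm_norm,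
      Real.norm_of_nonneg (by positivity)]
    field_simp
  rw [e2, lintegral_mul_const' _ _ (lintegral_radialProfile_lt_top k).ne]
  refine ENNReal.mul_lt_top ?_ (lintegral_radialProfile_lt_top k)
  exact ((hb.conj_mul hb).mul (a := fun ρ => ((ρ ^ 3 / (4 * Real.pi ^ 2) : ℝ) : ℂ))
    (by fun_prop) (by fun_prop)).integrableOn.2

theorem integral_radialProfile_swap {k : ℕ} (hk : HasHarmonic k) {F : ℝ → ℂ} (hFm : Measurable F)
    (hF : IntegrableOn (fun ρ => (((ρ ^ 2)⁻¹ : ℝ) : ℂ) * F ρ) (Set.Ioi 0)) :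
    ∫ r, (∫ ρ in Set.Ioi (0 : ℝ), F ρ * ((‖radialProfile k (ρ * r)‖ ^ 2 : ℝ) : ℂ))
        ∂(radialMeasure 1) =
      ∫ ρ in Set.Ioi (0 : ℝ), ((2 * Real.pi ^ 2 / (k + 1) : ℝ) : ℂ) *
        ((((ρ ^ 2)⁻¹ : ℝ) : ℂ) * F ρ) := by
  have hc := continuous_radialProfile k
  have hm : Measurable (Function.uncurry fun r ρ =>
      F ρ * ((‖radialProfile k (ρ * r)‖ ^ 2 : ℝ) : ℂ)) := by
    unfold Function.uncurry
    fun_prop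
  rw [integral_integral_swap]
  · refine setIntegral_congr_fun measurableSet_Ioi fun ρ hρ => ?_
    have hρ' : (0 : ℝ) < ρ := hρ
    have h2 : (ρ : ℂ) ≠ 0 := by exact_mod_cast hρ'.ne'
    simp only [integral_const_mul, integral_complex_ofReal, integral_norm_sq_radialProfile hk hρ']
    push_cast
    field_simp
  · rw [integrable_prod_iff' hm.aestronglyMeasurable]
    constructor
    · filter_upwards [ae_restrict_mem measurableSet_Ioi] with ρ hρ
      have h := (integrable_norm_sq_radialProfile k hρ).ofReal (𝕜 := ℂ)
      simp only [Function.uncurry_apply_pair]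
      exact Integrable.const_mul h (F ρ)
    · refine Integrable.congr (hF.norm.mul_const (2 * Real.pi ^ 2 / (k + 1))) ?_
      filter_upwards [ae_restrict_mem measurableSet_Ioi] with ρ hρ
      have hρ' : (0 : ℝ) < ρ := hρ
      simp only [Function.uncurry, norm_mul, Complex.norm_real, norm_pow, norm_norm, norm_inv]
      rw [integral_const_mul, integral_norm_sq_radialProfile hk hρ',
        Real.norm_of_nonneg hρ'.le]
      field_simp

/-- Plancherel in t at fixed r, then Fubini and scaling in r. The constant is 2π · 1/(4π²) ·
2π²/(k+1), and ρ⁵ · ρ⁻² is the ρ³ of polar coordinates in ℝ⁴. -/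
theorem integral_conj_modeSignal_mul (s s' : Bool) {k : ℕ} (hk : HasHarmonic k) {b b' : ℝ → ℂ}
    (hb : IsProfile b) (hb' : IsProfile b') :
    ∫ q, (starRingEnd ℂ) (modeSignal D s k b q) * modeSignal D s' k b' q
        ∂(volume.prod (radialMeasure 1)) =
      if s = s' then (Real.pi / (k + 1) : ℝ) * ∫ ρ in Set.Ioi (0 : ℝ),
        ((ρ ^ 3 : ℝ) : ℂ) * ((starRingEnd ℂ) (b ρ) * b' ρ) else 0 := by
  have hInt : Integrable (fun q => (starRingEnd ℂ) (modeSignal D s k b q) *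
      modeSignal D s' k b' q) (volume.prod (radialMeasure 1)) :=
    (memLp_modeSignal (D := D) s k hb).star.integrable_mul (memLp_modeSignal (D := D) s' k hb')
  rw [integral_prod_symm _ hInt]
  have e1 : ∀ r, ∫ t, (starRingEnd ℂ) (modeSignal D s k b (t, r)) * modeSignal D s' k b' (t, r) =
      if s = s' then 2 * Real.pi * ∫ ρ in Set.Ioi (0 : ℝ),
        ((ρ ^ 5 / (4 * Real.pi ^ 2) : ℝ) : ℂ) * ((starRingEnd ℂ) (b ρ) * b' ρ) *
        ((‖radialProfile k (ρ * r)‖ ^ 2 : ℝ) : ℂ) else 0 := by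
    intro r
    refine (integral_conj_timeSignal_mul_timeSignal s s'
      (isProfile_modeDensity k hb r).integrableOn (integrableOn_sq_modeDensity k hb r)
      (isProfile_modeDensity k hb' r).integrableOn (integrableOn_sq_modeDensity k hb' r)).trans ?_
    split_ifs with hs
    · congr 1
      exact setIntegral_congr_fun measurableSet_Ioi fun ρ hρ => conj_modeDensity_mul k b b' r hρ
    · rfl
  simp_rw [e1]
  split_ifs with hs
  · have hbb := hb.conj_mul hb'
    have hF := (hbb.mul (a := fun ρ => ((ρ ^ 3 / (4 * Real.pi ^ 2) : ℝ) : ℂ))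
      (by fun_prop) (by fun_prop)).integrableOn
    have hm := hbb.1
    rw [integral_const_mul, integral_radialProfile_swap hk (F := fun ρ =>
      ((ρ ^ 5 / (4 * Real.pi ^ 2) : ℝ) : ℂ) * ((starRingEnd ℂ) (b ρ) * b' ρ))
      (Measurable.mul (by fun_prop) hm), ← integral_const_mul, ← integral_const_mul]
    · refine setIntegral_congr_fun measurableSet_Ioi fun ρ hρ => ?_
      have h1 : (Real.pi : ℂ) ≠ 0 := by exact_mod_cast Real.pi_ne_zero
      have h2 : (ρ : ℂ) ≠ 0 := by exact_mod_cast (ne_of_gt hρ)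
      have h3 : (k + 1 : ℂ) ≠ 0 := by exact_mod_cast Nat.succ_ne_zero k
      push_cast
      field_simp
      ring
    · refine hF.congr_fun (fun ρ hρ => ?_) measurableSet_Ioi
      have h1 : (Real.pi : ℂ) ≠ 0 := by exact_mod_cast Real.pi_ne_zero
      have h2 : (ρ : ℂ) ≠ 0 := by exact_mod_cast (ne_of_gt hρ)
      push_cast
      field_simp
  · simp

end Signals


/-! ### Modes in `ℝ⁴` -/

section Modes

/-- The function `b(|ξ|) p(ξ/|ξ|)`, for `p` homogeneous of degree `k`. -/
def modeFun (k : ℕ) (p : MvPolynomial (Fin 4) ℝ) (b : ℝ → ℂ) (ξ : Eucl 4) : ℂ :=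
  b ‖ξ‖ * ((polyVal p ξ * (‖ξ‖ ^ k)⁻¹ : ℝ) : ℂ)

theorem modeFun_smul {k : ℕ} {p : MvPolynomial (Fin 4) ℝ} (hp : p.IsHomogeneous k) (b : ℝ → ℂ)
    {r : ℝ} (hr : 0 < r) (ω : S3) :
    modeFun k p b (r • (ω : Eucl 4)) = b r * ((polyVal p ω : ℝ) : ℂ) := by
  rw [modeFun, norm_smul_sphere hr, polyVal_smul hp]
  congr 2
  field_simp

theorem measurable_modeFun (k : ℕ) (p : MvPolynomial (Fin 4) ℝ) {b : ℝ → ℂ} (hb : Measurable b) :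
    Measurable (modeFun k p b) := by
  have := (continuous_polyVal p).measurable
  unfold modeFun
  fun_prop

theorem memLp_modeFun {k : ℕ} {p : MvPolynomial (Fin 4) ℝ} (hp : p.IsHomogeneous k) {b : ℝ → ℂ}
    (hb : IsProfile b) (q : ℝ≥0∞) : MemLp (modeFun k p b) q volume := by
  obtain ⟨hm, ε, R, C, hε, hC, hs⟩ := hb
  obtain ⟨C', hC'0, hC'⟩ := exists_polyVal_le hp
  have h0 : 0 ≤ C := (norm_nonneg _).trans (hC 0)
  have hind : modeFun k p b = (Metric.closedBall 0 R).indicator (modeFun k p b) := by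
    funext ξ
    by_cases hξ : ξ ∈ Metric.closedBall (0 : Eucl 4) R
    · rw [Set.indicator_of_mem hξ]
    · rw [Set.indicator_of_notMem hξ, modeFun, hs, zero_mul]
      intro hmem
      exact hξ (by simpa using hmem.2)
  rw [hind, memLp_indicator_iff_restrict measurableSet_closedBall]
  have : IsFiniteMeasure ((volume : Measure (Eucl 4)).restrict (Metric.closedBall 0 R)) :=
    ⟨by simpa using measure_closedBall_lt_top⟩
  refine MemLp.of_bound (measurable_modeFun k p hm).aestronglyMeasurable (C * C')
    (ae_of_all _ fun ξ => ?_)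
  rw [modeFun, norm_mul, Complex.norm_real, Real.norm_eq_abs, abs_mul, abs_of_nonneg
    (by positivity : (0 : ℝ) ≤ (‖ξ‖ ^ k)⁻¹)]
  refine mul_le_mul (hC _) ?_ (by positivity) h0
  calc |polyVal p ξ| * (‖ξ‖ ^ k)⁻¹ ≤ C' * ‖ξ‖ ^ k * (‖ξ‖ ^ k)⁻¹ := by
        gcongr
        exact hC' ξ
    _ ≤ C' := by
        rw [mul_assoc]
        exact mul_le_of_le_one_right hC'0 (mul_inv_le_one)

theorem integral_conj_modeFun_mul {k l : ℕ} {p q : MvPolynomial (Fin 4) ℝ}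
    (hp : p.IsHomogeneous k) (hq : q.IsHomogeneous l) {b b' : ℝ → ℂ} (hb : IsProfile b)
    (hb' : IsProfile b') :
    ∫ ξ, (starRingEnd ℂ) (modeFun k p b ξ) * modeFun l q b' ξ =
      (∫ ρ in Set.Ioi (0 : ℝ), ((ρ ^ 3 : ℝ) : ℂ) * ((starRingEnd ℂ) (b ρ) * b' ρ)) *
        sphereInner p q := by
  have hInt : Integrable (fun ξ => (starRingEnd ℂ) (modeFun k p b ξ) * modeFun l q b' ξ) :=
    (memLp_modeFun hp hb 2).star.integrable_mul (memLp_modeFun hq hb' 2)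
  rw [integral_polar hInt, integral_radialMeasure, ← integral_mul_const]
  refine setIntegral_congr_fun measurableSet_Ioi fun ρ hρ => ?_
  simp only [modeFun_smul hp b hρ, modeFun_smul hq b' hρ, map_mul, Complex.conj_ofReal]
  have h : ∫ ω : S3, (starRingEnd ℂ) (b ρ) * ((polyVal p ω : ℝ) : ℂ) *
      (b' ρ * ((polyVal q ω : ℝ) : ℂ)) ∂(sphereMeasure 4) =
      ((starRingEnd ℂ) (b ρ) * b' ρ) * sphereInner p q := by
    rw [sphereInner, ← integral_const_mul]
    refine integral_congr_ae (ae_of_all _ fun ω => ?_)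
    simp only
    ring
  rw [h]
  ring

variable (D : Dispersion)

/-- The profile of a mode at time `t`. -/
def waveProfile (s : Bool) (b : ℝ → ℂ) (t ρ : ℝ) : ℂ :=
  ((D.amp ρ : ℝ) : ℂ) * Complex.exp (-(Complex.I * (sgn s * t * D.φ ρ))) * b ρ

variable {D}

theorem isProfile_waveProfile (s : Bool) {b : ℝ → ℂ} (hb : IsProfile b) (t : ℝ) :
    IsProfile (waveProfile D s b t) := by
  have h1 := D.measurable_amp
  have h2 := D.continuousOn_amp
  have h3 := D.continuous_φ
  exact hb.mul (a := fun ρ => ((D.amp ρ : ℝ) : ℂ) *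
    Complex.exp (-(Complex.I * (sgn s * t * D.φ ρ)))) (by fun_prop) (by fun_prop)

variable (D) in
/-- The half-wave with the given mode as initial datum. -/
def modeWave (s : Bool) (k : ℕ) (p : MvPolynomial (Fin 4) ℝ) (b : ℝ → ℂ) (t : ℝ) (x : Eucl 4) : ℂ :=
  𝓕⁻ (modeFun k p (waveProfile D s b t)) x

theorem stronglyMeasurable_modeWave (s : Bool) (k : ℕ) (p : MvPolynomial (Fin 4) ℝ) {b : ℝ → ℂ}
    (hb : IsProfile b) : StronglyMeasurable (Function.uncurry (modeWave D s k p b)) := by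
  have h1 := D.measurable_amp
  have h2 := D.continuous_φ
  have h3 := (continuous_polyVal p).measurable
  have h4 := hb.1
  have hm : StronglyMeasurable (fun z : (ℝ × Eucl 4) × Eucl 4 =>
      Complex.exp ((2 * Real.pi * inner ℝ z.2 z.1.2 : ℝ) * Complex.I) •
        modeFun k p (waveProfile D s b z.1.1) z.2) := by
    refine Measurable.stronglyMeasurable ?_
    unfold modeFun waveProfile
    fun_prop
  have := hm.integral_prod_right' (ν := volume)
  convert this using 1
  funext z
  rw [Function.uncurry, modeWave, Real.fourierInv_eq']

/-- The inverse Fourier integral in polar coordinates, with the angular integral evaluated by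
Funk–Hecke: the dependence on ω separates as p(ω). -/
theorem modeWave_smul (s : Bool) {k : ℕ} {p : MvPolynomial (Fin 4) ℝ} (hp : IsSolidHarmonic k p)
    {b : ℝ → ℂ} (hb : IsProfile b) (t : ℝ) {r : ℝ} (hr : 0 < r) (ω : S3) :
    modeWave D s k p b t (r • (ω : Eucl 4)) =
      modeSignal D s k b (t, r) * ((polyVal p ω : ℝ) : ℂ) := by
  have hInt : Integrable (fun ξ => Complex.exp ((2 * Real.pi * inner ℝ ξ (r • (ω : Eucl 4)) : ℝ) *
      Complex.I) • modeFun k p (waveProfile D s b t) ξ) := by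
    refine Integrable.bdd_mul (c := 1) (memLp_one_iff_integrable.1
      (memLp_modeFun hp.1 (isProfile_waveProfile s hb t) 1))
      (Continuous.aestronglyMeasurable (by fun_prop)) (ae_of_all _ fun ξ => ?_)
    rw [Complex.norm_exp_ofReal_mul_I]
  rw [modeWave, Real.fourierInv_eq', integral_polar hInt, integral_radialMeasure, modeSignal,
    timeSignal, ← integral_mul_const]
  refine setIntegral_congr_fun measurableSet_Ioi fun ρ hρ => ?_
  have h1 := sphereFourier_smul hp (mul_pos hρ hr) ω
  have h2 : ∫ θ : S3, Complex.exp ((2 * Real.pi * inner ℝ (ρ • (θ : Eucl 4)) (r • (ω : Eucl 4)) : ℝ) *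
      Complex.I) • modeFun k p (waveProfile D s b t) (ρ • (θ : Eucl 4)) ∂(sphereMeasure 4) =
      waveProfile D s b t ρ * sphereFourier p ((ρ * r) • (ω : Eucl 4)) := by
    rw [sphereFourier, ← integral_const_mul]
    refine integral_congr_ae (ae_of_all _ fun θ => ?_)
    have h3 : ((2 * Real.pi * inner ℝ (ρ • (θ : Eucl 4)) (r • (ω : Eucl 4)) : ℝ) : ℂ) *
        Complex.I = 2 * Real.pi * Complex.I *
          (inner ℝ ((ρ * r) • (ω : Eucl 4)) (θ : Eucl 4) : ℝ) := by
      rw [inner_smul_left, inner_smul_right, inner_smul_left, real_inner_comm]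
      push_cast
      simp
      ring
    simp only [modeFun_smul hp.1 _ hρ, h3, smul_eq_mul]
    ring
  rw [h2, h1, modeDensity, waveProfile]
  push_cast
  ring

/-- Polar coordinates in space-time. -/
def spaceTimePolar (z : (ℝ × ℝ) × S3) : ℝ × Eucl 4 := (z.1.1, z.1.2 • (z.2 : Eucl 4))

/-- The measure `dt dx / |x|²`. -/
def spaceTimeMeasure : Measure (ℝ × Eucl 4) := (volume : Measure ℝ).prod weightMeasure

theorem measurePreserving_spaceTimePolar :
    MeasurePreserving spaceTimePolar
      (((volume : Measure ℝ).prod (radialMeasure 1)).prod (sphereMeasure 4)) spaceTimeMeasure :=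
  ((MeasurePreserving.id volume).prod measurePreserving_polarMap_weight).comp
    (measurePreserving_prodAssoc volume (radialMeasure 1) (sphereMeasure 4))

theorem ae_pos_spaceTimePolar :
    ∀ᵐ z : (ℝ × ℝ) × S3 ∂(((volume : Measure ℝ).prod (radialMeasure 1)).prod (sphereMeasure 4)),
      0 < z.1.2 :=
  (Measure.quasiMeasurePreserving_fst.comp Measure.quasiMeasurePreserving_fst |>.ae
    (p := fun _ => True) (by simp)).and
    ((Measure.quasiMeasurePreserving_snd.comp Measure.quasiMeasurePreserving_fst).ae
      (ae_radialMeasure_pos 1)) |>.mono fun z hz => hz.2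

theorem memLp_modeWave (s : Bool) {k : ℕ} {p : MvPolynomial (Fin 4) ℝ} (hp : IsSolidHarmonic k p)
    {b : ℝ → ℂ} (hb : IsProfile b) :
    MemLp (Function.uncurry (modeWave D s k p b)) 2 spaceTimeMeasure := by
  have hmeas := measurePreserving_spaceTimePolar
  rw [← hmeas.map_eq, memLp_map_measure_iff
    (stronglyMeasurable_modeWave s k p hb).aestronglyMeasurable hmeas.measurable.aemeasurable]
  obtain ⟨C, hC⟩ := exists_bound_polyVal_sphere p
  have h1 := (memLp_modeSignal (D := D) s k hb).comp_fst (sphereMeasure 4)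
  have h2 : MemLp (fun z : (ℝ × ℝ) × S3 => ((polyVal p z.2 : ℝ) : ℂ) * modeSignal D s k b z.1) 2
      (((volume : Measure ℝ).prod (radialMeasure 1)).prod (sphereMeasure 4)) := by
    have := continuous_polyVal p
    refine MemLp.of_le_mul (c := C) h1 (AEStronglyMeasurable.mul
      (Continuous.aestronglyMeasurable (by fun_prop)) h1.1) (ae_of_all _ fun z => ?_)
    rw [norm_mul, Complex.norm_real]
    gcongr
    exact (Complex.norm_real _).symm.trans_le (hC z.2)
  refine (memLp_congr_ae ?_).1 h2
  filter_upwards [ae_pos_spaceTimePolar] with z hz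
  rw [Function.comp, spaceTimePolar, Function.uncurry_apply_pair, modeWave_smul s hp hb _ hz,
    mul_comm]

/-- Both sides contain the factor `sphereInner p q`. If it is nonzero then k = l by orthogonality,
and the weights cancel the 1/(k+1) of the radial computation. -/
theorem integral_conj_modeWave_mul (s s' : Bool) {k l : ℕ} {p q : MvPolynomial (Fin 4) ℝ}
    (hp : IsSolidHarmonic k p) (hq : IsSolidHarmonic l q) {b b' : ℝ → ℂ} (hb : IsProfile b)
    (hb' : IsProfile b') :
    Real.sqrt (k + 1) * Real.sqrt (l + 1) *
      ∫ z, (starRingEnd ℂ) (Function.uncurry (modeWave D s k p b) z) *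
        Function.uncurry (modeWave D s' l q b') z ∂spaceTimeMeasure =
      if s = s' then Real.pi * ∫ ξ, (starRingEnd ℂ) (modeFun k p b ξ) * modeFun l q b' ξ else 0 := by
  have hmeas := measurePreserving_spaceTimePolar
  have e1 : ∫ z, (starRingEnd ℂ) (Function.uncurry (modeWave D s k p b) z) *
        Function.uncurry (modeWave D s' l q b') z ∂spaceTimeMeasure =
      (∫ q, (starRingEnd ℂ) (modeSignal D s k b q) * modeSignal D s' l b' q
        ∂((volume : Measure ℝ).prod (radialMeasure 1))) * sphereInner p q := by
    rw [sphereInner, ← integral_prod_mul, ← hmeas.map_eq, integral_map hmeas.measurable.aemeasurable]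
    · refine integral_congr_ae ?_
      filter_upwards [ae_pos_spaceTimePolar] with z hz
      rw [spaceTimePolar, Function.uncurry_apply_pair, Function.uncurry_apply_pair,
        modeWave_smul s hp hb _ hz, modeWave_smul s' hq hb' _ hz, map_mul, Complex.conj_ofReal]
      ring
    · exact (Complex.continuous_conj.comp_stronglyMeasurable
        (stronglyMeasurable_modeWave s k p hb)).aestronglyMeasurable.mul
        (stronglyMeasurable_modeWave s' l q hb').aestronglyMeasurable
  rw [e1, integral_conj_modeFun_mul hp.1 hq.1 hb hb']
  by_cases h0 : sphereInner p q = 0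
  · simp [h0]
  have hkl : k = l := by
    by_contra hne
    exact h0 (sphereInner_eq_zero hp hq hne)
  subst hkl
  have hk : HasHarmonic k := by
    by_contra hcon
    refine h0 ?_
    have : ∀ ω : S3, polyVal p ω = 0 := fun ω => by
      by_contra hne
      exact hcon ⟨p, ω, hp, hne⟩
    simp [sphereInner, this]
  rw [integral_conj_modeSignal_mul s s' hk hb hb']
  split_ifs with hs
  · have h3 : (k + 1 : ℂ) ≠ 0 := by exact_mod_cast Nat.succ_ne_zero k
    have h4 : ((Real.sqrt (k + 1) : ℝ) : ℂ) * ((Real.sqrt (k + 1) : ℝ) : ℂ) = k + 1 := by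
      rw [← Complex.ofReal_mul, Real.mul_self_sqrt (by positivity)]
      push_cast; rfl
    rw [h4]
    push_cast
    field_simp
  · simp

end Modes


/-! ### Linear combinations in Hilbert spaces -/

section Hilbert

variable {ι H K : Type*} [NormedAddCommGroup H] [InnerProductSpace ℂ H] [NormedAddCommGroup K]
  [InnerProductSpace ℂ K]

/-- Families with proportional Gram matrices have linear combinations with proportional norms. -/
theorem norm_sq_linearCombination_of_inner {x : ι → H} {y : ι → K} {C : ℝ}
    (h : ∀ i j, inner ℂ (x i) (x j) = (C : ℂ) * inner ℂ (y i) (y j)) (c : ι →₀ ℂ) :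
    ‖Finsupp.linearCombination ℂ x c‖ ^ 2 = C * ‖Finsupp.linearCombination ℂ y c‖ ^ 2 := by
  have key : inner ℂ (Finsupp.linearCombination ℂ x c) (Finsupp.linearCombination ℂ x c) =
      (C : ℂ) * inner ℂ (Finsupp.linearCombination ℂ y c) (Finsupp.linearCombination ℂ y c) := by
    simp only [Finsupp.linearCombination_apply, Finsupp.sum, sum_inner, inner_sum, inner_smul_left,
      inner_smul_right, h, Finset.mul_sum]
    refine Finset.sum_congr rfl fun i _ => Finset.sum_congr rfl fun j _ => ?_
    ring
  rw [inner_self_eq_norm_sq_to_K, inner_self_eq_norm_sq_to_K] at key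
  refine Complex.ofReal_injective ?_
  push_cast
  simpa using key

theorem norm_sum_sq_of_pairwise_orthogonal (s : Finset ℕ) {y : ℕ → H}
    (h : ∀ i j, i ≠ j → inner ℂ (y i) (y j) = 0) : ‖∑ i ∈ s, y i‖ ^ 2 = ∑ i ∈ s, ‖y i‖ ^ 2 := by
  have key : inner ℂ (∑ i ∈ s, y i) (∑ i ∈ s, y i) = ∑ i ∈ s, inner ℂ (y i) (y i) := by
    rw [sum_inner]
    refine Finset.sum_congr rfl fun i hi => ?_
    rw [inner_sum]
    exact Finset.sum_eq_single i (fun j _ hj => h i j hj.symm) (fun hn => absurd hi hn)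
  simp only [inner_self_eq_norm_sq_to_K] at key
  exact_mod_cast key

/-- Inserting weights `≥ 1` that depend only on the class of a vector does not decrease the norm of
a linear combination, if different classes are orthogonal. -/
theorem norm_linearCombination_le_of_weight {x : ι → H} {deg : ι → ℕ} {w : ℕ → ℝ}
    (hx : ∀ i j, deg i ≠ deg j → inner ℂ (x i) (x j) = 0) (hw : ∀ k, 1 ≤ w k) (c : ι →₀ ℂ) :
    ‖Finsupp.linearCombination ℂ x c‖ ≤
      ‖Finsupp.linearCombination ℂ (fun i => ((w (deg i) : ℝ) : ℂ) • x i) c‖ := by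
  classical
  -- Terms are grouped by class. The groups are orthogonal, so Pythagoras reduces the claim to one
  -- group, where the weight is constant.
  set y : ℕ → H := fun k => ∑ i ∈ c.support with deg i = k, c i • x i with hy
  have hyo : ∀ k l, k ≠ l → inner ℂ (y k) (y l) = 0 := by
    intro k l hkl
    simp only [hy, sum_inner, inner_sum]
    refine Finset.sum_eq_zero fun j hj => Finset.sum_eq_zero fun i hi => ?_
    rw [Finset.mem_filter] at hi hj
    rw [inner_smul_left, inner_smul_right]
    rw [hx i j (by rw [hi.2, hj.2]; exact hkl)]
    simp
  have hmap : ∀ i ∈ c.support, deg i ∈ c.support.image deg := fun i hi =>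
    Finset.mem_image_of_mem _ hi
  have e1 : Finsupp.linearCombination ℂ x c = ∑ k ∈ c.support.image deg, y k := by
    rw [Finsupp.linearCombination_apply, Finsupp.sum, hy, Finset.sum_fiberwise_of_maps_to hmap]
  have e2 : Finsupp.linearCombination ℂ (fun i => ((w (deg i) : ℝ) : ℂ) • x i) c =
      ∑ k ∈ c.support.image deg, ((w k : ℝ) : ℂ) • y k := by
    rw [Finsupp.linearCombination_apply, Finsupp.sum, ← Finset.sum_fiberwise_of_maps_to hmap]
    refine Finset.sum_congr rfl fun k _ => ?_
    rw [hy, Finset.smul_sum]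
    refine Finset.sum_congr rfl fun i hi => ?_
    rw [(Finset.mem_filter.1 hi).2, smul_comm]
  rw [← abs_of_nonneg (norm_nonneg (Finsupp.linearCombination ℂ x c)),
    ← abs_of_nonneg (norm_nonneg (Finsupp.linearCombination ℂ (fun i => ((w (deg i) : ℝ) : ℂ) • x i) c)),
    ← sq_le_sq, e1, e2, norm_sum_sq_of_pairwise_orthogonal _ hyo,
    norm_sum_sq_of_pairwise_orthogonal _ (fun k l hkl => by
      rw [inner_smul_left, inner_smul_right, hyo k l hkl]; simp)]
  refine Finset.sum_le_sum fun k _ => ?_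
  rw [norm_smul, Complex.norm_real, mul_pow]
  have : 1 ≤ ‖w k‖ := (hw k).trans (le_abs_self _)
  nlinarith [sq_nonneg ‖y k‖, one_le_pow₀ this (n := 2)]

/-- Extension by continuity along one sequence: L is bounded relative to F, so it sends F-Cauchy
sequences to Cauchy sequences, and no map on the completion has to be defined. -/
theorem exists_tendsto_of_norm_le [CompleteSpace K] {V : Type*} [AddCommGroup V] [Module ℂ V]
    (F : V →ₗ[ℂ] H) (L : V →ₗ[ℂ] K) {C : ℝ} (h : ∀ c, ‖L c‖ ≤ C * ‖F c‖) {c : ℕ → V} {f : H}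
    (hc : Tendsto (fun n => F (c n)) atTop (𝓝 f)) : ∃ l, Tendsto (fun n => L (c n)) atTop (𝓝 l) := by
  refine cauchySeq_tendsto_of_complete ?_
  have h1 := hc.cauchySeq
  have hC : ∀ c, ‖L c‖ ≤ (|C| + 1) * ‖F c‖ := fun c => (h c).trans
    (mul_le_mul_of_nonneg_right ((le_abs_self C).trans (by linarith)) (norm_nonneg _))
  rw [Metric.cauchySeq_iff] at h1 ⊢
  intro ε hε
  have hC1 : 0 < |C| + 1 := by positivity
  obtain ⟨N, hN⟩ := h1 (ε / (|C| + 1)) (by positivity)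
  refine ⟨N, fun m hm n hn => ?_⟩
  have h2 := hN m hm n hn
  rw [dist_eq_norm, ← map_sub] at h2 ⊢
  calc ‖L (c m - c n)‖ ≤ (|C| + 1) * ‖F (c m - c n)‖ := hC _
    _ < (|C| + 1) * (ε / (|C| + 1)) := by gcongr
    _ = ε := by field_simp

end Hilbert

/-- A sequence that tends to zero in `L¹` has a subsequence that tends to zero almost everywhere. -/
theorem exists_seq_ae_tendsto_zero {X : Type*} [MeasurableSpace X] {μ : Measure X}
    {h : ℕ → X → ℝ≥0∞} (hm : ∀ n, AEMeasurable (h n) μ)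
    (hlim : Tendsto (fun n => ∫⁻ x, h n x ∂μ) atTop (𝓝 0)) :
    ∃ ns : ℕ → ℕ, StrictMono ns ∧ ∀ᵐ x ∂μ, Tendsto (fun k => h (ns k) x) atTop (𝓝 0) := by
  obtain ⟨ns, hns, hle⟩ := extraction_forall_of_eventually (P := fun k n =>
    ∫⁻ x, h n x ∂μ ≤ (2⁻¹ : ℝ≥0∞) ^ k) (fun k => (hlim.eventually_le_const (by
      exact ENNReal.pow_pos (by simp) k)))
  refine ⟨ns, hns, ?_⟩
  have hsum : ∫⁻ x, ∑' k, h (ns k) x ∂μ ≠ ∞ := by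
    rw [lintegral_tsum fun k => hm (ns k)]
    refine ne_top_of_le_ne_top ?_ (ENNReal.tsum_le_tsum hle)
    rw [ENNReal.tsum_geometric]
    simp
  filter_upwards [ae_lt_top' (AEMeasurable.tsum fun k => hm (ns k)) hsum] with x hx
  exact ENNReal.tendsto_atTop_zero_of_tsum_ne_top hx.ne


/-! ### Finite superpositions of modes -/

/-- A mode `b(|ξ|) p(ξ/|ξ|)` of one of the two half-waves. -/
structure Mode where
  /-- The direction of propagation. -/
  s : Bool
  /-- The degree of the spherical harmonic. -/
  k : ℕ
  /-- The spherical harmonic. -/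
  p : MvPolynomial (Fin 4) ℝ
  /-- The radial profile. -/
  b : ℝ → ℂ
  harmonic : IsSolidHarmonic k p
  profile : IsProfile b

/-- Pairs of initial data. -/
abbrev DataSpace : Type := PiLp 2 fun _ : Bool => L2 4

/-- Space-time functions with finite weighted integral. -/
abbrev WaveSpace : Type := Lp ℂ 2 spaceTimeMeasure

/-- A bounded radial multiplier. -/
structure Multiplier where
  /-- The symbol. -/
  a : ℝ → ℝ
  measurable : Measurable a
  continuousOn : ContinuousOn a (Set.Ioi 0)
  abs_le_one : ∀ ρ, |a ρ| ≤ 1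

namespace Mode

/-- The `L²` function of a mode. -/
def toL2 (i : Mode) : L2 4 := (memLp_modeFun i.harmonic.1 i.profile 2).toLp _

/-- The initial datum of a mode. -/
def data (i : Mode) : DataSpace := WithLp.toLp 2 fun s => if s = i.s then i.toL2 else 0

/-- Multiplication of the radial profile of a mode by a multiplier. -/
def scale (m : Multiplier) (i : Mode) : Mode where
  s := i.s
  k := i.k
  p := i.p
  b := fun ρ => ((m.a ρ : ℝ) : ℂ) * i.b ρ
  harmonic := i.harmonic
  profile := i.profile.mul (Complex.measurable_ofReal.comp m.measurable)
    (Complex.continuous_ofReal.comp_continuousOn m.continuousOn)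

variable (D : Dispersion)

/-- The half-wave of a mode. -/
def wave (i : Mode) : ℝ → Eucl 4 → ℂ := modeWave D i.s i.k i.p i.b

theorem memLp_wave (i : Mode) : MemLp (Function.uncurry (i.wave D)) 2 spaceTimeMeasure :=
  memLp_modeWave i.s i.harmonic i.profile

/-- The half-wave of a mode as an element of `L²(dt dx/|x|²)`. -/
def waveLp (i : Mode) : WaveSpace := (i.memLp_wave D).toLp _

theorem coeFn_toL2 (i : Mode) : i.toL2 =ᵐ[volume] modeFun i.k i.p i.b := MemLp.coeFn_toLp _

theorem inner_data (i j : Mode) : inner ℂ i.data j.data = if i.s = j.s then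
    ∫ ξ, (starRingEnd ℂ) (modeFun i.k i.p i.b ξ) * modeFun j.k j.p j.b ξ else 0 := by
  have h : inner ℂ i.toL2 j.toL2 =
      ∫ ξ, (starRingEnd ℂ) (modeFun i.k i.p i.b ξ) * modeFun j.k j.p j.b ξ := by
    rw [L2.inner_def]
    refine integral_congr_ae ?_
    filter_upwards [i.coeFn_toL2, j.coeFn_toL2] with ξ h1 h2
    rw [h1, h2, RCLike.inner_apply, mul_comm]
  rw [PiLp.inner_apply]
  cases hi : i.s <;> cases hj : j.s <;> simp [data, hi, hj, h]

theorem inner_waveLp (i j : Mode) : inner ℂ (i.waveLp D) (j.waveLp D) =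
    ∫ z, (starRingEnd ℂ) (Function.uncurry (modeWave D i.s i.k i.p i.b) z) *
        Function.uncurry (modeWave D j.s j.k j.p j.b) z ∂spaceTimeMeasure := by
  rw [L2.inner_def]
  refine integral_congr_ae ?_
  filter_upwards [(i.memLp_wave D).coeFn_toLp, (j.memLp_wave D).coeFn_toLp] with ξ h1 h2
  rw [waveLp, waveLp, h1, h2, RCLike.inner_apply, mul_comm]
  rfl

/-- The smoothing identity for single modes, in polarised form so that it extends to sums. -/
theorem inner_weighted_waveLp (i j : Mode) :
    inner ℂ (((Real.sqrt (i.k + 1) : ℝ) : ℂ) • i.waveLp D)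
      (((Real.sqrt (j.k + 1) : ℝ) : ℂ) • j.waveLp D) =
      ((Real.pi : ℝ) : ℂ) * inner ℂ i.data j.data := by
  rw [inner_smul_left, inner_smul_right, inner_waveLp, Complex.conj_ofReal, ← mul_assoc,
    integral_conj_modeWave_mul i.s j.s i.harmonic j.harmonic i.profile j.profile, inner_data]
  split_ifs <;> simp

theorem inner_waveLp_eq_zero (i j : Mode) (h : i.k ≠ j.k) :
    inner ℂ (i.waveLp D) (j.waveLp D) = 0 := by
  have h1 := inner_weighted_waveLp D i j
  have h2 : inner ℂ i.data j.data = 0 := by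
    rw [inner_data, integral_conj_modeFun_mul i.harmonic.1 j.harmonic.1 i.profile j.profile,
      sphereInner_eq_zero i.harmonic j.harmonic h]
    simp
  rw [inner_smul_left, inner_smul_right, h2, mul_zero] at h1
  have h3 : ∀ k : ℕ, ((Real.sqrt (k + 1) : ℝ) : ℂ) ≠ 0 := fun k => by
    have : Real.sqrt ((k : ℝ) + 1) ≠ 0 := (Real.sqrt_pos.2 (by positivity)).ne'
    exact_mod_cast this
  rw [Complex.conj_ofReal] at h1
  rcases mul_eq_zero.1 h1 with h4 | h4
  · exact absurd h4 (h3 _)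
  · exact (mul_eq_zero.1 h4).resolve_left (h3 _)

theorem scale_toL2 (m : Multiplier) (i : Mode) :
    (i.scale m).toL2 =ᵐ[volume] fun ξ => ((m.a ‖ξ‖ : ℝ) : ℂ) * i.toL2 ξ := by
  filter_upwards [(i.scale m).coeFn_toL2, i.coeFn_toL2] with ξ h1 h2
  rw [h1, h2]
  simp only [modeFun, scale]
  ring

end Mode

/-! ### The linear maps -/

/-- Formal superpositions of modes. -/
abbrev Modes : Type := Mode →₀ ℂ

/-- The initial datum of a superposition. -/
def dataMap : Modes →ₗ[ℂ] DataSpace := Finsupp.linearCombination ℂ Mode.data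

/-- Multiplication of every mode by a multiplier. -/
def scaleMap (m : Multiplier) : Modes →ₗ[ℂ] Modes :=
  Finsupp.linearCombination ℂ fun i => Finsupp.single (i.scale m) 1

/-- The operator `(1 - Λ)^{1/4}` on superpositions of modes. -/
def angularMap : Modes →ₗ[ℂ] Modes :=
  Finsupp.linearCombination ℂ fun i => Finsupp.single i ((Real.sqrt (i.k + 1) : ℝ) : ℂ)

section Maps

variable (D : Dispersion)

/-- The space-time function of a superposition. -/
def waveMap : Modes →ₗ[ℂ] (ℝ → Eucl 4 → ℂ) := Finsupp.linearCombination ℂ fun i => i.wave D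

/-- The space-time function of a superposition, as an element of `L²(dt dx/|x|²)`. -/
def waveLpMap : Modes →ₗ[ℂ] WaveSpace := Finsupp.linearCombination ℂ fun i => i.waveLp D

theorem dataMap_single (i : Mode) (z : ℂ) : dataMap (Finsupp.single i z) = z • i.data :=
  Finsupp.linearCombination_single ..

theorem scaleMap_single (m : Multiplier) (i : Mode) (z : ℂ) :
    scaleMap m (Finsupp.single i z) = Finsupp.single (i.scale m) z := by
  rw [scaleMap, Finsupp.linearCombination_single, Finsupp.smul_single, smul_eq_mul, mul_one]

theorem angularMap_single (i : Mode) (z : ℂ) :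
    angularMap (Finsupp.single i z) = Finsupp.single i (z * ((Real.sqrt (i.k + 1) : ℝ) : ℂ)) := by
  rw [angularMap, Finsupp.linearCombination_single, Finsupp.smul_single, smul_eq_mul]

theorem waveMap_single (i : Mode) (z : ℂ) : waveMap D (Finsupp.single i z) = z • i.wave D :=
  Finsupp.linearCombination_single ..

theorem waveLpMap_single (i : Mode) (z : ℂ) : waveLpMap D (Finsupp.single i z) = z • i.waveLp D :=
  Finsupp.linearCombination_single ..

theorem angularMap_scaleMap (m : Multiplier) (c : Modes) :
    angularMap (scaleMap m c) = scaleMap m (angularMap c) := by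
  induction c using Finsupp.induction_linear with
  | zero => simp
  | add f g hf hg => simp only [map_add, hf, hg]
  | single i z => simp only [scaleMap_single, angularMap_single]; rfl

theorem waveLpMap_angularMap (c : Modes) : waveLpMap D (angularMap c) =
    Finsupp.linearCombination ℂ (fun i : Mode => ((Real.sqrt (i.k + 1) : ℝ) : ℂ) • i.waveLp D) c := by
  induction c using Finsupp.induction_linear with
  | zero => simp
  | add f g hf hg => simp only [map_add, hf, hg]
  | single i z =>
    rw [angularMap_single, waveLpMap_single, Finsupp.linearCombination_single, smul_smul]

theorem norm_sq_waveLpMap_angularMap (c : Modes) :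
    ‖waveLpMap D (angularMap c)‖ ^ 2 = Real.pi * ‖dataMap c‖ ^ 2 := by
  rw [waveLpMap_angularMap]
  exact norm_sq_linearCombination_of_inner (Mode.inner_weighted_waveLp D) c

theorem norm_waveLpMap_angularMap (c : Modes) :
    ‖waveLpMap D (angularMap c)‖ = Real.sqrt Real.pi * ‖dataMap c‖ := by
  rw [← Real.sqrt_sq (norm_nonneg (waveLpMap D (angularMap c))), norm_sq_waveLpMap_angularMap,
    Real.sqrt_mul Real.pi_pos.le, Real.sqrt_sq (norm_nonneg _)]

/-- Degrees are orthogonal and √(k+1) ≥ 1, so dropping the angular operator does not increase the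
norm. This makes the waves themselves converge along with their angular powers. -/
theorem norm_waveLpMap_le (c : Modes) : ‖waveLpMap D c‖ ≤ Real.sqrt Real.pi * ‖dataMap c‖ := by
  rw [← norm_waveLpMap_angularMap D, waveLpMap_angularMap]
  refine norm_linearCombination_le_of_weight (deg := Mode.k) (w := fun k => Real.sqrt (k + 1))
    (Mode.inner_waveLp_eq_zero D) (fun k => ?_) c
  rw [Real.one_le_sqrt]
  linarith [k.cast_nonneg (α := ℝ)]

theorem dataMap_scaleMap_apply (m : Multiplier) (c : Modes) (s : Bool) :
    dataMap (scaleMap m c) s =ᵐ[volume] fun ξ => ((m.a ‖ξ‖ : ℝ) : ℂ) * dataMap c s ξ := by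
  induction c using Finsupp.induction_linear with
  | zero =>
    rw [map_zero, map_zero]
    exact ae_of_all _ fun ξ => by simp
  | add f g hf hg =>
    simp only [map_add, PiLp.add_apply]
    filter_upwards [hf, hg, Lp.coeFn_add (dataMap (scaleMap m f) s) (dataMap (scaleMap m g) s),
      Lp.coeFn_add (dataMap f s) (dataMap g s)] with ξ h1 h2 h3 h4
    rw [h3, h4, Pi.add_apply, Pi.add_apply, h1, h2, mul_add]
  | single i z =>
    rw [scaleMap_single, dataMap_single, dataMap_single, PiLp.smul_apply, PiLp.smul_apply]
    simp only [Mode.data]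
    by_cases hs : s = i.s
    · rw [if_pos hs, if_pos (show s = (i.scale m).s from hs)]
      filter_upwards [Lp.coeFn_smul z (i.scale m).toL2, Lp.coeFn_smul z i.toL2, i.scale_toL2 m]
        with ξ h1 h2 h3
      rw [h1, h2, Pi.smul_apply, Pi.smul_apply, h3, smul_eq_mul, smul_eq_mul]
      ring
    · rw [if_neg hs, if_neg (show ¬ s = (i.scale m).s from hs), smul_zero]
      exact ae_of_all _ fun ξ => by simp

theorem norm_dataMap_scaleMap_le (m : Multiplier) (c : Modes) :
    ‖dataMap (scaleMap m c)‖ ≤ ‖dataMap c‖ := by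
  rw [← abs_of_nonneg (norm_nonneg (dataMap (scaleMap m c))),
    ← abs_of_nonneg (norm_nonneg (dataMap c)), ← sq_le_sq, PiLp.norm_sq_eq_of_L2,
    PiLp.norm_sq_eq_of_L2]
  refine Finset.sum_le_sum fun s _ => ?_
  gcongr
  refine Lp.norm_le_norm_of_ae_le ?_
  filter_upwards [dataMap_scaleMap_apply m c s] with ξ h
  rw [h, norm_mul, Complex.norm_real]
  exact mul_le_of_le_one_left (norm_nonneg _) (m.abs_le_one _)

theorem stronglyMeasurable_waveMap (c : Modes) :
    StronglyMeasurable (Function.uncurry (waveMap D c)) := by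
  induction c using Finsupp.induction_linear with
  | zero => rw [map_zero]; exact stronglyMeasurable_zero
  | add f g hf hg => rw [map_add]; exact hf.add hg
  | single i z =>
    rw [waveMap_single]
    exact (stronglyMeasurable_modeWave i.s i.k i.p i.profile).const_smul z

theorem coeFn_waveLpMap (c : Modes) :
    waveLpMap D c =ᵐ[spaceTimeMeasure] Function.uncurry (waveMap D c) := by
  induction c using Finsupp.induction_linear with
  | zero => rw [map_zero, map_zero]; exact Lp.coeFn_zero ..
  | add f g hf hg =>
    rw [map_add, map_add]
    exact (Lp.coeFn_add _ _).trans (hf.add hg)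
  | single i z =>
    rw [waveMap_single, waveLpMap_single]
    exact (Lp.coeFn_smul _ _).trans ((i.memLp_wave D).coeFn_toLp.const_smul z)

end Maps


/-! ### The angular operator on superpositions -/

/-- In dimension four 1 + k(k+2) is the perfect square (k+1)², so this weight is exactly the inverse
square root of the 1/(k+1) from the radial normalisation. -/
theorem one_add_sphereEigenvalue_rpow (k : ℕ) :
    (1 + sphereEigenvalue 4 k) ^ (1 / 4 : ℝ) = Real.sqrt (k + 1) := by
  have h : 1 + sphereEigenvalue 4 k = ((k : ℝ) + 1) ^ (2 : ℝ) := by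
    rw [sphereEigenvalue, Real.rpow_two]
    push_cast
    ring
  rw [h, ← Real.rpow_mul (by positivity), Real.sqrt_eq_rpow]
  norm_num

theorem sphereMoment_add_left {d : ℕ} {f g : Metric.sphere (0 : Eucl d) 1 → ℂ}
    (hf : Integrable f (sphereMeasure d)) (hg : Integrable g (sphereMeasure d))
    (p : MvPolynomial (Fin d) ℝ) :
    sphereMoment (fun ω => f ω + g ω) p = sphereMoment f p + sphereMoment g p := by
  rw [sphereMoment_eq, sphereMoment_eq, sphereMoment_eq,
    ← integral_add (integrable_mul_polyVal hf p) (integrable_mul_polyVal hg p)]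
  simp only [add_mul]

theorem sphereMoment_mul_left {d : ℕ} (z : ℂ) (f : Metric.sphere (0 : Eucl d) 1 → ℂ)
    (p : MvPolynomial (Fin d) ℝ) :
    sphereMoment (fun ω => z * f ω) p = z * sphereMoment f p := by
  rw [sphereMoment_eq, sphereMoment_eq, ← integral_const_mul]
  simp only [mul_assoc]

theorem IsSphereFunction.add {d : ℕ} {θ : ℝ → ℝ} {f h f' h' : Metric.sphere (0 : Eucl d) 1 → ℂ}
    (H : IsSphereFunction θ f h) (H' : IsSphereFunction θ f' h') :
    IsSphereFunction θ (fun ω => f ω + f' ω) (fun ω => h ω + h' ω) := by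
  refine ⟨H.1.add H'.1, H.2.1.add H'.2.1, fun k p hp => ?_⟩
  rw [sphereMoment_add_left (H.1.integrable one_le_two) (H'.1.integrable one_le_two),
    sphereMoment_add_left (H.2.1.integrable one_le_two) (H'.2.1.integrable one_le_two),
    H.2.2 k p hp, H'.2.2 k p hp, mul_add]

/-- A harmonic of degree k has zero moment against every other degree, so only the eigenvalue at k
is felt. -/
theorem isSphereFunction_polyVal {k : ℕ} {p : MvPolynomial (Fin 4) ℝ} (hp : IsSolidHarmonic k p)
    (z : ℂ) : IsSphereFunction (fun ρ => (1 + ρ) ^ (1 / 4 : ℝ))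
      (fun ω : S3 => z * ((polyVal p ω : ℝ) : ℂ))
      (fun ω : S3 => (z * ((Real.sqrt (k + 1) : ℝ) : ℂ)) * ((polyVal p ω : ℝ) : ℂ)) := by
  have hm : ∀ z : ℂ, MemLp (fun ω : S3 => z * ((polyVal p ω : ℝ) : ℂ)) 2 (sphereMeasure 4) := by
    intro z
    obtain ⟨C, hC⟩ := exists_bound_polyVal_sphere p
    have := continuous_polyVal p
    refine MemLp.of_bound (Continuous.aestronglyMeasurable (by fun_prop)) (‖z‖ * C)
      (ae_of_all _ fun ω => ?_)
    rw [norm_mul]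
    gcongr
    exact hC ω
  refine ⟨hm z, hm _, fun l q hq => ?_⟩
  rw [sphereMoment_mul_left, sphereMoment_mul_left]
  by_cases hkl : k = l
  · subst hkl
    simp only [one_add_sphereEigenvalue_rpow]
    ring
  · have : sphereMoment (fun ω : S3 => ((polyVal p ω : ℝ) : ℂ)) q = 0 := by
      rw [sphereMoment_eq]
      exact sphereInner_eq_zero hp hq hkl
    rw [this]
    simp

section Superposition

variable (D : Dispersion)

theorem isSphereFunction_waveMap (c : Modes) (t : ℝ) {r : ℝ} (hr : 0 < r) :
    IsSphereFunction (fun ρ => (1 + ρ) ^ (1 / 4 : ℝ))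
      (fun ω : S3 => waveMap D c t (r • (ω : Eucl 4)))
      (fun ω : S3 => waveMap D (angularMap c) t (r • (ω : Eucl 4))) := by
  induction c using Finsupp.induction_linear with
  | zero =>
    simp only [map_zero, Pi.zero_apply]
    exact ⟨MemLp.zero, MemLp.zero, fun k p _ => by simp [sphereMoment]⟩
  | add f g hf hg =>
    simp only [map_add, Pi.add_apply]
    exact hf.add hg
  | single i z =>
    simp only [angularMap_single, waveMap_single, Pi.smul_apply, smul_eq_mul, Mode.wave,
      modeWave_smul i.s i.harmonic i.profile t hr]
    convert isSphereFunction_polyVal i.harmonic (z * modeSignal D i.s i.k i.b (t, r)) using 2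
    · ring
    · ring

/-- The factor of the half-wave with sign `s` at time `t`. -/
def ampPhase (s : Bool) (t ρ : ℝ) : ℂ :=
  ((D.amp ρ : ℝ) : ℂ) * Complex.exp (-(Complex.I * (sgn s * t * D.φ ρ)))

theorem norm_ampPhase (s : Bool) (t ρ : ℝ) : ‖ampPhase D s t ρ‖ = |D.amp ρ| := by
  rw [ampPhase, norm_mul, Complex.norm_real, Complex.norm_exp]
  cases s <;> simp [sgn]

theorem measurable_ampPhase (s : Bool) (t : ℝ) :
    Measurable fun ξ : Eucl 4 => ampPhase D s t ‖ξ‖ := by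
  have h1 := D.measurable_amp
  have h2 := D.continuous_φ
  unfold ampPhase
  fun_prop

/-- The amplitude is square integrable against Schwartz functions. -/
def TemperateAmp : Prop := ∀ ψ : 𝓢(Eucl 4, ℂ), MemLp (fun ξ => ψ ξ * ((D.amp ‖ξ‖ : ℝ) : ℂ)) 2 volume

variable {D}

theorem TemperateAmp.memLp (hD : TemperateAmp D) (ψ : 𝓢(Eucl 4, ℂ)) (s : Bool) (t : ℝ) :
    MemLp (fun ξ => ψ ξ * ampPhase D s t ‖ξ‖) 2 volume := by
  refine (hD ψ).congr_norm
    (ψ.continuous.aestronglyMeasurable.mul (measurable_ampPhase D s t).aestronglyMeasurable)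
    (ae_of_all _ fun ξ => ?_)
  rw [norm_mul, norm_mul, norm_ampPhase, Complex.norm_real, Real.norm_eq_abs]

theorem integral_fourierInv_mul_eq_flip {f g : Eucl 4 → ℂ} (hf : Integrable f) (hg : Integrable g) :
    ∫ x, 𝓕⁻ f x * g x = ∫ x, f x * 𝓕⁻ g x := by
  have h := integral_fourier_mul_eq_flip hf hg.comp_neg
  rw [Real.fourierInv_eq_fourier_comp_neg g, ← h, ← integral_neg_eq_self]
  simp only [Real.fourierInv_eq_fourier_neg, neg_neg]

theorem fourierInv_modeFun_pairing (i : Mode) (t : ℝ) (ψ : 𝓢(Eucl 4, ℂ)) :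
    Integrable (fun x => ψ x * i.wave D t x) ∧
    ∫ x, ψ x * i.wave D t x =
      ∫ ξ, (𝓕⁻ ψ : 𝓢(Eucl 4, ℂ)) ξ * ampPhase D i.s t ‖ξ‖ * modeFun i.k i.p i.b ξ := by
  have hm := memLp_one_iff_integrable.1
    (memLp_modeFun i.harmonic.1 (isProfile_waveProfile (D := D) i.s i.profile t) 1)
  constructor
  · refine Integrable.mul_bdd (c := ∫ ξ, ‖modeFun i.k i.p (waveProfile D i.s i.b t) ξ‖)
      ψ.integrable ?_ (ae_of_all _ fun x => ?_)
    · exact ((stronglyMeasurable_modeWave i.s i.k i.p i.profile).comp_measurable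
        measurable_prodMk_left).aestronglyMeasurable
    · rw [Mode.wave, modeWave, Real.fourierInv_eq']
      refine (norm_integral_le_integral_norm _).trans (le_of_eq ?_)
      refine integral_congr_ae (ae_of_all _ fun ξ => ?_)
      simp only [norm_smul, Complex.norm_exp_ofReal_mul_I, one_mul]
  · have h1 := integral_fourierInv_mul_eq_flip ψ.integrable hm
    rw [← SchwartzMap.fourierInv_coe] at h1
    refine h1.symm.trans (integral_congr_ae (ae_of_all _ fun ξ => ?_))
    simp only [modeFun, waveProfile, ampPhase]
    ring

/-- The right side depends on the superposition only through its L² datum, hence passes to limits of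
data. `TemperateAmp` keeps the integrals finite when the amplitude is singular at the origin. -/
theorem waveMap_pairing (hD : TemperateAmp D) (c : Modes) (t : ℝ) (ψ : 𝓢(Eucl 4, ℂ)) :
    Integrable (fun x => ψ x * waveMap D c t x) ∧
    ∫ x, ψ x * waveMap D c t x =
      ∑ s, ∫ ξ, (𝓕⁻ ψ : 𝓢(Eucl 4, ℂ)) ξ * ampPhase D s t ‖ξ‖ * dataMap c s ξ := by
  have hInt : ∀ (s : Bool) (f : L2 4), Integrable fun ξ => (𝓕⁻ ψ : 𝓢(Eucl 4, ℂ)) ξ * ampPhase D s t ‖ξ‖ * f ξ :=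
    fun s f => (hD.memLp (𝓕⁻ ψ) s t).integrable_mul (Lp.memLp f)
  induction c using Finsupp.induction_linear with
  | zero =>
    simp only [map_zero, Pi.zero_apply, mul_zero, integral_zero, PiLp.zero_apply]
    refine ⟨integrable_zero _ _ _, (Finset.sum_eq_zero fun s _ => ?_).symm⟩
    refine (integral_congr_ae ?_).trans (integral_zero _ _)
    exact ae_of_all _ fun ξ => by simp
  | add f g hf hg =>
    simp only [map_add, Pi.add_apply, mul_add, PiLp.add_apply]
    refine ⟨hf.1.add hg.1, ?_⟩
    rw [integral_add hf.1 hg.1, hf.2, hg.2, ← Finset.sum_add_distrib]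
    refine Finset.sum_congr rfl fun s _ => ?_
    rw [← integral_add (hInt s _) (hInt s _)]
    refine integral_congr_ae ?_
    filter_upwards [Lp.coeFn_add (dataMap f s) (dataMap g s)] with ξ h
    rw [h, Pi.add_apply, mul_add]
  | single i z =>
    obtain ⟨h1, h2⟩ := fourierInv_modeFun_pairing (D := D) i t ψ
    have e : (fun x => ψ x * waveMap D (Finsupp.single i z) t x) =
        fun x => z * (ψ x * i.wave D t x) := by
      funext x
      rw [waveMap_single, Pi.smul_apply, Pi.smul_apply, smul_eq_mul]
      ring
    rw [e]
    refine ⟨h1.const_mul z, ?_⟩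
    rw [integral_const_mul, h2, Finset.sum_eq_single i.s]
    · rw [← integral_const_mul]
      refine integral_congr_ae ?_
      rw [dataMap_single, PiLp.smul_apply]
      simp only [Mode.data, if_true]
      filter_upwards [Lp.coeFn_smul z i.toL2, i.coeFn_toL2] with ξ h3 h4
      rw [h3, Pi.smul_apply, h4, smul_eq_mul]
      ring
    · intro s _ hs
      rw [dataMap_single, PiLp.smul_apply]
      simp only [Mode.data, if_neg hs, smul_zero]
      refine (integral_congr_ae ?_).trans (integral_zero _ _)
      exact ae_of_all _ fun ξ => by simp
    · simp

end Superposition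


/-! ### Density of the modes -/

theorem memLp_two_iff_lintegral {X : Type*} [MeasurableSpace X] {μ : Measure X} {f : X → ℂ}
    (hf : AEStronglyMeasurable f μ) : MemLp f 2 μ ↔ ∫⁻ x, ‖f x‖ₑ ^ 2 ∂μ < ∞ := by
  have h := eLpNorm_lt_top_iff_lintegral_rpow_enorm_lt_top (μ := μ) (f := f) two_ne_zero
    ENNReal.ofNat_ne_top
  simp only [ENNReal.toReal_ofNat, ENNReal.rpow_ofNat] at h
  rw [← h]
  exact ⟨fun h => h.2, fun h => ⟨hf, h⟩⟩

theorem eLpNorm_two_sq {X : Type*} [MeasurableSpace X] {μ : Measure X} (f : X → ℂ) :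
    eLpNorm f 2 μ ^ 2 = ∫⁻ x, ‖f x‖ₑ ^ 2 ∂μ := by
  rw [eLpNorm_eq_lintegral_rpow_enorm_toReal two_ne_zero ENNReal.ofNat_ne_top]
  simp only [ENNReal.toReal_ofNat, ENNReal.rpow_ofNat]
  rw [← ENNReal.rpow_natCast, ← ENNReal.rpow_mul]
  norm_num

theorem memLp_two_prod_right_ae {X Y : Type*} [MeasurableSpace X] [MeasurableSpace Y]
    {μ : Measure X} {ν : Measure Y} [SFinite ν] [SFinite μ] {f : X × Y → ℂ}
    (hf : MemLp f 2 (μ.prod ν)) :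
    ∀ᵐ x ∂μ, MemLp (fun y => f (x, y)) 2 ν := by
  have h1 := (memLp_two_iff_lintegral hf.1).1 hf
  rw [lintegral_prod _ (hf.1.enorm.pow_const 2)] at h1
  filter_upwards [ae_lt_top' (hf.1.enorm.pow_const 2).lintegral_prod_right' h1.ne,
    hf.1.prodMk_left] with x h2 h3
  exact (memLp_two_iff_lintegral h3).2 h2

/-- Modes with indicator profiles show that each harmonic moment of f vanishes on almost every
sphere. Finite generation in each degree makes the exceptional set of radii common to all harmonics,
and completeness finishes. -/
theorem ae_eq_zero_of_modes {f : Eucl 4 → ℂ} (hf : MemLp f 2 volume)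
    (H : ∀ (k : ℕ) (p : MvPolynomial (Fin 4) ℝ) (b : ℝ → ℂ), IsSolidHarmonic k p → IsProfile b →
      ∫ ξ, (starRingEnd ℂ) (modeFun k p b ξ) * f ξ = 0) : f =ᵐ[volume] 0 := by
  have hpol : MemLp (fun q : ℝ × S3 => f (q.1 • (q.2 : Eucl 4))) 2
      ((radialMeasure 3).prod (sphereMeasure 4)) := hf.comp_measurePreserving measurePreserving_polarMap
  have hslice : ∀ᵐ r ∂(radialMeasure 3), MemLp (fun ω : S3 => f (r • (ω : Eucl 4))) 2
      (sphereMeasure 4) := memLp_two_prod_right_ae hpol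
  have hmom : ∀ (k : ℕ) (p : MvPolynomial (Fin 4) ℝ), IsSolidHarmonic k p →
      ∀ᵐ r ∂(radialMeasure 3), sphereMoment (fun ω : S3 => f (r • (ω : Eucl 4))) p = 0 := by
    intro k p hp
    -- The half-line is exhausted by compact intervals on which indicators are profiles and the
    -- radial measure is finite.
    have hn : ∀ n : ℕ, ∀ᵐ r ∂((radialMeasure 3).restrict (Set.Icc (1 / ((n : ℝ) + 1)) (n + 1))),
        sphereMoment (fun ω : S3 => f (r • (ω : Eucl 4))) p = 0 := by
      intro n
      set J := Set.Icc (1 / ((n : ℝ) + 1)) ((n : ℝ) + 1) with hJ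
      have hfin : IsFiniteMeasure ((radialMeasure 3).restrict J) := by
        refine ⟨?_⟩
        rw [Measure.restrict_apply_univ, radialMeasure, withDensity_apply _ measurableSet_Icc]
        exact setLIntegral_lt_top_of_isCompact
          ((Measure.restrict_apply_le _ _).trans_lt isCompact_Icc.measure_lt_top).ne isCompact_Icc
          (f := fun r : ℝ => Real.toNNReal (r ^ 3)) (by fun_prop)
      have hInt : Integrable (fun q : ℝ × S3 => f (q.1 • (q.2 : Eucl 4)) * ((polyVal p q.2 : ℝ) : ℂ))
          (((radialMeasure 3).restrict J).prod (sphereMeasure 4)) := by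
        obtain ⟨C, hC⟩ := exists_bound_polyVal_sphere p
        have hc := continuous_polyVal p
        have hr : MemLp (fun q : ℝ × S3 => f (q.1 • (q.2 : Eucl 4))) 2
            (((radialMeasure 3).restrict J).prod (sphereMeasure 4)) := by
          rw [← Measure.restrict_univ (μ := sphereMeasure 4), Measure.prod_restrict]
          exact hpol.restrict _
        exact (hr.integrable one_le_two).mul_bdd (c := C)
          (Continuous.aestronglyMeasurable (by fun_prop)) (ae_of_all _ fun q => hC q.2)
      refine Integrable.ae_eq_zero_of_forall_setIntegral_eq_zero hInt.integral_prod_left ?_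
      intro A hA _
      set b : ℝ → ℂ := (A ∩ J).indicator fun _ => 1 with hb
      have hbp : IsProfile b := by
        refine ⟨measurable_const.indicator (hA.inter measurableSet_Icc), 1 / ((n : ℝ) + 1), n + 1, 1,
          by positivity, fun ρ => ?_, fun ρ hρ => ?_⟩
        · rw [hb]
          refine (norm_indicator_le_norm_self _ _).trans (by simp)
        · exact Set.indicator_of_notMem (fun h => hρ h.2) _
      have h0 := H k p b hp hbp
      have hInt' : Integrable fun ξ => (starRingEnd ℂ) (modeFun k p b ξ) * f ξ :=
        (memLp_modeFun hp.1 hbp 2).star.integrable_mul hf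
      rw [integral_polar hInt'] at h0
      rw [Measure.restrict_restrict hA, ← integral_indicator (hA.inter measurableSet_Icc), ← h0]
      refine integral_congr_ae ?_
      filter_upwards [ae_radialMeasure_pos 3] with r hr
      simp only [modeFun_smul hp.1 b hr]
      by_cases hr' : r ∈ A ∩ J
      · rw [Set.indicator_of_mem hr']
        simp [hb, Set.indicator_of_mem hr', mul_comm, sphereMoment_eq]
      · rw [Set.indicator_of_notMem hr']
        simp [hb, Set.indicator_of_notMem hr']
    have hall := ae_all_iff.2 fun n => (ae_restrict_iff' measurableSet_Icc).1 (hn n)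
    filter_upwards [hall, ae_radialMeasure_pos 3] with r h hr
    obtain ⟨n, hn⟩ := exists_nat_ge (max r (1 / r))
    refine h n ⟨?_, ?_⟩
    · rw [div_le_iff₀ (by positivity)]
      have := (le_max_right r (1 / r)).trans hn
      rw [div_le_iff₀ hr] at this
      nlinarith
    · exact ((le_max_left _ _).trans hn).trans (by linarith)
  have hall := ae_forall_sphereMoment (μ := radialMeasure 3) (f := fun _ _ => 0)
    (h := fun (r : ℝ) (ω : S3) => f (r • (ω : Eucl 4))) (fun _ => 0)
    (ae_of_all _ fun _ => integrable_zero _ _ _)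
    (hslice.mono fun r hr => hr.integrable one_le_two)
    (fun k p hp => (hmom k p hp).mono fun r hr => by simpa using hr)
  refine ae_eq_of_ae_polar hf.1 aestronglyMeasurable_zero ?_
  rw [← ae_radialMeasure_iff 3]
  filter_upwards [hall, hslice] with r h1 h2
  exact ae_eq_zero_of_sphereMoment_eq_zero (by norm_num) h2 fun k p hp => by
    simpa using h1 k p hp

theorem denseRange_dataMap : DenseRange dataMap := by
  have h : Dense ((LinearMap.range dataMap : Submodule ℂ DataSpace) : Set DataSpace) := by
    rw [Submodule.dense_iff_topologicalClosure_eq_top, Submodule.topologicalClosure_eq_top_iff,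
      Submodule.eq_bot_iff]
    intro x hx
    rw [Submodule.mem_orthogonal] at hx
    have hi : ∀ i : Mode, inner ℂ i.data x = 0 := fun i => hx _ ⟨Finsupp.single i 1, by
      rw [dataMap_single, one_smul]⟩
    ext1 s
    have hz : x s = 0 := by
      rw [Lp.eq_zero_iff_ae_eq_zero]
      refine ae_eq_zero_of_modes (Lp.memLp _) fun k p b hp hb => ?_
      have h1 := hi ⟨s, k, p, b, hp, hb⟩
      rw [PiLp.inner_apply, Finset.sum_eq_single s (fun s' _ hs' => by simp [Mode.data, hs'])
        (by simp)] at h1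
      simp only [Mode.data, if_true] at h1
      rw [L2.inner_def] at h1
      rw [← h1]
      refine integral_congr_ae ?_
      filter_upwards [Mode.coeFn_toL2 ⟨s, k, p, b, hp, hb⟩] with ξ h2
      rw [h2, RCLike.inner_apply, mul_comm]
    rw [hz]
    rfl
  exact h


/-! ### Limits of superpositions -/

theorem tendsto_integral_mul_of_lintegral {X : Type*} [MeasurableSpace X] {μ : Measure X}
    {m : X → ℂ} (hm : MemLp m 2 μ) {f : ℕ → X → ℂ} {f' : X → ℂ} (hf : ∀ n, MemLp (f n) 2 μ)
    (hf' : MemLp f' 2 μ) (h : Tendsto (fun n => ∫⁻ x, ‖f n x - f' x‖ₑ ^ 2 ∂μ) atTop (𝓝 0)) :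
    Tendsto (fun n => ∫ x, m x * f n x ∂μ) atTop (𝓝 (∫ x, m x * f' x ∂μ)) := by
  refine tendsto_integral_of_L1 _ (hm.integrable_mul hf').1
    (Eventually.of_forall fun n => hm.integrable_mul (hf n)) ?_
  have hle : ∀ n, ∫⁻ x, ‖m x * f n x - m x * f' x‖ₑ ∂μ ≤
      (∫⁻ x, ‖m x‖ₑ ^ 2 ∂μ) ^ (1 / 2 : ℝ) * (∫⁻ x, ‖f n x - f' x‖ₑ ^ 2 ∂μ) ^ (1 / 2 : ℝ) := by
    intro n
    have := ENNReal.lintegral_mul_le_Lp_mul_Lq μ Real.HolderConjugate.two_two hm.1.enorm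
      ((hf n).1.sub hf'.1).enorm
    simp only [Pi.mul_apply, Pi.sub_apply, ENNReal.rpow_ofNat] at this
    simpa only [← mul_sub, enorm_mul] using this
  refine tendsto_of_tendsto_of_tendsto_of_le_of_le tendsto_const_nhds ?_ (fun n => zero_le) hle
  have h1 := (ENNReal.continuous_rpow_const (y := (1 / 2 : ℝ))).tendsto 0 |>.comp h
  rw [ENNReal.zero_rpow_of_pos (by norm_num)] at h1
  have h2 := ENNReal.Tendsto.const_mul (a := (∫⁻ x, ‖m x‖ₑ ^ 2 ∂μ) ^ (1 / 2 : ℝ)) h1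
    (Or.inr (ENNReal.rpow_ne_top_of_nonneg (by norm_num) ((memLp_two_iff_lintegral hm.1).1 hm).ne))
  simpa using h2

theorem ae_ne_zero_volume : ∀ᵐ x : Eucl 4, x ≠ 0 := by
  rw [ae_iff]
  simp

theorem withDensity_weightMeasure :
    weightMeasure.withDensity (fun x => ‖x‖ₑ ^ 2) = (volume : Measure (Eucl 4)) := by
  rw [weightMeasure, ← withDensity_mul _ measurable_weight (by fun_prop)]
  conv_rhs => rw [← withDensity_one (μ := (volume : Measure (Eucl 4)))]
  refine withDensity_congr_ae ?_
  filter_upwards [ae_ne_zero_volume] with x hx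
  exact ENNReal.inv_mul_cancel (by simpa using hx) (by finiteness)

/-- Pairing with ψ in dx is pairing with |x|²ψ in dx/|x|². As |x|²ψ is square integrable for that
weight, convergence in weighted L² gives convergence of distributions. -/
theorem memLp_schwartz_mul_norm_sq (ψ : 𝓢(Eucl 4, ℂ)) :
    MemLp (fun x => ((‖x‖ ^ 2 : ℝ) : ℂ) * ψ x) 2 weightMeasure := by
  have hm : Measurable fun x : Eucl 4 => ((‖x‖ ^ 2 : ℝ) : ℂ) * ψ x := by
    have := ψ.continuous
    exact Continuous.measurable (by fun_prop)
  rw [memLp_two_iff_lintegral hm.aestronglyMeasurable, lintegral_weightMeasure (by fun_prop)]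
  obtain ⟨C, hC⟩ : ∃ C, ∀ x, ‖ψ x‖ ≤ C := ⟨_, ψ.norm_le_seminorm ℝ⟩
  have h1 : Integrable fun x => C * (‖x‖ ^ 2 * ‖ψ x‖) := (ψ.integrable_pow_mul volume 2).const_mul C
  refine lt_of_le_of_lt (lintegral_mono fun x => ?_) h1.lintegral_lt_top
  by_cases hx : x = 0
  · simp [hx]
  have hx' : 0 < ‖x‖ := norm_pos_iff.2 hx
  rw [← ofReal_norm, ← ofReal_norm, ← ENNReal.ofReal_pow (by positivity),
    ← ENNReal.ofReal_pow (by positivity), ← ENNReal.ofReal_div_of_pos (by positivity)]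
  refine ENNReal.ofReal_le_ofReal ?_
  rw [norm_mul, Complex.norm_real, Real.norm_of_nonneg (by positivity), div_le_iff₀ (by positivity)]
  calc (‖x‖ ^ 2 * ‖ψ x‖) ^ 2 = ‖ψ x‖ * (‖x‖ ^ 2 * ‖ψ x‖) * ‖x‖ ^ 2 := by ring
    _ ≤ C * (‖x‖ ^ 2 * ‖ψ x‖) * ‖x‖ ^ 2 := by
      gcongr
      exact hC x

theorem integrable_schwartz_mul (ψ : 𝓢(Eucl 4, ℂ)) {w : Eucl 4 → ℂ} (hw : MemLp w 2 weightMeasure) :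
    Integrable (fun x => ψ x * w x) := by
  rw [← withDensity_weightMeasure, integrable_withDensity_iff_integrable_smul' (by fun_prop)
    (ae_of_all _ fun x => by finiteness)]
  refine ((memLp_schwartz_mul_norm_sq ψ).integrable_mul hw).congr (ae_of_all _ fun x => ?_)
  simp only [ENNReal.toReal_pow, toReal_enorm, Complex.real_smul, Pi.mul_apply]
  push_cast
  ring

theorem integral_schwartz_mul (ψ : 𝓢(Eucl 4, ℂ)) (w : Eucl 4 → ℂ) :
    ∫ x, ψ x * w x = ∫ x, (((‖x‖ ^ 2 : ℝ) : ℂ) * ψ x) * w x ∂weightMeasure := by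
  conv_lhs => rw [← withDensity_weightMeasure]
  rw [integral_withDensity_eq_integral_toReal_smul (by fun_prop)
    (ae_of_all _ fun x => by finiteness)]
  refine integral_congr_ae (ae_of_all _ fun x => ?_)
  simp only [ENNReal.toReal_pow, toReal_enorm, Complex.real_smul]
  push_cast
  ring

/-- A subsequence converges in L² on almost every sphere. Moments are continuous there, so the
moment identities survive in the limit. -/
theorem IsAngularFunction.of_tendsto {θ : ℝ → ℝ} {v w : ℕ → Eucl 4 → ℂ} {v' w' : Eucl 4 → ℂ}
    (h : ∀ n, IsAngularFunction θ (v n) (w n)) (hv : ∀ n, MemLp (v n) 2 weightMeasure)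
    (hw : ∀ n, MemLp (w n) 2 weightMeasure) (hv' : MemLp v' 2 weightMeasure)
    (hw' : MemLp w' 2 weightMeasure)
    (hlim : Tendsto (fun n => ∫⁻ x, (‖v n x - v' x‖ₑ ^ 2 + ‖w n x - w' x‖ₑ ^ 2) ∂weightMeasure)
      atTop (𝓝 0)) : IsAngularFunction θ v' w' := by
  have hP := measurePreserving_polarMap_weight
  have hm : ∀ n, AEMeasurable (fun x => ‖v n x - v' x‖ₑ ^ 2 + ‖w n x - w' x‖ₑ ^ 2)
      weightMeasure := fun n =>
    (((hv n).1.sub hv'.1).enorm.pow_const 2).add (((hw n).1.sub hw'.1).enorm.pow_const 2)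
  have hm' : ∀ n, AEMeasurable (fun q : ℝ × S3 =>
      ‖v n (q.1 • (q.2 : Eucl 4)) - v' (q.1 • (q.2 : Eucl 4))‖ₑ ^ 2 +
        ‖w n (q.1 • (q.2 : Eucl 4)) - w' (q.1 • (q.2 : Eucl 4))‖ₑ ^ 2)
      ((radialMeasure 1).prod (sphereMeasure 4)) := fun n =>
    (hm n).comp_quasiMeasurePreserving hP.quasiMeasurePreserving
  have e : ∀ n, ∫⁻ x, (‖v n x - v' x‖ₑ ^ 2 + ‖w n x - w' x‖ₑ ^ 2) ∂weightMeasure =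
      ∫⁻ r, ∫⁻ ω : S3, (‖v n (r • (ω : Eucl 4)) - v' (r • (ω : Eucl 4))‖ₑ ^ 2 +
        ‖w n (r • (ω : Eucl 4)) - w' (r • (ω : Eucl 4))‖ₑ ^ 2) ∂(sphereMeasure 4)
          ∂(radialMeasure 1) := by
    intro n
    rw [← lintegral_prod _ (hm' n)]
    have := hm n
    rw [← hP.map_eq] at this ⊢
    exact lintegral_map' this hP.measurable.aemeasurable
  simp only [e] at hlim
  obtain ⟨ns, -, hns⟩ := exists_seq_ae_tendsto_zero (fun n => (hm' n).lintegral_prod_right') hlim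
  have hslice : ∀ {f : Eucl 4 → ℂ}, MemLp f 2 weightMeasure → ∀ᵐ r ∂(radialMeasure 1),
      MemLp (fun ω : S3 => f (r • (ω : Eucl 4))) 2 (sphereMeasure 4) := fun hf =>
    memLp_two_prod_right_ae (hf.comp_measurePreserving hP)
  rw [IsAngularFunction, ← ae_radialMeasure_iff 1]
  have h1 : ∀ᵐ r ∂(radialMeasure 1), ∀ n, IsSphereFunction θ
      (fun ω : S3 => v n (r • (ω : Eucl 4))) (fun ω : S3 => w n (r • (ω : Eucl 4))) :=
    ae_all_iff.2 fun n => (ae_radialMeasure_iff 1).2 (h n)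
  filter_upwards [hns, hslice hv', hslice hw', h1] with r hr hrv hrw hrn
  refine ⟨hrv, hrw, fun k p hp => ?_⟩
  have hpm : MemLp (fun ω : S3 => ((polyVal p ω : ℝ) : ℂ)) 2 (sphereMeasure 4) := by
    simpa using (isSphereFunction_polyVal hp 1).1
  have hmom : ∀ {f : ℕ → S3 → ℂ} {f' : S3 → ℂ}, (∀ n, MemLp (f n) 2 (sphereMeasure 4)) →
      MemLp f' 2 (sphereMeasure 4) →
      Tendsto (fun n => ∫⁻ ω, ‖f n ω - f' ω‖ₑ ^ 2 ∂(sphereMeasure 4)) atTop (𝓝 0) →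
      Tendsto (fun n => sphereMoment (f n) p) atTop (𝓝 (sphereMoment f' p)) := by
    intro f f' hf hf' hl
    have := tendsto_integral_mul_of_lintegral hpm hf hf' hl
    simpa only [sphereMoment_eq, mul_comm] using this
  have l1 := hmom (fun n => (hrn (ns n)).1) hrv (tendsto_of_tendsto_of_tendsto_of_le_of_le
    tendsto_const_nhds hr (fun n => zero_le) fun n => lintegral_mono fun ω => le_self_add)
  have l2 := hmom (fun n => (hrn (ns n)).2.1) hrw (tendsto_of_tendsto_of_tendsto_of_le_of_le
    tendsto_const_nhds hr (fun n => zero_le) fun n => lintegral_mono fun ω => le_add_self)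
  refine tendsto_nhds_unique l2 ((l1.const_mul _).congr fun n => ?_)
  exact ((hrn (ns n)).2.2 k p hp).symm

theorem tendsto_lintegral_of_tendsto_waveSpace {D : Dispersion} {c : ℕ → Modes} {u : WaveSpace}
    (h : Tendsto (fun n => waveLpMap D (c n)) atTop (𝓝 u)) :
    Tendsto (fun n => ∫⁻ z, ‖Function.uncurry (waveMap D (c n)) z - u z‖ₑ ^ 2 ∂spaceTimeMeasure)
      atTop (𝓝 0) := by
  rw [Lp.tendsto_Lp_iff_tendsto_eLpNorm'] at h
  have h2 := ((ENNReal.continuous_pow 2).tendsto 0).comp h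
  rw [zero_pow two_ne_zero] at h2
  refine h2.congr fun n => ?_
  rw [Function.comp, eLpNorm_two_sq]
  refine lintegral_congr_ae ?_
  filter_upwards [coeFn_waveLpMap D (c n)] with z hz
  rw [Pi.sub_apply, hz]

/-- Extends the isometry from superpositions to all data. Here v is the wave with datum m f, S its
angular power, and g the angular power for the datum f itself, so that formally g is S with the
multiplier m removed. That relation is stated by duality on test functions. -/
theorem exists_smoothing {D : Dispersion} (hD : TemperateAmp D) (m : Multiplier) (f : DataSpace) :
    ∃ v S g : ℝ → Eucl 4 → ℂ, StronglyMeasurable (Function.uncurry g) ∧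
      weightedIntegral g = ENNReal.ofReal Real.pi * ‖f‖ₑ ^ 2 ∧
      ∀ᵐ t : ℝ, MemLp (v t) 2 weightMeasure ∧ MemLp (S t) 2 weightMeasure ∧
        MemLp (g t) 2 weightMeasure ∧
        IsAngularFunction (fun ρ => (1 + ρ) ^ (1 / 4 : ℝ)) (v t) (S t) ∧
        (∀ ψ : 𝓢(Eucl 4, ℂ), ∫ x, ψ x * v t x =
          ∑ s, ∫ ξ, (𝓕⁻ ψ : 𝓢(Eucl 4, ℂ)) ξ * ampPhase D s t ‖ξ‖ * (((m.a ‖ξ‖ : ℝ) : ℂ) * f s ξ)) ∧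
        ∀ ψ ψ' : 𝓢(Eucl 4, ℂ), (∀ ξ, (𝓕⁻ ψ : 𝓢(Eucl 4, ℂ)) ξ =
            ((m.a ‖ξ‖ : ℝ) : ℂ) * (𝓕⁻ ψ' : 𝓢(Eucl 4, ℂ)) ξ) →
          ∫ x, ψ x * g t x = ∫ x, ψ' x * S t x := by
  obtain ⟨y, hy, hlim⟩ := mem_closure_iff_seq_limit.1 (denseRange_dataMap f)
  choose c hc using hy
  obtain rfl : (fun n => dataMap (c n)) = y := funext hc
  obtain ⟨g, hg⟩ := exists_tendsto_of_norm_le dataMap (waveLpMap D ∘ₗ angularMap)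
    (fun c => (norm_waveLpMap_angularMap D c).le) hlim
  obtain ⟨S, hS⟩ := exists_tendsto_of_norm_le dataMap (waveLpMap D ∘ₗ angularMap ∘ₗ scaleMap m)
    (fun c => (norm_waveLpMap_angularMap D _).le.trans
      (mul_le_mul_of_nonneg_left (norm_dataMap_scaleMap_le m c) (Real.sqrt_nonneg _))) hlim
  obtain ⟨v, hv⟩ := exists_tendsto_of_norm_le dataMap (waveLpMap D ∘ₗ scaleMap m)
    (fun c => (norm_waveLpMap_le D _).trans
      (mul_le_mul_of_nonneg_left (norm_dataMap_scaleMap_le m c) (Real.sqrt_nonneg _))) hlim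
  have hmeas : ∀ (c : Modes) (u : WaveSpace), Measurable
      fun z => ‖Function.uncurry (waveMap D c) z - u z‖ₑ ^ 2 := fun c u =>
    ((stronglyMeasurable_waveMap D c).sub (Lp.stronglyMeasurable u)).enorm.pow_const 2
  have hsum := ((tendsto_lintegral_of_tendsto_waveSpace hv).add
    (tendsto_lintegral_of_tendsto_waveSpace hS)).add (tendsto_lintegral_of_tendsto_waveSpace hg)
  -- A single error controls all three limits, so one subsequence and one null set of times serve
  -- for v, S and g.
  set δ : ℕ → ℝ × Eucl 4 → ℝ≥0∞ := fun n z =>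
    ‖Function.uncurry (waveMap D (scaleMap m (c n))) z - v z‖ₑ ^ 2 +
    ‖Function.uncurry (waveMap D (angularMap (scaleMap m (c n)))) z - S z‖ₑ ^ 2 +
    ‖Function.uncurry (waveMap D (angularMap (c n))) z - g z‖ₑ ^ 2 with hδ
  have hδm : ∀ n, Measurable (δ n) := fun n => ((hmeas _ v).add (hmeas _ S)).add (hmeas _ g)
  have hδlim : Tendsto (fun n => ∫⁻ t, ∫⁻ x, δ n (t, x) ∂weightMeasure) atTop (𝓝 0) := by
    simp only [add_zero] at hsum
    refine hsum.congr fun n => ?_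
    rw [← lintegral_prod _ (hδm n).aemeasurable]
    change _ = ∫⁻ z, δ n z ∂spaceTimeMeasure
    simp only [hδ]
    rw [lintegral_add_right _ (hmeas _ g), lintegral_add_right _ (hmeas _ S)]
    rfl
  obtain ⟨ns, hns, hae⟩ := exists_seq_ae_tendsto_zero
    (fun n => ((hδm n).lintegral_prod_right' (ν := weightMeasure)).aemeasurable) hδlim
  have hsec : ∀ u : WaveSpace, ∀ᵐ t, MemLp (fun x => u (t, x)) 2 weightMeasure := fun u =>
    memLp_two_prod_right_ae (Lp.memLp u)
  have hsecn : ∀ (e : Modes →ₗ[ℂ] Modes), ∀ᵐ t, ∀ n,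
      MemLp (waveMap D (e (c n)) t) 2 weightMeasure := fun e => ae_all_iff.2 fun n =>
    memLp_two_prod_right_ae (f := Function.uncurry (waveMap D (e (c n))))
      ((memLp_congr_ae (coeFn_waveLpMap D (e (c n)))).1 (Lp.memLp _))
  refine ⟨fun t x => v (t, x), fun t x => S (t, x), fun t x => g (t, x),
    Lp.stronglyMeasurable g, ?_, ?_⟩
  · have h1 : weightedIntegral (fun t x => g (t, x)) = ‖g‖ₑ ^ 2 := by
      have h0 : ‖g‖ₑ ^ 2 = ∫⁻ z, ‖g z‖ₑ ^ 2 ∂((volume : Measure ℝ).prod weightMeasure) := by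
        rw [Lp.enorm_def, eLpNorm_two_sq]
        rfl
      rw [h0, lintegral_prod _ ((Lp.stronglyMeasurable g).enorm.pow_const 2).aemeasurable]
      refine lintegral_congr fun t => ?_
      rw [lintegral_weightMeasure]
      exact (((Lp.stronglyMeasurable g).comp_measurable
        measurable_prodMk_left).enorm.pow_const 2).aemeasurable
    have h2 : ‖g‖ ^ 2 = Real.pi * ‖f‖ ^ 2 := by
      refine tendsto_nhds_unique (hg.norm.pow 2) ?_
      refine ((hlim.norm.pow 2).const_mul Real.pi).congr fun n => ?_
      exact (norm_sq_waveLpMap_angularMap D (c n)).symm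
    rw [h1, ← ofReal_norm, ← ofReal_norm, ← ENNReal.ofReal_pow (norm_nonneg _),
      ← ENNReal.ofReal_pow (norm_nonneg _), h2, ENNReal.ofReal_mul Real.pi_pos.le]
  · filter_upwards [hae, hsec v, hsec S, hsec g, hsecn (scaleMap m),
      hsecn (angularMap ∘ₗ scaleMap m), hsecn angularMap] with t ht tv tS tg tvn tSn tgn
    have lim_of_le : ∀ {h : ℕ → Eucl 4 → ℝ≥0∞}, (∀ n x, h n x ≤ δ (ns n) (t, x)) →
        Tendsto (fun n => ∫⁻ x, h n x ∂weightMeasure) atTop (𝓝 0) := fun hle =>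
      tendsto_of_tendsto_of_tendsto_of_le_of_le tendsto_const_nhds ht (fun n => zero_le)
        fun n => lintegral_mono (hle n)
    -- On a good time slice the pairings of the approximants, expressed through the data, converge
    -- to the pairing of the limit.
    have pair : ∀ (e : Modes →ₗ[ℂ] Modes) (u : WaveSpace),
        (∀ n, MemLp (waveMap D (e (c n)) t) 2 weightMeasure) →
        MemLp (fun x => u (t, x)) 2 weightMeasure →
        (∀ n x, ‖waveMap D (e (c n)) t x - u (t, x)‖ₑ ^ 2 ≤ δ n (t, x)) →
        ∀ ψ : 𝓢(Eucl 4, ℂ), Tendsto (fun n => ∑ s, ∫ ξ, (𝓕⁻ ψ : 𝓢(Eucl 4, ℂ)) ξ *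
          ampPhase D s t ‖ξ‖ * dataMap (e (c (ns n))) s ξ) atTop (𝓝 (∫ x, ψ x * u (t, x))) := by
      intro e u hn hu hle ψ
      rw [integral_schwartz_mul]
      refine (tendsto_integral_mul_of_lintegral (memLp_schwartz_mul_norm_sq ψ)
        (fun n => hn (ns n)) hu (lim_of_le fun n x => hle (ns n) x)).congr fun n => ?_
      rw [← integral_schwartz_mul, (waveMap_pairing hD _ t ψ).2]
    have pv := pair (scaleMap m) v tvn tv fun n x => le_add_of_le_of_nonneg le_self_add zero_le
    have pS := pair (angularMap ∘ₗ scaleMap m) S tSn tS fun n x =>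
      le_add_of_le_of_nonneg le_add_self zero_le
    have pg := pair angularMap g tgn tg fun n x => le_add_self
    refine ⟨tv, tS, tg, ?_, fun ψ => ?_, fun ψ ψ' hψ => ?_⟩
    · refine IsAngularFunction.of_tendsto (v := fun n => waveMap D (scaleMap m (c (ns n))) t)
        (w := fun n => waveMap D (angularMap (scaleMap m (c (ns n)))) t) (fun n => ?_)
        (fun n => tvn (ns n)) (fun n => tSn (ns n)) tv tS (lim_of_le fun n x => le_self_add)
      filter_upwards [ae_restrict_mem measurableSet_Ioi] with r hr
      exact isSphereFunction_waveMap D _ t hr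
    · refine tendsto_nhds_unique (pv ψ) (tendsto_finsetSum _ fun s _ => ?_)
      have hmul : ∀ h : L2 4, ∫ ξ, (𝓕⁻ ψ : 𝓢(Eucl 4, ℂ)) ξ * ampPhase D s t ‖ξ‖ *
          (((m.a ‖ξ‖ : ℝ) : ℂ) * h ξ) = ∫ ξ, ((𝓕⁻ ψ : 𝓢(Eucl 4, ℂ)) ξ * ampPhase D s t ‖ξ‖ *
          ((m.a ‖ξ‖ : ℝ) : ℂ)) * h ξ := fun h => by simp only [mul_assoc]
      rw [hmul]
      have hmem : MemLp (fun ξ => (𝓕⁻ ψ : 𝓢(Eucl 4, ℂ)) ξ * ampPhase D s t ‖ξ‖ *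
          ((m.a ‖ξ‖ : ℝ) : ℂ)) 2 volume := by
        refine (hD.memLp (𝓕⁻ ψ) s t).mono ((hD.memLp (𝓕⁻ ψ) s t).1.mul ?_)
          (ae_of_all _ fun ξ => ?_)
        · exact (Complex.measurable_ofReal.comp
            (m.measurable.comp measurable_norm)).aestronglyMeasurable
        · rw [norm_mul, Complex.norm_real]
          exact mul_le_of_le_one_right (norm_nonneg _) (m.abs_le_one _)
      have hcomp : Tendsto (fun n => dataMap (c (ns n)) s) atTop (𝓝 (f s)) :=
        ((PiLp.continuous_apply 2 (fun _ : Bool => L2 4) s).tendsto f).comp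
          (hlim.comp hns.tendsto_atTop)
      rw [Lp.tendsto_Lp_iff_tendsto_eLpNorm'] at hcomp
      have hcomp2 := ((ENNReal.continuous_pow 2).tendsto 0).comp hcomp
      rw [zero_pow two_ne_zero] at hcomp2
      refine (tendsto_integral_mul_of_lintegral hmem (f := fun n => dataMap (c (ns n)) s)
        (fun n => Lp.memLp _) (Lp.memLp _) (hcomp2.congr fun n => ?_)).congr fun n => ?_
      · rw [Function.comp, eLpNorm_two_sq]
        rfl
      · rw [← hmul]
        refine integral_congr_ae ?_
        filter_upwards [dataMap_scaleMap_apply m (c (ns n)) s] with ξ hξ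
        rw [hξ]
    -- The approximants have equal pairings: the angular operator commutes with the multiplier, and
    -- `hψ` moves m from the test function to the datum.
    · refine tendsto_nhds_unique (pg ψ) ((pS ψ').congr fun n => ?_)
      refine Finset.sum_congr rfl fun s _ => integral_congr_ae ?_
      rw [LinearMap.comp_apply, angularMap_scaleMap]
      filter_upwards [dataMap_scaleMap_apply m (angularMap (c (ns n))) s] with ξ hξ
      rw [hξ, hψ ξ]
      ring


/-! ### Test functions away from the origin -/

/-- Smooth functions with compact support in `ℝ⁴ ∖ {0}`. -/
structure IsTest (χ : Eucl 4 → ℂ) : Prop where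
  contDiff : ContDiff ℝ (⊤ : ℕ∞) χ
  hasCompactSupport : HasCompactSupport χ
  zero_notMem : (0 : Eucl 4) ∉ tsupport χ

/-- |ξ| is smooth near the support of χ, so symbols singular at the origin, such as powers of |ξ|,
preserve test functions. This is why the origin is excluded from the support. -/
theorem IsTest.mul_radial {χ : Eucl 4 → ℂ} (hχ : IsTest χ) {a : ℝ → ℂ}
    (ha : ContDiffOn ℝ (⊤ : ℕ∞) a (Set.Ioi 0)) : IsTest fun ξ => a ‖ξ‖ * χ ξ := by
  have hsub : tsupport (fun ξ => a ‖ξ‖ * χ ξ) ⊆ tsupport χ :=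
    tsupport_mul_subset_right (f := fun ξ => a ‖ξ‖) (g := χ)
  refine ⟨?_, hχ.hasCompactSupport.mul_left (f := fun ξ => a ‖ξ‖), fun h => hχ.zero_notMem (hsub h)⟩
  rw [contDiff_iff_contDiffAt]
  intro ξ
  by_cases hξ : ξ ∈ tsupport χ
  · have h0 : ξ ≠ 0 := fun h => hχ.zero_notMem (h ▸ hξ)
    have h1 : ContDiffAt ℝ (⊤ : ℕ∞) a ‖ξ‖ :=
      ha.contDiffAt (Ioi_mem_nhds (norm_pos_iff.2 h0))
    exact (h1.comp ξ (contDiffAt_norm ℝ h0)).mul hχ.contDiff.contDiffAt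
  · have h1 : χ =ᶠ[𝓝 ξ] 0 := notMem_tsupport_iff_eventuallyEq.1 hξ
    refine (contDiffAt_const (c := (0 : ℂ))).congr_of_eventuallyEq ?_
    filter_upwards [h1] with η hη
    simp [hη]

theorem IsTest.conj {χ : Eucl 4 → ℂ} (hχ : IsTest χ) : IsTest fun ξ => (starRingEnd ℂ) (χ ξ) := by
  have hsub : tsupport (fun ξ => (starRingEnd ℂ) (χ ξ)) ⊆ tsupport χ :=
    tsupport_comp_subset (map_zero (starRingEnd ℂ)) χ
  exact ⟨Complex.conjCLE.contDiff.comp hχ.contDiff,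
    hχ.hasCompactSupport.comp_left (map_zero _), fun h => hχ.zero_notMem (hsub h)⟩

theorem IsTest.memLp {χ : Eucl 4 → ℂ} (hχ : IsTest χ) : MemLp χ 2 volume :=
  hχ.contDiff.continuous.memLp_of_hasCompactSupport hχ.hasCompactSupport

/-- A test function as a Schwartz function. -/
def IsTest.toSchwartz {χ : Eucl 4 → ℂ} (hχ : IsTest χ) : 𝓢(Eucl 4, ℂ) :=
  hχ.hasCompactSupport.toSchwartzMap hχ.contDiff

theorem IsTest.toSchwartz_apply {χ : Eucl 4 → ℂ} (hχ : IsTest χ) (ξ : Eucl 4) :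
    hχ.toSchwartz ξ = χ ξ := rfl

/-- Test functions avoiding the origin determine f off a point, which is a null set. -/
theorem ae_eq_of_forall_isTest {f g : Eucl 4 → ℂ} (hf : MemLp f 2 volume) (hg : MemLp g 2 volume)
    (h : ∀ χ, IsTest χ → ∫ ξ, χ ξ * f ξ = ∫ ξ, χ ξ * g ξ) : f =ᵐ[volume] g := by
  have hU : IsOpen ({0}ᶜ : Set (Eucl 4)) := isOpen_compl_singleton
  have hsub : MemLp (fun ξ => f ξ - g ξ) 2 volume := hf.sub hg
  have key := hU.ae_eq_zero_of_integral_contDiff_smul_eq_zero (f := fun ξ => f ξ - g ξ) (μ := volume)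
    ((hsub.locallyIntegrable one_le_two).locallyIntegrableOn _) ?_
  · filter_upwards [key, ae_ne_zero_volume] with ξ h1 h2
    exact sub_eq_zero.1 (h1 h2)
  · intro χ hχ hc hs
    have hs' : tsupport (fun ξ => ((χ ξ : ℝ) : ℂ)) ⊆ tsupport χ :=
      tsupport_comp_subset Complex.ofReal_zero χ
    have ht : IsTest fun ξ => ((χ ξ : ℝ) : ℂ) := ⟨Complex.ofRealCLM.contDiff.comp hχ,
      hc.comp_left Complex.ofReal_zero, fun h0 => hs (hs' h0) rfl⟩
    have h1 := h _ ht
    have hi : ∀ {f : Eucl 4 → ℂ}, MemLp f 2 volume → Integrable fun ξ => ((χ ξ : ℝ) : ℂ) * f ξ :=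
      fun hf => ht.memLp.integrable_mul hf
    rw [← sub_eq_zero, ← integral_sub (hi hf) (hi hg)] at h1
    rw [← h1]
    refine integral_congr_ae (ae_of_all _ fun ξ => ?_)
    simp only [Complex.real_smul, mul_sub]

/-! ### Evolution equations in Fourier space -/

theorem norm_exp_I_mul_sub_one_sub_le (y : ℝ) :
    ‖Complex.exp (Complex.I * y) - 1 - Complex.I * y‖ ≤ 2 * y ^ 2 := by
  have hn : ‖Complex.I * (y : ℂ)‖ = |y| := by simp
  rcases le_total |y| 1 with h | h
  · refine (Complex.norm_exp_sub_one_sub_id_le (by rwa [hn])).trans ?_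
    rw [hn, sq_abs]
    linarith [sq_nonneg y]
  · have h1 : ‖Complex.exp (Complex.I * y) - 1‖ ≤ |y| := by
      simpa using Real.norm_exp_I_mul_ofReal_sub_one_le (x := y)
    calc _ ≤ ‖Complex.exp (Complex.I * y) - 1‖ + ‖Complex.I * (y : ℂ)‖ := norm_sub_le _ _
      _ ≤ |y| + |y| := add_le_add h1 hn.le
      _ ≤ 2 * y ^ 2 := by rw [← sq_abs y]; nlinarith

section Evolution

variable {φ : ℝ → ℝ}

theorem contDiffOn_phase (hφ : ContDiffOn ℝ (⊤ : ℕ∞) φ (Set.Ioi 0)) (σ t : ℝ) :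
    ContDiffOn ℝ (⊤ : ℕ∞) (fun ρ => Complex.exp (-(Complex.I * (σ * t * φ ρ)))) (Set.Ioi 0) := by
  have h1 : ContDiffOn ℝ (⊤ : ℕ∞) (fun ρ => ((φ ρ : ℝ) : ℂ)) (Set.Ioi 0) :=
    Complex.ofRealCLM.contDiff.comp_contDiffOn hφ
  exact Complex.contDiff_exp.comp_contDiffOn ((contDiffOn_const.mul (contDiffOn_const.mul h1)).neg)

theorem contDiffOn_symbol (hφ : ContDiffOn ℝ (⊤ : ℕ∞) φ (Set.Ioi 0)) (σ : ℝ) :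
    ContDiffOn ℝ (⊤ : ℕ∞) (fun ρ => -(Complex.I * (σ * φ ρ))) (Set.Ioi 0) := by
  have h1 : ContDiffOn ℝ (⊤ : ℕ∞) (fun ρ => ((φ ρ : ℝ) : ℂ)) (Set.Ioi 0) :=
    Complex.ofRealCLM.contDiff.comp_contDiffOn hφ
  exact (contDiffOn_const.mul (contDiffOn_const.mul h1)).neg

/-- The free evolution of a test function is differentiable in `L²`. -/
theorem hasDerivAt_evolution (hφ : ContDiffOn ℝ (⊤ : ℕ∞) φ (Set.Ioi 0)) (σ : ℝ)
    {χ : Eucl 4 → ℂ} (hχ : IsTest χ) (t : ℝ) :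
    HasDerivAt (fun t => (hχ.mul_radial (contDiffOn_phase hφ σ t)).memLp.toLp)
      ((hχ.mul_radial (contDiffOn_phase hφ σ t)).mul_radial (contDiffOn_symbol hφ σ)).memLp.toLp t := by
  -- Taylor's remainder is at most 2(s-t)² times the modulus of this fixed function, which yields
  -- differentiability in norm.
  have hq : IsTest fun ξ => (-(Complex.I * (σ * φ ‖ξ‖))) * ((-(Complex.I * (σ * φ ‖ξ‖))) * χ ξ) :=
    (hχ.mul_radial (contDiffOn_symbol hφ σ)).mul_radial (contDiffOn_symbol hφ σ)
  rw [hasDerivAt_iff_isLittleO]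
  refine (Asymptotics.IsBigO.of_bound (2 * ‖hq.memLp.toLp‖) (g := fun s => (s - t) ^ 2)
    (Eventually.of_forall fun s => ?_)).trans_isLittleO ?_
  · rw [Real.norm_of_nonneg (sq_nonneg (s - t))]
    have : ‖(hχ.mul_radial (contDiffOn_phase hφ σ s)).memLp.toLp -
        (hχ.mul_radial (contDiffOn_phase hφ σ t)).memLp.toLp - (s - t) •
        ((hχ.mul_radial (contDiffOn_phase hφ σ t)).mul_radial (contDiffOn_symbol hφ σ)).memLp.toLp‖ ≤
        (2 * (s - t) ^ 2) * ‖hq.memLp.toLp‖ := by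
      refine Lp.norm_le_mul_norm_of_ae_le_mul ?_
      filter_upwards [Lp.coeFn_sub ((hχ.mul_radial (contDiffOn_phase hφ σ s)).memLp.toLp -
          (hχ.mul_radial (contDiffOn_phase hφ σ t)).memLp.toLp) ((s - t) •
          ((hχ.mul_radial (contDiffOn_phase hφ σ t)).mul_radial (contDiffOn_symbol hφ σ)).memLp.toLp),
        Lp.coeFn_sub (hχ.mul_radial (contDiffOn_phase hφ σ s)).memLp.toLp
          (hχ.mul_radial (contDiffOn_phase hφ σ t)).memLp.toLp,
        Lp.coeFn_smul (s - t)
          ((hχ.mul_radial (contDiffOn_phase hφ σ t)).mul_radial (contDiffOn_symbol hφ σ)).memLp.toLp,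
        (hχ.mul_radial (contDiffOn_phase hφ σ s)).memLp.coeFn_toLp,
        (hχ.mul_radial (contDiffOn_phase hφ σ t)).memLp.coeFn_toLp,
        ((hχ.mul_radial (contDiffOn_phase hφ σ t)).mul_radial
          (contDiffOn_symbol hφ σ)).memLp.coeFn_toLp, hq.memLp.coeFn_toLp] with ξ h1 h2 h3 h4 h5 h6 h7
      rw [h1, Pi.sub_apply, h2, Pi.sub_apply, h3, Pi.smul_apply, h4, h5, h6, h7]
      have e : Complex.exp (-(Complex.I * (σ * s * φ ‖ξ‖))) * χ ξ -
          Complex.exp (-(Complex.I * (σ * t * φ ‖ξ‖))) * χ ξ -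
          (s - t) • (-(Complex.I * (σ * φ ‖ξ‖)) * (Complex.exp (-(Complex.I * (σ * t * φ ‖ξ‖))) * χ ξ)) =
          (Complex.exp (-(Complex.I * (σ * t * φ ‖ξ‖))) * χ ξ) *
          (Complex.exp (Complex.I * ((-(σ * (s - t) * φ ‖ξ‖) : ℝ) : ℂ)) - 1 -
            Complex.I * ((-(σ * (s - t) * φ ‖ξ‖) : ℝ) : ℂ)) := by
        have : Complex.exp (-(Complex.I * (σ * s * φ ‖ξ‖))) =
            Complex.exp (-(Complex.I * (σ * t * φ ‖ξ‖))) *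
              Complex.exp (Complex.I * ((-(σ * (s - t) * φ ‖ξ‖) : ℝ) : ℂ)) := by
          rw [← Complex.exp_add]
          congr 1
          push_cast
          ring
        rw [this, Complex.real_smul]
        push_cast
        ring
      have hexp : ‖Complex.exp (-(Complex.I * (σ * t * φ ‖ξ‖)))‖ = 1 := by
        rw [Complex.norm_exp]
        simp
      rw [e, norm_mul, norm_mul, hexp, one_mul]
      calc _ ≤ ‖χ ξ‖ * (2 * (-(σ * (s - t) * φ ‖ξ‖)) ^ 2) := by
            gcongr
            exact norm_exp_I_mul_sub_one_sub_le _
        _ = _ := by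
            simp only [norm_mul, norm_neg, Complex.norm_I, Complex.norm_real, Real.norm_eq_abs]
            rw [← sq_abs (-(σ * (s - t) * φ ‖ξ‖)), abs_neg, abs_mul, abs_mul, ← sq_abs (s - t)]
            ring
    exact this.trans (le_of_eq (by ring))
  · have := (Asymptotics.isLittleO_pow_sub_sub t one_lt_two)
    simpa using this

/-- A weak solution of `∂ₜz = -iσφ(|ξ|)z` that is continuous in `L²` is the free evolution. -/
theorem evolution_eq (hφ : ContDiffOn ℝ (⊤ : ℕ∞) φ (Set.Ioi 0)) (hφc : Continuous φ) (σ : ℝ)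
    {z : ℝ → L2 4} (hz : Continuous z)
    (h : ∀ χ, IsTest χ → ∀ t, HasDerivAt (fun s => ∫ ξ, χ ξ * z s ξ)
      (∫ ξ, χ ξ * (-(Complex.I * (σ * φ ‖ξ‖)) * z t ξ)) t) (t : ℝ) :
    z t =ᵐ[volume] fun ξ => Complex.exp (-(Complex.I * (σ * t * φ ‖ξ‖))) * z 0 ξ := by
  -- Pairing z(t) with the free evolution of χ gives a constant, since the two time derivatives
  -- cancel.
  have hconst : ∀ χ (hχ : IsTest χ) (t : ℝ),
      inner ℂ (hχ.mul_radial (contDiffOn_phase hφ σ t)).memLp.toLp (z t) =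
        inner ℂ (hχ.mul_radial (contDiffOn_phase hφ σ 0)).memLp.toLp (z 0) := by
    intro χ hχ
    set G : ℝ → L2 4 := fun t => (hχ.mul_radial (contDiffOn_phase hφ σ t)).memLp.toLp with hG
    have hd : ∀ t, HasDerivAt (fun s => inner ℂ (G s) (z s)) 0 t := by
      intro t
      have hGt : HasDerivAt G _ t := hasDerivAt_evolution hφ σ hχ t
      set G' : L2 4 := ((hχ.mul_radial (contDiffOn_phase hφ σ t)).mul_radial
        (contDiffOn_symbol hφ σ)).memLp.toLp with hG'
      have hw : HasDerivAt (fun s => inner ℂ (G t) (z s)) (-inner ℂ G' (z t)) t := by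
        have h1 := h _ (hχ.mul_radial (contDiffOn_phase hφ σ t)).conj t
        have e1 : (fun s => inner ℂ (G t) (z s)) = fun s => ∫ ξ, (starRingEnd ℂ)
            (Complex.exp (-(Complex.I * (σ * t * φ ‖ξ‖))) * χ ξ) * z s ξ := by
          funext s
          rw [L2.inner_def]
          refine integral_congr_ae ?_
          filter_upwards [(hχ.mul_radial (contDiffOn_phase hφ σ t)).memLp.coeFn_toLp] with ξ hξ
          rw [hG, hξ, RCLike.inner_apply, mul_comm]
        rw [e1]
        refine h1.congr_deriv ?_
        rw [L2.inner_def, ← integral_neg]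
        refine integral_congr_ae ?_
        filter_upwards [((hχ.mul_radial (contDiffOn_phase hφ σ t)).mul_radial
          (contDiffOn_symbol hφ σ)).memLp.coeFn_toLp] with ξ hξ
        rw [hG', hξ, RCLike.inner_apply]
        simp only [map_mul, map_neg, Complex.conj_I, Complex.conj_ofReal]
        ring
      -- The usual product rule is unavailable because z is differentiable only weakly. The slope
      -- splits into ⟨slope of G, z(s)⟩ + ⟨G(t), slope of z⟩: norm differentiability of G with
      -- continuity of z handles the first term, the weak equation the second.
      rw [hasDerivAt_iff_tendsto_slope] at hGt hw ⊢
      have hz' : Tendsto z (𝓝[≠] t) (𝓝 (z t)) := (hz.tendsto t).mono_left nhdsWithin_le_nhds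
      have h2 := (hGt.inner (𝕜 := ℂ) hz').add hw
      rw [add_neg_cancel] at h2
      refine h2.congr fun s => ?_
      simp only [slope, vsub_eq_sub]
      rw [inner_smul_left_eq_star_smul, conj_trivial, ← smul_add, inner_sub_left,
        sub_add_sub_cancel]
    intro t
    have hdiff : Differentiable ℝ fun s => inner ℂ (G s) (z s) := fun t => (hd t).differentiableAt
    exact is_const_of_deriv_eq_zero hdiff (fun t => (hd t).deriv) t 0
  have hmem : MemLp (fun ξ => Complex.exp (Complex.I * (σ * t * φ ‖ξ‖)) * z t ξ) 2 volume := by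
    refine (Lp.memLp (z t)).congr_norm (AEStronglyMeasurable.mul
      (Continuous.aestronglyMeasurable (by fun_prop)) (Lp.aestronglyMeasurable _))
      (ae_of_all _ fun ξ => ?_)
    rw [norm_mul, Complex.norm_exp]
    simp
  have key : (fun ξ => Complex.exp (Complex.I * (σ * t * φ ‖ξ‖)) * z t ξ) =ᵐ[volume] z 0 := by
    refine ae_eq_of_forall_isTest hmem (Lp.memLp _) fun χ hχ => ?_
    have h1 := hconst _ hχ.conj t
    rw [L2.inner_def, L2.inner_def] at h1
    refine (integral_congr_ae ?_).trans (h1.trans (integral_congr_ae ?_))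
    · filter_upwards [(hχ.conj.mul_radial (contDiffOn_phase hφ σ t)).memLp.coeFn_toLp] with ξ hξ
      rw [hξ, RCLike.inner_apply, map_mul, Complex.conj_conj, ← Complex.exp_conj]
      simp only [map_mul, map_neg, Complex.conj_I, Complex.conj_ofReal, neg_mul, neg_neg]
      ring
    · filter_upwards [(hχ.conj.mul_radial (contDiffOn_phase hφ σ 0)).memLp.coeFn_toLp] with ξ hξ
      rw [hξ, RCLike.inner_apply, map_mul, Complex.conj_conj]
      simp [mul_comm]
  filter_upwards [key] with ξ hξ
  rw [← hξ, ← mul_assoc, ← Complex.exp_add, neg_add_cancel, Complex.exp_zero, one_mul]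

end Evolution


/-! ### Second-order equations as pairs of half-waves -/

section Oscillator

theorem integrable_test_mul {χ : Eucl 4 → ℂ} (hχ : IsTest χ) (f : L2 4) :
    Integrable fun ξ => χ ξ * f ξ := hχ.memLp.integrable_mul (Lp.memLp f)

theorem integral_test_mul_add_smul {χ : Eucl 4 → ℂ} (hχ : IsTest χ) (f g : L2 4) (c : ℂ) :
    ∫ ξ, χ ξ * (f + c • g : L2 4) ξ = (∫ ξ, χ ξ * f ξ) + c * ∫ ξ, χ ξ * g ξ := by
  rw [← integral_const_mul, ← integral_add (integrable_test_mul hχ f)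
    ((integrable_test_mul hχ g).const_mul c)]
  refine integral_congr_ae ?_
  filter_upwards [Lp.coeFn_add f (c • g), Lp.coeFn_smul c g] with ξ h1 h2
  rw [h1, Pi.add_apply, h2, Pi.smul_apply, smul_eq_mul]
  ring

variable {φ : ℝ → ℝ}

/-- Weak solutions of `∂ₜY₁ = φY₂`, `∂ₜY₂ = -φY₁` are superpositions of two half-waves. -/
theorem oscillator_eq (hφ : ContDiffOn ℝ (⊤ : ℕ∞) φ (Set.Ioi 0)) (hφc : Continuous φ)
    {Y Z : ℝ → L2 4} (hY : Continuous Y) (hZ : Continuous Z)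
    (h1 : ∀ χ, IsTest χ → ∀ t, HasDerivAt (fun s => ∫ ξ, χ ξ * Y s ξ)
      (∫ ξ, (((φ ‖ξ‖ : ℝ) : ℂ) * χ ξ) * Z t ξ) t)
    (h2 : ∀ χ, IsTest χ → ∀ t, HasDerivAt (fun s => ∫ ξ, χ ξ * Z s ξ)
      (-∫ ξ, (((φ ‖ξ‖ : ℝ) : ℂ) * χ ξ) * Y t ξ) t) (t : ℝ) :
    Y t =ᵐ[volume] fun ξ => ∑ s, Complex.exp (-(Complex.I * (sgn s * t * φ ‖ξ‖))) *
      (2⁻¹ * (Y 0 ξ + (sgn s * Complex.I) * Z 0 ξ)) := by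
  -- The combinations Y ± iZ diagonalise the system: each solves ∂ₜz = ∓iφz.
  have key : ∀ s : Bool, (Y t + ((sgn s : ℂ) * Complex.I) • Z t : L2 4) =ᵐ[volume] fun ξ =>
      Complex.exp (-(Complex.I * (sgn s * t * φ ‖ξ‖))) *
        (Y 0 + ((sgn s : ℂ) * Complex.I) • Z 0 : L2 4) ξ := by
    intro s
    refine evolution_eq hφ hφc (sgn s) (z := fun t => Y t + ((sgn s : ℂ) * Complex.I) • Z t)
      (hY.add ((continuous_const_smul _).comp hZ)) (fun χ hχ t => ?_) t
    have hφχ : IsTest fun ξ => ((φ ‖ξ‖ : ℝ) : ℂ) * χ ξ :=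
      hχ.mul_radial (a := fun ρ => ((φ ρ : ℝ) : ℂ)) (Complex.ofRealCLM.contDiff.comp_contDiffOn hφ)
    simp only [integral_test_mul_add_smul hχ]
    refine ((h1 χ hχ t).add ((h2 χ hχ t).const_mul ((sgn s : ℂ) * Complex.I))).congr_deriv ?_
    have e : ∫ ξ, χ ξ * (-(Complex.I * (sgn s * φ ‖ξ‖)) *
        (Y t + ((sgn s : ℂ) * Complex.I) • Z t : L2 4) ξ) =
        -(Complex.I * sgn s) * ∫ ξ, (((φ ‖ξ‖ : ℝ) : ℂ) * χ ξ) *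
          (Y t + ((sgn s : ℂ) * Complex.I) • Z t : L2 4) ξ := by
      rw [← integral_const_mul]
      refine integral_congr_ae (ae_of_all _ fun ξ => ?_)
      simp only
      ring
    rw [e, integral_test_mul_add_smul hφχ]
    have hs : ((sgn s : ℝ) : ℂ) * ((sgn s : ℝ) : ℂ) = 1 := by
      exact_mod_cast congrArg (fun x : ℝ => (x : ℂ)) (sgn_mul_self s)
    linear_combination (-(∫ ξ, (((φ ‖ξ‖ : ℝ) : ℂ) * χ ξ) * Z t ξ)) * hs +
      ((sgn s : ℂ) * (sgn s : ℂ) * ∫ ξ, (((φ ‖ξ‖ : ℝ) : ℂ) * χ ξ) * Z t ξ) * Complex.I_sq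
  have hc : ∀ (t : ℝ) (s : Bool), (Y t + ((sgn s : ℂ) * Complex.I) • Z t : L2 4) =ᵐ[volume]
      fun ξ => Y t ξ + (sgn s * Complex.I) * Z t ξ := by
    intro t s
    filter_upwards [Lp.coeFn_add (Y t) (((sgn s : ℂ) * Complex.I) • Z t),
      Lp.coeFn_smul ((sgn s : ℂ) * Complex.I) (Z t)] with ξ h1 h2
    rw [h1, Pi.add_apply, h2, Pi.smul_apply, smul_eq_mul]
  filter_upwards [key true, key false, hc t true, hc t false, hc 0 true, hc 0 false]
    with ξ k1 k2 a1 a2 b1 b2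
  rw [a1, b1] at k1
  rw [a2, b2] at k2
  rw [Fintype.sum_bool]
  have e : ∀ (E A : ℂ), E * (2⁻¹ * A) = 2⁻¹ * (E * A) := fun E A => by ring
  rw [e, e, ← k1, ← k2]
  simp only [sgn, if_true, Bool.false_eq_true, if_false]
  push_cast
  ring

/-- The two half-wave data of a pair of initial data. -/
def halfData (A B : L2 4) : DataSpace :=
  WithLp.toLp 2 fun s => (2⁻¹ : ℂ) • (A + ((sgn s : ℂ) * Complex.I) • B)

theorem halfData_apply (A B : L2 4) (s : Bool) : halfData A B s =ᵐ[volume] fun ξ =>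
    2⁻¹ * (A ξ + (sgn s * Complex.I) * B ξ) := by
  filter_upwards [Lp.coeFn_smul (2⁻¹ : ℂ) (A + ((sgn s : ℂ) * Complex.I) • B),
    Lp.coeFn_add A (((sgn s : ℂ) * Complex.I) • B), Lp.coeFn_smul ((sgn s : ℂ) * Complex.I) B]
    with ξ h1 h2 h3
  simp only [halfData]
  rw [h1, Pi.smul_apply, h2, Pi.add_apply, h3, Pi.smul_apply, smul_eq_mul, smul_eq_mul]

/-- The parallelogram law for A and iB. Its factor 2 is the one on the left of the wave and
Klein–Gordon identities. -/
theorem norm_halfData (A B : L2 4) : 2 * ‖halfData A B‖ ^ 2 = ‖A‖ ^ 2 + ‖B‖ ^ 2 := by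
  have h := parallelogram_law_with_norm ℂ A (Complex.I • B)
  rw [PiLp.norm_sq_eq_of_L2, Fintype.sum_bool]
  simp only [halfData, norm_smul, sgn, if_true, Bool.false_eq_true, if_false, norm_inv,
    RCLike.norm_ofNat]
  push_cast
  rw [one_mul, neg_one_mul, neg_smul, ← sub_eq_add_neg]
  rw [norm_smul, Complex.norm_I, one_mul] at h
  nlinarith

theorem enorm_halfData (A B : L2 4) : 2 * ‖halfData A B‖ₑ ^ 2 = ‖A‖ₑ ^ 2 + ‖B‖ₑ ^ 2 := by
  rw [← ofReal_norm, ← ofReal_norm, ← ofReal_norm, ← ENNReal.ofReal_pow (norm_nonneg _),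
    ← ENNReal.ofReal_pow (norm_nonneg _), ← ENNReal.ofReal_pow (norm_nonneg _),
    ← ENNReal.ofReal_add (by positivity) (by positivity), ← norm_halfData,
    ENNReal.ofReal_mul (by norm_num), ENNReal.ofReal_ofNat]

end Oscillator

/-! ### From functions to distributions -/

/-- Since 1/(1+|x|²) ≤ 1/|x|², the function w/(1+|x|²)^{1/2} is in L². Multiplying it back by a
function of temperate growth gives a tempered distribution. -/
theorem exists_represents_of_memLp_weight {w : Eucl 4 → ℂ} (hw : MemLp w 2 weightMeasure) :
    ∃ T : Distr 4, Represents T w := by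
  set q : Eucl 4 → ℂ := fun x => (((1 + ‖x‖ ^ 2) ^ (1 / 2 : ℝ) : ℝ) : ℂ) with hq
  have hqt : q.HasTemperateGrowth := Complex.ofRealCLM.hasTemperateGrowth.comp
    (Function.hasTemperateGrowth_one_add_norm_sq_rpow (Eucl 4) (1 / 2))
  have hqpos : ∀ x : Eucl 4, 0 < (1 + ‖x‖ ^ 2) ^ (1 / 2 : ℝ) := fun x => by positivity
  have hq0 : ∀ x, q x ≠ 0 := fun x => Complex.ofReal_ne_zero.2 (hqpos x).ne'
  have hwm : AEStronglyMeasurable w volume := hw.1.mono_ac ac_weightMeasure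
  have hqc : Continuous q := hqt.1.continuous
  have hmem : MemLp (fun x => (q x)⁻¹ * w x) 2 volume := by
    have hm : AEStronglyMeasurable (fun x => (q x)⁻¹ * w x) volume :=
      (hqc.inv₀ hq0).aestronglyMeasurable.mul hwm
    rw [memLp_two_iff_lintegral hm]
    refine lt_of_le_of_lt ?_ ((memLp_two_iff_lintegral hw.1).1 hw)
    rw [lintegral_weightMeasure (hwm.enorm.pow_const 2)]
    refine lintegral_mono_ae ?_
    filter_upwards [ae_ne_zero_volume] with x hx
    have hx' : 0 < ‖x‖ := norm_pos_iff.2 hx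
    rw [← ofReal_norm, ← ofReal_norm, ← ofReal_norm, ← ENNReal.ofReal_pow (by positivity),
      ← ENNReal.ofReal_pow (by positivity), ← ENNReal.ofReal_pow (by positivity),
      ← ENNReal.ofReal_div_of_pos (by positivity)]
    refine ENNReal.ofReal_le_ofReal ?_
    have e : ((1 + ‖x‖ ^ 2) ^ (1 / 2 : ℝ)) ^ 2 = 1 + ‖x‖ ^ 2 := by
      rw [← Real.rpow_natCast, ← Real.rpow_mul (by positivity)]
      norm_num
    rw [norm_mul, norm_inv, hq, Complex.norm_real, Real.norm_of_nonneg (hqpos x).le, mul_pow, inv_pow,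
      e, div_eq_inv_mul (‖w x‖ ^ 2)]
    gcongr
    linarith
  refine ⟨TemperedDistribution.smulLeftCLM ℂ q (hmem.toLp : Distr 4), fun ψ => ?_⟩
  refine ⟨integrable_schwartz_mul ψ hw, ?_⟩
  rw [TemperedDistribution.smulLeftCLM_apply_apply, Lp.toTemperedDistribution_apply]
  refine integral_congr_ae ?_
  filter_upwards [hmem.coeFn_toLp] with x hx
  rw [hx, SchwartzMap.smulLeftCLM_apply_apply hqt, smul_eq_mul, smul_eq_mul]
  field_simp [hq0 x]

theorem apply_eq_integral_fourierInv {T : Distr 4} {w : Eucl 4 → ℂ} (h : Represents (𝓕 T) w)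
    (ψ : 𝓢(Eucl 4, ℂ)) : T ψ = ∫ ξ, (𝓕⁻ ψ : 𝓢(Eucl 4, ℂ)) ξ * w ξ := by
  rw [← (h (𝓕⁻ ψ)).2, TemperedDistribution.fourier_apply, FourierTransform.fourier_fourierInv_eq]

/-! ### From half-wave data on the Fourier side to the angular power of a solution -/

section Cases

variable {D : Dispersion}

/-- Identifies the limit v with the solution at time t: both have the same pairing with ψ once
written through its inverse Fourier transform. -/
theorem represents_of_fourier (hD : TemperateAmp D) (m : Multiplier) (f : DataSpace) (t : ℝ)
    {T : Distr 4} {w v : Eucl 4 → ℂ} (hw : Represents (𝓕 T) w)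
    (hwf : w =ᵐ[volume] fun ξ => ∑ s, ampPhase D s t ‖ξ‖ * (((m.a ‖ξ‖ : ℝ) : ℂ) * f s ξ))
    (hv : MemLp v 2 weightMeasure)
    (hvf : ∀ ψ : 𝓢(Eucl 4, ℂ), ∫ x, ψ x * v x =
      ∑ s, ∫ ξ, (𝓕⁻ ψ : 𝓢(Eucl 4, ℂ)) ξ * ampPhase D s t ‖ξ‖ * (((m.a ‖ξ‖ : ℝ) : ℂ) * f s ξ)) :
    Represents T v := by
  refine fun ψ => ⟨integrable_schwartz_mul ψ hv, ?_⟩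
  rw [apply_eq_integral_fourierInv hw, hvf]
  have hInt : ∀ s ∈ (Finset.univ : Finset Bool), Integrable fun ξ => (𝓕⁻ ψ : 𝓢(Eucl 4, ℂ)) ξ *
      ampPhase D s t ‖ξ‖ * (((m.a ‖ξ‖ : ℝ) : ℂ) * f s ξ) := by
    intro s _
    refine (hD.memLp (𝓕⁻ ψ) s t).integrable_mul (MemLp.mono (Lp.memLp (f s)) ?_
      (ae_of_all _ fun ξ => ?_))
    · exact (Complex.measurable_ofReal.comp
        (m.measurable.comp measurable_norm)).aestronglyMeasurable.mul (Lp.aestronglyMeasurable _)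
    · rw [norm_mul, Complex.norm_real]
      exact mul_le_of_le_one_left (norm_nonneg _) (m.abs_le_one _)
  rw [← integral_finsetSum _ hInt]
  refine integral_congr_ae ?_
  filter_upwards [hwf] with ξ hξ
  rw [hξ, Finset.mul_sum]
  simp only [mul_assoc]

/-- The multiplier `1`. -/
def Multiplier.one : Multiplier := ⟨fun _ => 1, measurable_const, continuousOn_const, by simp⟩

theorem exists_isAngularPowerOf (hD : TemperateAmp D) (f : DataSpace) {u : ℝ → Distr 4}
    {w : ℝ → Eucl 4 → ℂ} (hw : ∀ t, Represents (𝓕 (u t)) (w t))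
    (hwf : ∀ t, w t =ᵐ[volume] fun ξ => ∑ s, ampPhase D s t ‖ξ‖ * f s ξ) :
    ∃ g, IsAngularPowerOf (1 / 4) u g ∧
      weightedIntegral g = ENNReal.ofReal Real.pi * ‖f‖ₑ ^ 2 := by
  obtain ⟨v, S, g, hgm, hgi, h⟩ := exists_smoothing hD Multiplier.one f
  refine ⟨g, ⟨hgm.aestronglyMeasurable, ?_⟩, hgi⟩
  filter_upwards [h] with t ⟨hv, hS, hg, hang, hpair, hSg⟩
  obtain ⟨T, hT⟩ := exists_represents_of_memLp_weight hS
  refine ⟨T, ⟨v t, S t, represents_of_fourier hD Multiplier.one f t (hw t) ?_ hv hpair, hT, hang⟩,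
    fun ψ => ⟨integrable_schwartz_mul ψ hg, ?_⟩⟩
  · simpa [Multiplier.one] using hwf t
  · rw [(hT ψ).2]
    exact (hSg ψ ψ fun ξ => by simp [Multiplier.one]).symm

theorem exists_isLaplacianAngularPowerOf (hD : TemperateAmp D) (m : Multiplier) {κ : ℝ}
    (hm : ∀ ξ : Eucl 4, m.a ‖ξ‖ * inhomSymbol 4 κ ξ = 1) (f : DataSpace) {u : ℝ → Distr 4}
    {w : ℝ → Eucl 4 → ℂ} (hw : ∀ t, Represents (𝓕 (u t)) (w t))
    (hwf : ∀ t, w t =ᵐ[volume] fun ξ => ∑ s, ampPhase D s t ‖ξ‖ * (((m.a ‖ξ‖ : ℝ) : ℂ) * f s ξ)) :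
    ∃ g, IsLaplacianAngularPowerOf κ (1 / 4) u g ∧
      weightedIntegral g = ENNReal.ofReal Real.pi * ‖f‖ₑ ^ 2 := by
  obtain ⟨v, S, g, hgm, hgi, h⟩ := exists_smoothing hD m f
  refine ⟨g, ⟨hgm.aestronglyMeasurable, ?_⟩, hgi⟩
  filter_upwards [h] with t ⟨hv, hS, hg, hang, hpair, hSg⟩
  obtain ⟨T, hT⟩ := exists_represents_of_memLp_weight hS
  refine ⟨T, ⟨v t, S t, represents_of_fourier hD m f t (hw t) (hwf t) hv hpair, hT, hang⟩,
    fun ψ => ⟨integrable_schwartz_mul ψ hg, ?_⟩⟩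
  -- By duality (1-Δ)^κ acts on ψ, and on the Fourier side m times its symbol is 1, which is the
  -- relation required between ψ and ψ'.
  rw [oneSubLaplacianPow, TemperedDistribution.fourierMultiplierCLM_apply_apply, (hT _).2]
  refine (hSg ψ _ fun ξ => ?_).symm
  rw [FourierTransform.fourierInv_fourier_eq,
    SchwartzMap.smulLeftCLM_apply_apply (inhomSymbol_hasTemperateGrowth 4 κ), smul_eq_mul,
    ← mul_assoc, ← Complex.ofReal_mul, hm, Complex.ofReal_one, one_mul]

end Cases


/-! ### The equations in Fourier space -/

theorem represents_L2 (f : L2 4) : Represents (f : Distr 4) f := fun ψ => by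
  refine ⟨?_, ?_⟩
  · exact (ψ.memLp 2).integrable_mul (Lp.memLp f)
  · rw [Lp.toTemperedDistribution_apply]
    rfl

theorem represents_fourier_L2 (f : L2 4) : Represents (𝓕 (f : Distr 4)) (𝓕 f : L2 4) := by
  rw [Lp.fourier_toTemperedDistribution_eq]
  exact represents_L2 _

theorem apply_fourier {T : Distr 4} {w : Eucl 4 → ℂ} (h : Represents (𝓕 T) w) (χ : 𝓢(Eucl 4, ℂ)) :
    T (𝓕 χ) = ∫ ξ, χ ξ * w ξ := by
  rw [← (h χ).2, TemperedDistribution.fourier_apply]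

theorem HasTimeDeriv.fourier {u u' : ℝ → Distr 4} (h : HasTimeDeriv u u') {w : ℝ → Eucl 4 → ℂ}
    (hw : ∀ t, Represents (𝓕 (u t)) (w t)) (χ : 𝓢(Eucl 4, ℂ)) (t : ℝ) :
    HasDerivAt (fun s => ∫ ξ, χ ξ * w s ξ) (u' t (𝓕 χ)) t := by
  have := h (𝓕 χ) t
  simpa only [apply_fourier (hw _)] using this

theorem laplacian_apply_fourier {T : Distr 4} {w : Eucl 4 → ℂ} (h : Represents (𝓕 T) w)
    (χ : 𝓢(Eucl 4, ℂ)) :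
    (Δ T) (𝓕 χ) = -∫ ξ, χ ξ * ((((2 * Real.pi * ‖ξ‖) ^ 2 : ℝ) : ℂ) * w ξ) := by
  have hg : (fun x : Eucl 4 => Complex.ofReal (‖x‖ ^ 2)).HasTemperateGrowth := by fun_prop
  rw [TemperedDistribution.laplacian_eq_fourierMultiplierCLM]
  change (-(2 * Real.pi) ^ 2) • (TemperedDistribution.fourierMultiplierCLM ℂ
    (fun x : Eucl 4 => Complex.ofReal (‖x‖ ^ 2)) T (𝓕 χ)) = _
  rw [TemperedDistribution.fourierMultiplierCLM_apply_apply, FourierTransform.fourierInv_fourier_eq,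
    apply_fourier h, ← integral_smul, ← integral_neg]
  refine integral_congr_ae (ae_of_all _ fun ξ => ?_)
  simp only [SchwartzMap.smulLeftCLM_apply_apply hg, Complex.real_smul, smul_eq_mul]
  push_cast
  ring

/-! ### Temperate amplitudes -/

theorem temperateAmp_of_le_one {D : Dispersion} (h : ∀ ρ, 0 < ρ → D.amp ρ ≤ 1)
    (h0 : ∀ ρ, 0 ≤ D.amp ρ) : TemperateAmp D := by
  intro ψ
  refine MemLp.mono (ψ.memLp 2) (ψ.continuous.aestronglyMeasurable.mul
    (Complex.measurable_ofReal.comp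
      (D.measurable_amp.comp measurable_norm)).aestronglyMeasurable) ?_
  filter_upwards [ae_ne_zero_volume] with ξ hξ
  rw [norm_mul, Complex.norm_real, Real.norm_of_nonneg (h0 _)]
  exact mul_le_of_le_one_right (norm_nonneg _) (h _ (norm_pos_iff.2 hξ))

theorem lintegral_inv_norm_ball : ∫⁻ x in Metric.ball (0 : Eucl 4) 1, ENNReal.ofReal ‖x‖⁻¹ < ∞ := by
  rw [← lintegral_indicator measurableSet_ball, lintegral_polar
    ((Measurable.indicator (by fun_prop) measurableSet_ball).aemeasurable), lintegral_radialMeasure]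
  have hle : ∀ r ∈ Set.Ioi (0 : ℝ), ENNReal.ofReal (r ^ 3) * ∫⁻ ω : S3,
      (Metric.ball (0 : Eucl 4) 1).indicator (fun x => ENNReal.ofReal ‖x‖⁻¹) (r • (ω : Eucl 4))
        ∂(sphereMeasure 4) ≤ (Set.Ioo (0 : ℝ) 1).indicator (fun _ => sphereMeasure 4 Set.univ) r := by
    intro r hr
    have hr' : (0 : ℝ) < r := hr
    by_cases h1 : r < 1
    · rw [Set.indicator_of_mem (show r ∈ Set.Ioo (0 : ℝ) 1 from ⟨hr, h1⟩)]
      have e : ∀ ω : S3, (Metric.ball (0 : Eucl 4) 1).indicator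
          (fun x => ENNReal.ofReal ‖x‖⁻¹) (r • (ω : Eucl 4)) = ENNReal.ofReal r⁻¹ := by
        intro ω
        rw [Set.indicator_of_mem (by simpa [norm_smul_sphere hr'] using h1), norm_smul_sphere hr']
      simp only [e, lintegral_const]
      rw [← mul_assoc, ← ENNReal.ofReal_mul (by positivity)]
      refine mul_le_of_le_one_left zero_le ?_
      rw [ENNReal.ofReal_le_one]
      have : r ^ 3 * r⁻¹ = r ^ 2 := by field_simp
      rw [this]
      exact pow_le_one₀ hr'.le h1.le
    · have e : ∀ ω : S3, (Metric.ball (0 : Eucl 4) 1).indicator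
          (fun x => ENNReal.ofReal ‖x‖⁻¹) (r • (ω : Eucl 4)) = 0 := by
        intro ω
        rw [Set.indicator_of_notMem (by simpa [norm_smul_sphere hr'] using not_lt.1 h1)]
      simp [e]
  refine lt_of_le_of_lt (setLIntegral_mono (measurable_const.indicator measurableSet_Ioo) hle) ?_
  refine (setLIntegral_le_lintegral _ _).trans_lt ?_
  rw [lintegral_indicator measurableSet_Ioo, setLIntegral_const]
  exact ENNReal.mul_lt_top (measure_lt_top _ _) (by simp)

/-- |ξ|⁻¹ is integrable near 0 in ℝ⁴ and at most 1 off the unit ball. -/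
theorem temperateAmp_of_sq_le {D : Dispersion} (h : ∀ ρ, 0 < ρ → D.amp ρ ^ 2 ≤ ρ⁻¹) :
    TemperateAmp D := by
  intro ψ
  have hm : AEStronglyMeasurable (fun ξ : Eucl 4 => ψ ξ * ((D.amp ‖ξ‖ : ℝ) : ℂ)) volume :=
    ψ.continuous.aestronglyMeasurable.mul (Complex.measurable_ofReal.comp
      (D.measurable_amp.comp measurable_norm)).aestronglyMeasurable
  rw [memLp_two_iff_lintegral hm]
  obtain ⟨C, hC⟩ : ∃ C, ∀ x, ‖ψ x‖ ≤ C := ⟨_, ψ.norm_le_seminorm ℝ⟩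
  have hle : ∀ᵐ ξ : Eucl 4, ‖ψ ξ * ((D.amp ‖ξ‖ : ℝ) : ℂ)‖ₑ ^ 2 ≤
      ENNReal.ofReal (C ^ 2) * (Metric.ball (0 : Eucl 4) 1).indicator
        (fun x => ENNReal.ofReal ‖x‖⁻¹) ξ + ‖ψ ξ‖ₑ ^ 2 := by
    filter_upwards [ae_ne_zero_volume] with ξ hξ
    have hξ' := norm_pos_iff.2 hξ
    have h1 : ‖ψ ξ * ((D.amp ‖ξ‖ : ℝ) : ℂ)‖ ^ 2 ≤ ‖ψ ξ‖ ^ 2 * ‖ξ‖⁻¹ := by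
      rw [norm_mul, mul_pow, Complex.norm_real, Real.norm_eq_abs, sq_abs]
      gcongr
      exact h _ hξ'
    rw [← ofReal_norm, ← ENNReal.ofReal_pow (norm_nonneg _)]
    by_cases hb : ‖ξ‖ < 1
    · rw [Set.indicator_of_mem (by simpa using hb), ← ENNReal.ofReal_mul (by positivity)]
      refine le_add_of_le_of_nonneg (ENNReal.ofReal_le_ofReal (h1.trans ?_)) zero_le
      gcongr
      exact hC ξ
    · rw [Set.indicator_of_notMem (by simpa using not_lt.1 hb), mul_zero, zero_add, ← ofReal_norm,
        ← ENNReal.ofReal_pow (norm_nonneg _)]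
      refine ENNReal.ofReal_le_ofReal (h1.trans ?_)
      exact mul_le_of_le_one_right (by positivity) (inv_le_one_of_one_le₀ (not_lt.1 hb))
  refine lt_of_le_of_lt (lintegral_mono_ae hle) ?_
  rw [lintegral_add_right _ (ψ.continuous.measurable.enorm.pow_const 2),
    lintegral_const_mul' _ _ ENNReal.ofReal_ne_top, lintegral_indicator measurableSet_ball]
  exact ENNReal.add_lt_top.2 ⟨ENNReal.mul_lt_top ENNReal.ofReal_lt_top lintegral_inv_norm_ball,
    (memLp_two_iff_lintegral ψ.continuous.aestronglyMeasurable).1 (ψ.memLp 2)⟩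

/-! ### The Schrödinger equation -/

theorem schrodingerDispersion_amp {ρ : ℝ} (hρ : 0 < ρ) : schrodingerDispersion.amp ρ = 1 := by
  rw [Dispersion.amp]
  simp only [schrodingerDispersion]
  rw [div_self (by positivity), Real.sqrt_one]

/-- The amplitude is 1, so the half-wave datum is the Fourier transform of u(0) itself. -/
theorem exists_schrodinger {u : ℝ → L2 4} (hu : IsSchrodingerSolution u) :
    ∃ g, IsAngularPowerOf (1 / 4) (fun t => (u t : Distr 4)) g ∧
      weightedIntegral g = ENNReal.ofReal Real.pi * ‖u 0‖ₑ ^ 2 := by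
  have hD : TemperateAmp schrodingerDispersion := temperateAmp_of_le_one
    (fun ρ hρ => (schrodingerDispersion_amp hρ).le) fun ρ => Real.sqrt_nonneg _
  set w : ℝ → L2 4 := fun t => 𝓕 (u t) with hw
  have hrep : ∀ t, Represents (𝓕 (u t : Distr 4)) (w t) := fun t => represents_fourier_L2 _
  have hwc : Continuous w := (Lp.fourierTransformₗᵢ (Eucl 4) ℂ).continuous.comp hu.continuous
  have hev := evolution_eq (φ := schrodingerDispersion.φ) (σ := 1) (z := w)
    (ContDiff.contDiffOn (by simp only [schrodingerDispersion]; fun_prop))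
    schrodingerDispersion.continuous_φ hwc fun χ hχ t => by
      refine (hu.equation.fourier hrep hχ.toSchwartz t).congr_deriv ?_
      change (Complex.I / 2) • ((Δ (u t : Distr 4)) (𝓕 hχ.toSchwartz)) = _
      rw [laplacian_apply_fourier (hrep t), smul_eq_mul, mul_neg, ← integral_const_mul, ← integral_neg]
      refine integral_congr_ae (ae_of_all _ fun ξ => ?_)
      simp only [IsTest.toSchwartz_apply, schrodingerDispersion]
      push_cast
      ring
  -- A first-order equation has one half-wave only; the other datum is zero.
  set f : DataSpace := WithLp.toLp 2 fun s => if s then w 0 else 0 with hf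
  have hfn : ‖f‖ₑ = ‖u 0‖ₑ := by
    have h1 : ‖f‖ ^ 2 = ‖u 0‖ ^ 2 := by
      rw [PiLp.norm_sq_eq_of_L2, Fintype.sum_bool]
      simp [hf, hw, Lp.norm_fourier_eq]
    rw [← ofReal_norm, ← ofReal_norm, (sq_eq_sq₀ (norm_nonneg _) (norm_nonneg _)).1 h1]
  rw [← hfn]
  refine exists_isAngularPowerOf hD f hrep fun t => ?_
  filter_upwards [hev t, ae_ne_zero_volume] with ξ h1 h2
  rw [Fintype.sum_bool]
  simp only [hf, if_true, Bool.false_eq_true, if_false]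
  rw [h1, ampPhase, schrodingerDispersion_amp (norm_pos_iff.2 h2)]
  simp [sgn]


/-! ### Homogeneous Sobolev spaces -/

/-- The symbol `(2π|ξ|)^s`, as a function of `|ξ|`. -/
def homSymbol (s ρ : ℝ) : ℝ := (2 * Real.pi * ρ) ^ s

theorem measurable_homSymbol (s : ℝ) : Measurable (homSymbol s) := by
  unfold homSymbol
  fun_prop

theorem homSymbol_pos (s : ℝ) {ρ : ℝ} (hρ : 0 < ρ) : 0 < homSymbol s ρ :=
  Real.rpow_pos_of_pos (by positivity) s

theorem homSymbol_mul (s s' : ℝ) {ρ : ℝ} (hρ : 0 < ρ) :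
    homSymbol s ρ * homSymbol s' ρ = homSymbol (s + s') ρ :=
  (Real.rpow_add (by positivity) s s').symm

theorem contDiffOn_homSymbol (s : ℝ) :
    ContDiffOn ℝ (⊤ : ℕ∞) (fun ρ => ((homSymbol s ρ : ℝ) : ℂ)) (Set.Ioi 0) := by
  refine Complex.ofRealCLM.contDiff.comp_contDiffOn ?_
  intro ρ hρ
  have hρ' : (0 : ℝ) < ρ := hρ
  exact (ContDiffAt.rpow_const_of_ne (contDiffAt_const.mul contDiffAt_id)
    (by simp only [id]; positivity)).contDiffWithinAt

/-- The infimum runs over representatives that agree almost everywhere, so all its terms are equal.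
-/
theorem homSobolevSq_eq {s : ℝ} {T : Distr 4} {w : Eucl 4 → ℂ} (h : Represents (𝓕 T) w) :
    homSobolevSq s T = ∫⁻ ξ, ‖((homSymbol s ‖ξ‖ : ℝ) : ℂ) * w ξ‖ₑ ^ 2 := by
  have key : ∀ w' : Eucl 4 → ℂ, Represents (𝓕 T) w' →
      ∫⁻ ξ, ENNReal.ofReal (2 * Real.pi * ‖ξ‖) ^ (2 * s) * ‖w' ξ‖ₑ ^ 2 =
        ∫⁻ ξ, ‖((homSymbol s ‖ξ‖ : ℝ) : ℂ) * w ξ‖ₑ ^ 2 := by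
    intro w' hw'
    refine lintegral_congr_ae ?_
    filter_upwards [hw'.ae_eq h, ae_ne_zero_volume] with ξ h1 h2
    have h3 : 0 < 2 * Real.pi * ‖ξ‖ := by
      have := norm_pos_iff.2 h2
      positivity
    rw [h1, enorm_mul, mul_pow]
    congr 1
    rw [← ofReal_norm, Complex.norm_real, Real.norm_of_nonneg (homSymbol_pos s (norm_pos_iff.2 h2)).le,
      homSymbol, ← ENNReal.ofReal_rpow_of_pos h3, ← ENNReal.rpow_natCast, ← ENNReal.rpow_mul,
      mul_comm s]
    norm_num
  rw [homSobolevSq]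
  refine le_antisymm ((iInf₂_le w h).trans (key w h).le) (le_iInf₂ fun w' hw' => (key w' hw').ge)

theorem exists_represents_of_homSobolevSq {s : ℝ} {T : Distr 4} (h : homSobolevSq s T < ⊤) :
    ∃ w, Represents (𝓕 T) w := by
  by_contra hcon
  push Not at hcon
  rw [homSobolevSq] at h
  simp [hcon] at h

/-- Multiplication by (2π|ξ|)^s on the Fourier side turns the Sobolev curve isometrically into a
continuous curve in L². -/
theorem ContinuousInHomSobolev.exists_curve {s : ℝ} {u : ℝ → Distr 4}
    (h : ContinuousInHomSobolev s u) :
    ∃ (w : ℝ → Eucl 4 → ℂ) (Y : ℝ → L2 4), (∀ t, Represents (𝓕 (u t)) (w t)) ∧ Continuous Y ∧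
      (∀ t, Y t =ᵐ[volume] fun ξ => ((homSymbol s ‖ξ‖ : ℝ) : ℂ) * w t ξ) ∧
      ∀ t, homSobolevSq s (u t) = ‖Y t‖ₑ ^ 2 := by
  choose w hw using fun t => exists_represents_of_homSobolevSq (h.1 t)
  have hmem : ∀ t, MemLp (fun ξ => ((homSymbol s ‖ξ‖ : ℝ) : ℂ) * w t ξ) 2 volume := by
    intro t
    have hm : AEStronglyMeasurable (fun ξ => ((homSymbol s ‖ξ‖ : ℝ) : ℂ) * w t ξ) volume :=
      (Complex.measurable_ofReal.comp
        ((measurable_homSymbol s).comp measurable_norm)).aestronglyMeasurable.mul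
        (hw t).locallyIntegrable.aestronglyMeasurable
    rw [memLp_two_iff_lintegral hm, ← homSobolevSq_eq (hw t)]
    exact h.1 t
  refine ⟨w, fun t => (hmem t).toLp, hw, ?_, fun t => (hmem t).coeFn_toLp, fun t => ?_⟩
  · rw [continuous_iff_continuousAt]
    intro t₀
    rw [ContinuousAt, tendsto_iff_edist_tendsto_0]
    have h1 := (ENNReal.continuous_rpow_const (y := (1 / 2 : ℝ))).tendsto 0 |>.comp (h.2 t₀)
    rw [ENNReal.zero_rpow_of_pos (by norm_num)] at h1
    refine h1.congr fun t => ?_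
    have hrep : Represents (𝓕 (u t - u t₀)) fun ξ => w t ξ - w t₀ ξ := by
      intro ψ
      have h1 := hw t ψ
      have h2 := hw t₀ ψ
      have e : (fun ξ => ψ ξ * (w t ξ - w t₀ ξ)) = fun ξ => ψ ξ * w t ξ - ψ ξ * w t₀ ξ := by
        funext ξ
        ring
      rw [e]
      refine ⟨h1.1.sub h2.1, ?_⟩
      rw [integral_sub h1.1 h2.1, ← h1.2, ← h2.2]
      rfl
    have e2 : homSobolevSq s (u t - u t₀) = edist (hmem t).toLp (hmem t₀).toLp ^ 2 := by
      rw [homSobolevSq_eq hrep, Lp.edist_toLp_toLp, eLpNorm_two_sq]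
      refine lintegral_congr fun ξ => ?_
      rw [Pi.sub_apply, mul_sub]
    rw [Function.comp, e2, ← ENNReal.rpow_natCast, ← ENNReal.rpow_mul]
    norm_num
  · rw [homSobolevSq_eq (hw t), Lp.enorm_toLp, eLpNorm_two_sq]

/-! ### The wave equation -/

/-- The dispersion relation of the wave equation. -/
def waveDispersion : Dispersion where
  φ ρ := 2 * Real.pi * ρ
  φ' _ := 2 * Real.pi
  continuous_φ := by fun_prop
  continuous_φ' := by fun_prop
  pos ρ hρ := by positivity
  hasDerivAt ρ _ := ((hasDerivAt_id ρ).const_mul (2 * Real.pi)).congr_deriv (by simp)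
  deriv_pos ρ _ := by positivity

/-- The amplitude is the symbol of |∇|^{-1/2}, which is why the data are measured in Ḣ^{1/2} and
Ḣ^{-1/2}. -/
theorem waveDispersion_amp {ρ : ℝ} (hρ : 0 < ρ) :
    waveDispersion.amp ρ = homSymbol (-1 / 2) ρ := by
  have h : 2 * Real.pi / (4 * Real.pi ^ 2 * ρ) = (2 * Real.pi * ρ)⁻¹ := by
    have := Real.pi_pos
    field_simp
    ring
  rw [Dispersion.amp, homSymbol]
  simp only [waveDispersion]
  rw [h, Real.sqrt_eq_rpow, ← Real.rpow_neg_one, ← Real.rpow_mul (by positivity)]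
  norm_num

theorem temperateAmp_wave : TemperateAmp waveDispersion := by
  refine temperateAmp_of_sq_le fun ρ hρ => ?_
  rw [waveDispersion_amp hρ, sq, homSymbol_mul _ _ hρ, homSymbol]
  norm_num
  rw [Real.rpow_neg_one]
  refine inv_anti₀ hρ ?_
  nlinarith [Real.pi_gt_three]

/-- With φ = 2π|ξ|, the L² curves Y = φ^{1/2} û and Z = φ^{-1/2} ∂ₜû solve Y' = φZ, Z' = -φY, and û
= φ^{-1/2} Y has precisely the required amplitude. -/
theorem exists_wave {u u' : ℝ → Distr 4} (hu : IsWaveSolution u u') :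
    ∃ g, IsAngularPowerOf (1 / 4) u g ∧ 2 * weightedIntegral g =
      ENNReal.ofReal Real.pi * (homSobolevSq (1 / 2) (u 0) + homSobolevSq (-1 / 2) (u' 0)) := by
  obtain ⟨w, Y, hw, hYc, hYw, hYn⟩ := hu.continuous.exists_curve
  obtain ⟨w', Z, hw', hZc, hZw, hZn⟩ := hu.continuous_deriv.exists_curve
  have hφ : ContDiffOn ℝ (⊤ : ℕ∞) waveDispersion.φ (Set.Ioi 0) :=
    ContDiff.contDiffOn (by simp only [waveDispersion]; fun_prop)
  have hφs : ∀ {ρ : ℝ}, 0 < ρ → waveDispersion.φ ρ = homSymbol 1 ρ := fun hρ => by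
    simp [waveDispersion, homSymbol]
  have hosc := oscillator_eq hφ waveDispersion.continuous_φ hYc hZc ?_ ?_
  · have hdata : ∀ t, w t =ᵐ[volume] fun ξ => ∑ s, ampPhase waveDispersion s t ‖ξ‖ *
        halfData (Y 0) (Z 0) s ξ := by
      intro t
      filter_upwards [hosc t, hYw t, ae_ne_zero_volume, halfData_apply (Y 0) (Z 0) true,
        halfData_apply (Y 0) (Z 0) false] with ξ h1 h2 h3 h4 h5
      have hpos := norm_pos_iff.2 h3
      have h6 : w t ξ = ((homSymbol (-1 / 2) ‖ξ‖ : ℝ) : ℂ) * Y t ξ := by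
        rw [h2, ← mul_assoc, ← Complex.ofReal_mul, homSymbol_mul _ _ hpos, homSymbol]
        norm_num
      rw [h6, h1, Fintype.sum_bool, Fintype.sum_bool, h4, h5, ampPhase, ampPhase,
        waveDispersion_amp hpos]
      ring
    obtain ⟨g, hg, hgi⟩ := exists_isAngularPowerOf temperateAmp_wave (halfData (Y 0) (Z 0)) hw hdata
    refine ⟨g, hg, ?_⟩
    rw [hgi, hYn, hZn, ← enorm_halfData]
    ring
  · intro χ hχ t
    have hχ' := hχ.mul_radial (contDiffOn_homSymbol (1 / 2))
    have h1 := hu.hasTimeDeriv.fourier hw hχ'.toSchwartz t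
    rw [apply_fourier (hw' t)] at h1
    refine (h1.congr_deriv ?_).congr_of_eventuallyEq (Eventually.of_forall fun s => ?_)
    · refine integral_congr_ae ?_
      filter_upwards [hZw t, ae_ne_zero_volume] with ξ h2 h3
      have hpos := norm_pos_iff.2 h3
      have e : ((homSymbol 1 ‖ξ‖ : ℝ) : ℂ) * ((homSymbol (-1 / 2) ‖ξ‖ : ℝ) : ℂ) =
          ((homSymbol (1 / 2) ‖ξ‖ : ℝ) : ℂ) := by
        rw [← Complex.ofReal_mul, homSymbol_mul _ _ hpos]
        norm_num
      rw [h2, hφs hpos, hχ'.toSchwartz_apply, ← e]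
      ring
    · refine integral_congr_ae ?_
      filter_upwards [hYw s] with ξ h2
      rw [h2, hχ'.toSchwartz_apply]
      ring
  · intro χ hχ t
    have hχ' := hχ.mul_radial (contDiffOn_homSymbol (-1 / 2))
    have h1 := hu.equation.fourier hw' hχ'.toSchwartz t
    rw [laplacian_apply_fourier (hw t)] at h1
    refine (h1.congr_deriv ?_).congr_of_eventuallyEq (Eventually.of_forall fun s => ?_)
    · congr 1
      refine integral_congr_ae ?_
      filter_upwards [hYw t, ae_ne_zero_volume] with ξ h2 h3
      have hpos := norm_pos_iff.2 h3
      have e : ((homSymbol (-1 / 2) ‖ξ‖ : ℝ) : ℂ) * (((2 * Real.pi * ‖ξ‖) ^ 2 : ℝ) : ℂ) =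
          ((homSymbol 1 ‖ξ‖ : ℝ) : ℂ) * ((homSymbol (1 / 2) ‖ξ‖ : ℝ) : ℂ) := by
        have e2 : (2 * Real.pi * ‖ξ‖) ^ 2 = homSymbol 2 ‖ξ‖ := by simp [homSymbol]
        rw [e2, ← Complex.ofReal_mul, ← Complex.ofReal_mul, homSymbol_mul _ _ hpos,
          homSymbol_mul _ _ hpos]
        norm_num
      rw [h2, hφs hpos, hχ'.toSchwartz_apply]
      linear_combination (χ ξ * w t ξ) * e
    · refine integral_congr_ae ?_
      filter_upwards [hZw s] with ξ h2
      rw [h2, hχ'.toSchwartz_apply]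
      ring


/-! ### The Klein–Gordon equation -/

/-- The symbol `(1 + (2π|ξ|)²)^s`, as a function of `|ξ|`. -/
def bracket (s ρ : ℝ) : ℝ := (1 + (2 * Real.pi * ρ) ^ 2) ^ s

theorem bracket_pos (s ρ : ℝ) : 0 < bracket s ρ := Real.rpow_pos_of_pos (by positivity) s

theorem bracket_mul (s s' ρ : ℝ) : bracket s ρ * bracket s' ρ = bracket (s + s') ρ :=
  (Real.rpow_add (by positivity) s s').symm

theorem bracket_zero (ρ : ℝ) : bracket 0 ρ = 1 := Real.rpow_zero _

theorem bracket_mul_eq_one {s s' : ℝ} (h : s + s' = 0) (ρ : ℝ) : bracket s ρ * bracket s' ρ = 1 := by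
  rw [bracket_mul, h, bracket_zero]

theorem bracket_one (ρ : ℝ) : bracket 1 ρ = 1 + (2 * Real.pi * ρ) ^ 2 := Real.rpow_one _

theorem bracket_le_one {s : ℝ} (hs : s ≤ 0) (ρ : ℝ) : bracket s ρ ≤ 1 :=
  Real.rpow_le_one_of_one_le_of_nonpos (by nlinarith [sq_nonneg (2 * Real.pi * ρ)]) hs

theorem hasDerivAt_bracket (s ρ : ℝ) :
    HasDerivAt (bracket s) (s * (8 * Real.pi ^ 2 * ρ) * bracket (s - 1) ρ) ρ := by
  have h1 : HasDerivAt (fun ρ : ℝ => 1 + (2 * Real.pi * ρ) ^ 2) (8 * Real.pi ^ 2 * ρ) ρ :=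
    ((((hasDerivAt_id ρ).const_mul (2 * Real.pi)).pow 2).const_add 1).congr_deriv (by
      simp; ring)
  refine (h1.rpow_const (p := s) (Or.inl (by positivity))).congr_deriv ?_
  rw [bracket]
  ring

theorem contDiff_bracket (s : ℝ) : ContDiff ℝ (⊤ : ℕ∞) (bracket s) :=
  ContDiff.rpow_const_of_ne (by fun_prop) fun ρ => by positivity

theorem contDiffOn_bracket (s : ℝ) :
    ContDiffOn ℝ (⊤ : ℕ∞) (fun ρ => ((bracket s ρ : ℝ) : ℂ)) (Set.Ioi 0) :=
  (Complex.ofRealCLM.contDiff.comp (contDiff_bracket s)).contDiffOn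

/-- The dispersion relation of the Klein–Gordon equation. -/
def kleinGordonDispersion : Dispersion where
  φ := bracket (1 / 2)
  φ' ρ := 4 * Real.pi ^ 2 * ρ * bracket (-1 / 2) ρ
  continuous_φ := (contDiff_bracket _).continuous
  continuous_φ' := by
    have := (contDiff_bracket (-1 / 2)).continuous
    fun_prop
  pos ρ _ := bracket_pos _ _
  hasDerivAt ρ _ := (hasDerivAt_bracket (1 / 2) ρ).congr_deriv (by
    rw [show (1 / 2 - 1 : ℝ) = -1 / 2 by norm_num]
    ring)
  deriv_pos ρ hρ := mul_pos (by positivity) (bracket_pos _ _)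

/-- The amplitude is the symbol of (1-Δ)^{-1/4}; the multiplier m below is the same symbol, the
inverse of the (1-Δ)^{1/4} in the statement. -/
theorem kleinGordonDispersion_amp {ρ : ℝ} (hρ : 0 < ρ) :
    kleinGordonDispersion.amp ρ = bracket (-1 / 4) ρ := by
  rw [Dispersion.amp]
  simp only [kleinGordonDispersion]
  rw [mul_div_cancel_left₀ _ (by positivity), Real.sqrt_eq_iff_mul_self_eq (bracket_pos _ _).le
    (bracket_pos _ _).le, bracket_mul]
  norm_num

theorem temperateAmp_kleinGordon : TemperateAmp kleinGordonDispersion :=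
  temperateAmp_of_le_one (fun ρ hρ => by
    rw [kleinGordonDispersion_amp hρ]
    exact bracket_le_one (by norm_num) ρ) fun ρ => Real.sqrt_nonneg _

/-- The multiplier `(1 - Δ)^{-1/4}`. -/
def bracketMultiplier : Multiplier where
  a := bracket (-1 / 4)
  measurable := (contDiff_bracket _).continuous.measurable
  continuousOn := (contDiff_bracket _).continuous.continuousOn
  abs_le_one ρ := by
    rw [abs_of_pos (bracket_pos _ _)]
    exact bracket_le_one (by norm_num) ρ

theorem fourier_weakGradient {f : L2 4} {D : Fin 4 → L2 4} (h : IsWeakGradient f D) (j : Fin 4) :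
    (𝓕 (D j) : L2 4) =ᵐ[volume] fun ξ => (2 * Real.pi * Complex.I) * ((ξ j : ℝ) : ℂ) *
      (𝓕 f : L2 4) ξ := by
  refine (represents_fourier_L2 (D j)).ae_eq ?_
  intro ψ
  have hg : (fun x : Eucl 4 => Complex.ofReal (inner ℝ x
      (EuclideanSpace.single j 1 : Eucl 4))).HasTemperateGrowth := by fun_prop
  have e := represents_fourier_L2 f (SchwartzMap.smulLeftCLM ℂ (fun x : Eucl 4 =>
    Complex.ofReal (inner ℝ x (EuclideanSpace.single j 1 : Eucl 4))) ψ)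
  have e2 : ∀ ξ : Eucl 4, ψ ξ * ((2 * Real.pi * Complex.I) * ((ξ j : ℝ) : ℂ) * (𝓕 f : L2 4) ξ) =
      (2 * Real.pi * Complex.I) * (SchwartzMap.smulLeftCLM ℂ (fun x : Eucl 4 =>
        Complex.ofReal (inner ℝ x (EuclideanSpace.single j 1 : Eucl 4))) ψ ξ * (𝓕 f : L2 4) ξ) := by
    intro ξ
    rw [SchwartzMap.smulLeftCLM_apply_apply hg, smul_eq_mul, EuclideanSpace.inner_single_right]
    simp only [conj_trivial, one_mul]
    ring
  simp only [e2]
  refine ⟨e.1.const_mul _, ?_⟩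
  rw [integral_const_mul, ← e.2, ← h j, TemperedDistribution.fourier_lineDerivOp_eq]
  rfl

/-- Plancherel with 1 + (2π|ξ|)² = 1 + Σ (2πξⱼ)²: the squared H¹ norm on the Fourier side. -/
theorem lintegral_bracket {f : L2 4} {D : Fin 4 → L2 4} (h : IsWeakGradient f D) :
    ∫⁻ ξ, ‖((bracket (1 / 2) ‖ξ‖ : ℝ) : ℂ) * (𝓕 f : L2 4) ξ‖ₑ ^ 2 =
      ‖f‖ₑ ^ 2 + ∑ j, ‖D j‖ₑ ^ 2 := by
  have hn : ∀ f : L2 4, ‖f‖ₑ ^ 2 = ∫⁻ ξ, ‖(𝓕 f : L2 4) ξ‖ₑ ^ 2 := by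
    intro f
    rw [← eLpNorm_two_sq, ← Lp.enorm_def, ← ofReal_norm, ← ofReal_norm, Lp.norm_fourier_eq]
  have hm : ∀ f : L2 4, AEMeasurable (fun ξ => ‖(𝓕 f : L2 4) ξ‖ₑ ^ 2) volume := fun f =>
    (Lp.aestronglyMeasurable _).enorm.pow_const 2
  simp only [hn]
  rw [← lintegral_finsetSum' _ fun j _ => hm (D j), ← lintegral_add_left' (hm f)]
  refine lintegral_congr_ae ?_
  filter_upwards [eventually_countable_forall.2 fun j => fourier_weakGradient h j] with ξ hξ
  simp only [hξ, ← ofReal_norm, ← ENNReal.ofReal_pow (norm_nonneg _)]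
  rw [← ENNReal.ofReal_sum_of_nonneg fun j _ => by positivity,
    ← ENNReal.ofReal_add (by positivity) (by positivity)]
  congr 1
  have e : bracket (1 / 2) ‖ξ‖ ^ 2 = 1 + (2 * Real.pi) ^ 2 * ∑ j, (ξ j) ^ 2 := by
    rw [sq, bracket_mul, show (1 / 2 + 1 / 2 : ℝ) = 1 by norm_num, bracket_one, mul_pow,
      EuclideanSpace.real_norm_sq_eq]
  rw [norm_mul, mul_pow, Complex.norm_real, Real.norm_eq_abs, sq_abs, e, add_mul, one_mul,
    Finset.mul_sum, Finset.sum_mul]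
  congr 1
  refine Finset.sum_congr rfl fun j _ => ?_
  simp only [norm_mul, Complex.norm_real, Complex.norm_I, RCLike.norm_ofNat, mul_one, mul_pow,
    Real.norm_eq_abs, sq_abs]

/-- Write φ = (1 + (2π|ξ|)²)^{1/2}. Then Y = û and Z = φ⁻¹ ∂ₜû solve Y' = φZ, Z' = -φY. As amp · m =
φ⁻¹, the half-wave data are built from φû(0) and ∂ₜû(0), whose squared norms sum to the right-hand
side. -/
theorem exists_kleinGordon {u u' : ℝ → L2 4} {D : Fin 4 → L2 4} (hu : IsKleinGordonSolution u u')
    (hD : IsWeakGradient (u 0) D) :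
    ∃ g, IsLaplacianAngularPowerOf (1 / 4) (1 / 4) (fun t => (u t : Distr 4)) g ∧
      2 * weightedIntegral g =
        ENNReal.ofReal Real.pi * (‖u 0‖ₑ ^ 2 + ∑ j, ‖D j‖ₑ ^ 2 + ‖u' 0‖ₑ ^ 2) := by
  set w : ℝ → L2 4 := fun t => 𝓕 (u t) with hw
  set w' : ℝ → L2 4 := fun t => 𝓕 (u' t) with hw'
  have hrep : ∀ t, Represents (𝓕 (u t : Distr 4)) (w t) := fun t => represents_fourier_L2 _
  have hrep' : ∀ t, Represents (𝓕 (u' t : Distr 4)) (w' t) := fun t => represents_fourier_L2 _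
  have hwc : Continuous w := (Lp.fourierTransformₗᵢ (Eucl 4) ℂ).continuous.comp hu.continuous
  have hwc' : Continuous w' :=
    (Lp.fourierTransformₗᵢ (Eucl 4) ℂ).continuous.comp hu.continuous_deriv
  have hbm : ∀ s, AEStronglyMeasurable (fun ξ : Eucl 4 => ((bracket s ‖ξ‖ : ℝ) : ℂ)) volume := by
    intro s
    have := (contDiff_bracket s).continuous
    exact Continuous.aestronglyMeasurable (by fun_prop)
  have hbn : ∀ (f : L2 4) (ξ : Eucl 4),
      ‖((bracket (-1 / 2) ‖ξ‖ : ℝ) : ℂ) * f ξ‖ ≤ ‖f ξ‖ := fun f ξ => by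
    rw [norm_mul, Complex.norm_real, Real.norm_of_nonneg (bracket_pos _ _).le]
    exact mul_le_of_le_one_left (norm_nonneg _) (bracket_le_one (by norm_num) _)
  have hmem : ∀ f : L2 4, MemLp (fun ξ => ((bracket (-1 / 2) ‖ξ‖ : ℝ) : ℂ) * f ξ) 2 volume :=
    fun f => (Lp.memLp f).mono ((hbm _).mul (Lp.aestronglyMeasurable f)) (ae_of_all _ (hbn f))
  set Z : ℝ → L2 4 := fun t => (hmem (w' t)).toLp with hZ
  have hZw : ∀ t, Z t =ᵐ[volume] fun ξ => ((bracket (-1 / 2) ‖ξ‖ : ℝ) : ℂ) * w' t ξ := fun t =>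
    (hmem (w' t)).coeFn_toLp
  have hZc : Continuous Z := by
    have hlip : ∀ t s, dist (Z t) (Z s) ≤ dist (w' t) (w' s) := by
      intro t s
      rw [dist_eq_norm, dist_eq_norm]
      refine Lp.norm_le_norm_of_ae_le ?_
      filter_upwards [Lp.coeFn_sub (Z t) (Z s), Lp.coeFn_sub (w' t) (w' s), hZw t, hZw s]
        with ξ h1 h2 h3 h4
      rw [h1, Pi.sub_apply, h3, h4, ← mul_sub, ← Pi.sub_apply, ← h2]
      exact hbn _ ξ
    rw [continuous_iff_continuousAt]
    intro t
    rw [ContinuousAt, tendsto_iff_dist_tendsto_zero]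
    exact squeeze_zero (fun s => dist_nonneg) (fun s => hlip s t)
      (tendsto_iff_dist_tendsto_zero.1 (hwc'.tendsto t))
  -- The gradient is assumed square integrable at time 0 only, so the curve Y is left unweighted and
  -- φ multiplies the initial datum alone.
  have hAmem : MemLp (fun ξ => ((bracket (1 / 2) ‖ξ‖ : ℝ) : ℂ) * w 0 ξ) 2 volume := by
    have hm : AEStronglyMeasurable (fun ξ => ((bracket (1 / 2) ‖ξ‖ : ℝ) : ℂ) * w 0 ξ) volume :=
      (hbm _).mul (Lp.aestronglyMeasurable _)
    rw [memLp_two_iff_lintegral hm, hw, lintegral_bracket hD]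
    exact ENNReal.add_lt_top.2 ⟨ENNReal.pow_lt_top (enorm_lt_top), ENNReal.sum_lt_top.2
      fun j _ => ENNReal.pow_lt_top (enorm_lt_top)⟩
  have hAn : ‖hAmem.toLp‖ₑ ^ 2 = ‖u 0‖ₑ ^ 2 + ∑ j, ‖D j‖ₑ ^ 2 := by
    rw [Lp.enorm_toLp, eLpNorm_two_sq, ← lintegral_bracket hD]
  have hBn : ‖w' 0‖ₑ = ‖u' 0‖ₑ := by
    rw [← ofReal_norm, ← ofReal_norm, hw', Lp.norm_fourier_eq]
  have hosc := oscillator_eq (φ := kleinGordonDispersion.φ) (contDiff_bracket _).contDiffOn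
    kleinGordonDispersion.continuous_φ hwc hZc ?_ ?_
  · have hm : ∀ ξ : Eucl 4, bracketMultiplier.a ‖ξ‖ * inhomSymbol 4 (1 / 4) ξ = 1 := by
      intro ξ
      change bracket (-1 / 4) ‖ξ‖ * bracket (1 / 4) ‖ξ‖ = 1
      exact bracket_mul_eq_one (by norm_num) _
    have hdata : ∀ t, w t =ᵐ[volume] fun ξ => ∑ s, ampPhase kleinGordonDispersion s t ‖ξ‖ *
        (((bracketMultiplier.a ‖ξ‖ : ℝ) : ℂ) * halfData hAmem.toLp (w' 0) s ξ) := by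
      intro t
      filter_upwards [hosc t, hZw 0, ae_ne_zero_volume, halfData_apply hAmem.toLp (w' 0) true,
        halfData_apply hAmem.toLp (w' 0) false, hAmem.coeFn_toLp] with ξ h1 h2 h3 h4 h5 h6
      have hpos := norm_pos_iff.2 h3
      have e1 : ((bracket (-1 / 4) ‖ξ‖ : ℝ) : ℂ) * ((bracket (-1 / 4) ‖ξ‖ : ℝ) : ℂ) =
          ((bracket (-1 / 2) ‖ξ‖ : ℝ) : ℂ) := by
        rw [← Complex.ofReal_mul, bracket_mul]
        norm_num
      have e2 : ((bracket (-1 / 2) ‖ξ‖ : ℝ) : ℂ) * ((bracket (1 / 2) ‖ξ‖ : ℝ) : ℂ) = 1 := by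
        rw [← Complex.ofReal_mul, bracket_mul_eq_one (by norm_num), Complex.ofReal_one]
      rw [h1, Fintype.sum_bool, Fintype.sum_bool, h4, h5, h6, h2, ampPhase, ampPhase,
        kleinGordonDispersion_amp hpos]
      change _ = ((bracket (-1 / 4) ‖ξ‖ : ℝ) : ℂ) * _ *
        (((bracket (-1 / 4) ‖ξ‖ : ℝ) : ℂ) * _) + ((bracket (-1 / 4) ‖ξ‖ : ℝ) : ℂ) * _ *
        (((bracket (-1 / 4) ‖ξ‖ : ℝ) : ℂ) * _)
      have e3 : ∀ E X V : ℂ, E * (2⁻¹ * (w 0 ξ + X * (((bracket (-1 / 2) ‖ξ‖ : ℝ) : ℂ) * V))) =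
          ((bracket (-1 / 4) ‖ξ‖ : ℝ) : ℂ) * E * (((bracket (-1 / 4) ‖ξ‖ : ℝ) : ℂ) *
            (2⁻¹ * (((bracket (1 / 2) ‖ξ‖ : ℝ) : ℂ) * w 0 ξ + X * V))) := by
        intro E X V
        linear_combination (-(E * 2⁻¹ * (((bracket (1 / 2) ‖ξ‖ : ℝ) : ℂ) * w 0 ξ + X * V))) * e1 -
          (E * 2⁻¹ * w 0 ξ) * e2
      rw [e3, e3]
    obtain ⟨g, hg, hgi⟩ := exists_isLaplacianAngularPowerOf temperateAmp_kleinGordon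
      bracketMultiplier hm (halfData hAmem.toLp (w' 0)) hrep hdata
    refine ⟨g, hg, ?_⟩
    rw [hgi, ← hAn, ← hBn, ← enorm_halfData]
    ring
  · intro χ hχ t
    have h1 := hu.hasTimeDeriv.fourier hrep hχ.toSchwartz t
    rw [apply_fourier (hrep' t)] at h1
    refine h1.congr_deriv (integral_congr_ae ?_)
    filter_upwards [hZw t] with ξ h2
    have e2 : ((bracket (1 / 2) ‖ξ‖ : ℝ) : ℂ) * ((bracket (-1 / 2) ‖ξ‖ : ℝ) : ℂ) = 1 := by
      rw [← Complex.ofReal_mul, bracket_mul_eq_one (by norm_num), Complex.ofReal_one]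
    rw [h2, hχ.toSchwartz_apply]
    change _ = ((bracket (1 / 2) ‖ξ‖ : ℝ) : ℂ) * χ ξ * _
    linear_combination (-(χ ξ * w' t ξ)) * e2
  · intro χ hχ t
    have hχ' := hχ.mul_radial (contDiffOn_bracket (-1 / 2))
    have h1 := hu.equation.fourier hrep' hχ'.toSchwartz t
    change HasDerivAt _ ((Δ (u t : Distr 4)) (𝓕 hχ'.toSchwartz) - (u t : Distr 4) (𝓕 hχ'.toSchwartz)) t
      at h1
    rw [laplacian_apply_fourier (hrep t), apply_fourier (hrep t)] at h1
    have hInt1 : Integrable fun ξ => hχ'.toSchwartz ξ * w t ξ := integrable_test_mul hχ' (w t)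
    have hInt2 : Integrable fun ξ => hχ'.toSchwartz ξ *
        ((((2 * Real.pi * ‖ξ‖) ^ 2 : ℝ) : ℂ) * w t ξ) := by
      have hpoly : ContDiffOn ℝ (⊤ : ℕ∞) (fun ρ : ℝ => (((2 * Real.pi * ρ) ^ 2 : ℝ) : ℂ))
          (Set.Ioi 0) := (Complex.ofRealCLM.contDiff.comp
            (by fun_prop : ContDiff ℝ (⊤ : ℕ∞) fun ρ : ℝ => (2 * Real.pi * ρ) ^ 2)).contDiffOn
      refine (integrable_test_mul (hχ'.mul_radial hpoly) (w t)).congr (ae_of_all _ fun ξ => ?_)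
      simp only [hχ'.toSchwartz_apply]
      ring
    refine (h1.congr_deriv ?_).congr_of_eventuallyEq (Eventually.of_forall fun s => ?_)
    · rw [← neg_add', ← integral_add hInt2 hInt1]
      congr 1
      refine integral_congr_ae (ae_of_all _ fun ξ => ?_)
      have e : ((bracket (-1 / 2) ‖ξ‖ : ℝ) : ℂ) * (1 + (((2 * Real.pi * ‖ξ‖) ^ 2 : ℝ) : ℂ)) =
          ((bracket (1 / 2) ‖ξ‖ : ℝ) : ℂ) := by
        rw [← Complex.ofReal_one, ← Complex.ofReal_add, ← bracket_one, ← Complex.ofReal_mul,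
          bracket_mul]
        norm_num
      change ((bracket (-1 / 2) ‖ξ‖ : ℝ) : ℂ) * χ ξ * _ + ((bracket (-1 / 2) ‖ξ‖ : ℝ) : ℂ) * χ ξ * _ =
        ((bracket (1 / 2) ‖ξ‖ : ℝ) : ℂ) * χ ξ * _
      linear_combination (χ ξ * w t ξ) * e
    · refine integral_congr_ae ?_
      filter_upwards [hZw s] with ξ h2
      rw [h2, hχ'.toSchwartz_apply]
      ring

end AngularSmoothing

end

/-! ### The three smoothing identities -/

theorem theorem1p2 :
    -- the Schrödinger equation on `ℝ^{4+1}`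
    (∀ u : ℝ → AngularSmoothing.L2 4, AngularSmoothing.IsSchrodingerSolution u →
      (∃ g, AngularSmoothing.IsAngularPowerOf (1 / 4)
        (fun t => (u t : AngularSmoothing.Distr 4)) g) ∧
      ∀ g, AngularSmoothing.IsAngularPowerOf (1 / 4)
          (fun t => (u t : AngularSmoothing.Distr 4)) g →
        AngularSmoothing.weightedIntegral g = ENNReal.ofReal Real.pi * ‖u 0‖ₑ ^ 2) ∧
    -- the wave equation on `ℝ^{4+1}`
    (∀ u u' : ℝ → AngularSmoothing.Distr 4, AngularSmoothing.IsWaveSolution u u' →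
      (∃ g, AngularSmoothing.IsAngularPowerOf (1 / 4) u g) ∧
      ∀ g, AngularSmoothing.IsAngularPowerOf (1 / 4) u g →
        2 * AngularSmoothing.weightedIntegral g =
          ENNReal.ofReal Real.pi * (AngularSmoothing.homSobolevSq (1 / 2) (u 0) +
            AngularSmoothing.homSobolevSq (-1 / 2) (u' 0))) ∧
    -- the Klein–Gordon equation on `ℝ^{4+1}`
    (∀ (u u' : ℝ → AngularSmoothing.L2 4) (D : Fin 4 → AngularSmoothing.L2 4),
      AngularSmoothing.IsKleinGordonSolution u u' → AngularSmoothing.IsWeakGradient (u 0) D →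
      (∃ g, AngularSmoothing.IsLaplacianAngularPowerOf (1 / 4) (1 / 4)
        (fun t => (u t : AngularSmoothing.Distr 4)) g) ∧
      ∀ g, AngularSmoothing.IsLaplacianAngularPowerOf (1 / 4) (1 / 4)
          (fun t => (u t : AngularSmoothing.Distr 4)) g →
        2 * AngularSmoothing.weightedIntegral g =
          ENNReal.ofReal Real.pi * (‖u 0‖ₑ ^ 2 + ∑ j, ‖D j‖ₑ ^ 2 + ‖u' 0‖ₑ ^ 2)) := by
  refine ⟨fun u hu => ?_, fun u u' hu => ?_, fun u u' D hu hD => ?_⟩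
  · obtain ⟨g, hg, hgi⟩ := AngularSmoothing.exists_schrodinger hu
    exact ⟨⟨g, hg⟩, fun g' hg' => (hg'.weightedIntegral_eq hg).trans hgi⟩
  · obtain ⟨g, hg, hgi⟩ := AngularSmoothing.exists_wave hu
    exact ⟨⟨g, hg⟩, fun g' hg' => by rw [hg'.weightedIntegral_eq hg, hgi]⟩
  · obtain ⟨g, hg, hgi⟩ := AngularSmoothing.exists_kleinGordon hu hD
    exact ⟨⟨g, hg⟩, fun g' hg' => by rw [hg'.weightedIntegral_eq hg, hgi]⟩
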